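/- **Conventions.** A space is locally compact if every point has a compact Hausdorff neighbourhood. A locally compact groupoid $G$ is a topological groupoid whose arrow space is locally compact and whose unit space $G^{(0)}$ is Hausdorff; $r,s$ are its range and source maps and $G^u=r^{-1}(u)$. On a locally compact space $W$, $C_c(W)$ is the linear span of the functions that are continuous on some open Hausdorff subset $V\subseteq W$ and vanish outside a compact subset of $V$ (the usual $C_c(W)$ if $W$ is Hausdorff). A *proper continuous family of measures* along $\pi\colon W\to V$ consists of $\sigma$-finite Radon measures $\nu_v$ on $\pi^{-1}(v)$, $v\in V$, with support equal to $\pi^{-1}(v)$, such that $v\mapsto\int f\,d\nu_v$ is continuous for all $f\in C_c(W)$. A Haar system on $G$ is a left invariant proper continuous family of measures along $r$. For a left (right) $G$-space $W$ the momentum map is denoted $r_W$ ($s_W$), and $W_u=s_W^{-1}(u)$; $G\ltimes W=\{(\gamma,w): s(\gamma)=r_W(w)\}$. A *topological correspondence* from $(G,\chi)$ to $(H,\kappa)$ (locally compact groupoids with Haar systems) is a pair $(W,\nu)$ where $W$ is a locally compact $G$-$H$-bispace with proper $H$-action and $\nu=\{\nu_u\}_{u\in H^{(0)}}$ is an $H$-invariant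 proper continuous family of measures along $s_W$ such that there is a continuous function $\Delta\colon G\ltimes W\to(0,\infty)$ with, for all $u\in H^{(0)}$ and $F\in C_c(G\ltimes W)$, $$\int_{W_u}\int_{G^{r_W(w)}}F(\gamma^{-1},w)\,d\chi^{r_W(w)}(\gamma)\,d\nu_u(w)=\int_{W_u}\int_{G^{r_W(w)}}F(\gamma,\gamma^{-1}w)\,\Delta(\gamma,\gamma^{-1}w)\,d\chi^{r_W(w)}(\gamma)\,d\nu_u(w).$$ The last condition is the $(G,\chi)$-quasi-invariance of the measures $\nu_u$, and $\Delta$ is called an adjoining function. **Setting.** Let $(X,\alpha)\colon(G_1,\chi_1)\to(G_2,\chi_2)$ and $(Y,\beta)\colon(G_2,\chi_2)\to(G_3,\chi_3)$ be topological correspondences with adjoining functions $\Delta_1$ and $\Delta_2$, where $X$ and $Y$ are Hausdorff and second countable. Let $Z=\{(x,y)\in X\times Y: s_X(x)=r_Y(y)\}$ with the diagonal $G_2$-action $(x,y)\gamma=(x\gamma,\gamma^{-1}y)$, let $\Omega=Z/G_2$ with the $G_1$-$G_3$-bispace structure $\eta[x,y]\gamma=[\eta x,y\gamma]$, and assume that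 the transformation groupoid $Z\rtimes G_2$ is Hausdorff (automatic if $G_2$ is Hausdorff or acts freely on $X$). For $f\in C_c(Z)$ put $$\Lambda(f)([x,y])=\int_{G_2^{s_X(x)}}f(x\gamma,\gamma^{-1}y)\,d\chi_2^{s_X(x)}(\gamma).$$ **Proposition.** The space $\Omega$ is Hausdorff and second countable. There is a continuous $G_3$-invariant function $b\colon Z\to(0,\infty)$ with $$b(x\gamma,\gamma^{-1}y)\,b(x,y)^{-1}=\Delta_2(\gamma^{-1},y)\qquad\text{for all }((x,y),\gamma)\in Z\rtimes G_2.$$ For each such $b$ there is a unique family $\mu=\{\mu_u\}_{u\in G_3^{(0)}}$ of Radon measures $\mu_u$ on $\Omega_u$ with $$\int_{Y_u}\int_{X_{r_Y(y)}}f(x,y)\,b(x,y)\,d\alpha_{r_Y(y)}(x)\,d\beta_u(y)=\int_{\Omega_u}\Lambda(f)\,d\mu_u\qquad\text{for all }f\in C_c(Z),\ u\in G_3^{(0)}.$$ For this family, each $\mu_u$ is $(G_1,\chi_1)$-quasi-invariant and $(\Omega,\mu)$ is a topological correspondence from $(G_1,\chi_1)$ to $(G_3,\chi_3)$. The formula $$\Delta_{1,2}(\eta,[x,y])=b(\eta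 x,y)^{-1}\,\Delta_1(\eta,x)\,b(x,y)$$ gives a well-defined continuous $(0,\infty)$-valued $1$-cocycle (groupoid homomorphism) on $G_1\ltimes\Omega$, and $\Delta_{1,2}$ is the unique adjoining function of $(\Omega,\mu)$. -/

import Mathlib

open MeasureTheory

/-- A topological groupoid with space of arrows `G` and space of units `U`.  Since `unit` is
continuous with continuous left inverse `src`, it identifies `U` with the subspace of unit arrows
of `G`. The product `g h` is defined exactly when `src g = rng h`. -/
structure TopGroupoid (G U : Type*) [TopologicalSpace G] [TopologicalSpace U] where
  src : G → U
  rng : G → U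
  unit : U → G
  inv : G → G
  mul : (g h : G) → src g = rng h → G
  src_unit : ∀ u, src (unit u) = u
  rng_unit : ∀ u, rng (unit u) = u
  src_inv : ∀ g, src (inv g) = rng g
  rng_inv : ∀ g, rng (inv g) = src g
  src_mul : ∀ g h p, src (mul g h p) = src h
  rng_mul : ∀ g h p, rng (mul g h p) = rng g
  unit_mul : ∀ g, mul (unit (rng g)) g (src_unit _) = g
  mul_unit : ∀ g, mul g (unit (src g)) (rng_unit _).symm = g
  inv_mul : ∀ g, mul (inv g) g (src_inv g) = unit (src g)
  mul_inv : ∀ g, mul g (inv g) (rng_inv g).symm = unit (rng g)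
  mul_assoc : ∀ g h k (p : src g = rng h) (q : src h = rng k),
    mul (mul g h p) k ((src_mul g h p).trans q) = mul g (mul h k q) (p.trans (rng_mul h k q).symm)
  continuous_src : Continuous src
  continuous_rng : Continuous rng
  continuous_unit : Continuous unit
  continuous_inv : Continuous inv
  continuous_mul : Continuous fun p : {p : G × G // src p.1 = rng p.2} => mul p.1.1 p.1.2 p.2

namespace TopGroupoid

variable {G U : Type*} [TopologicalSpace G] [TopologicalSpace U] (𝒢 : TopGroupoid G U)

theorem mul_congr {g g' h h' : G} (p : 𝒢.src g = 𝒢.rng h) (hg : g = g') (hh : h = h') :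
    𝒢.mul g h p = 𝒢.mul g' h' (hg ▸ hh ▸ p) := by
  subst hg hh; rfl

theorem inv_mul_cancel_left (g h : G) (p : 𝒢.src g = 𝒢.rng h) :
    𝒢.mul (𝒢.inv g) (𝒢.mul g h p) ((𝒢.src_inv g).trans (𝒢.rng_mul g h p).symm) = h := by
  rw [← 𝒢.mul_assoc (𝒢.inv g) g h (𝒢.src_inv g) p,
    𝒢.mul_congr _ ((𝒢.inv_mul g).trans (congrArg 𝒢.unit p)) rfl, 𝒢.unit_mul]

/-- The inverse is determined by `g h = r(g)`. -/
theorem eq_inv_of_mul_eq_unit (g h : G) (p : 𝒢.src g = 𝒢.rng h)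
    (e : 𝒢.mul g h p = 𝒢.unit (𝒢.rng g)) : h = 𝒢.inv g := by
  rw [← 𝒢.inv_mul_cancel_left g h p, 𝒢.mul_congr _ rfl (e.trans
    (congrArg 𝒢.unit (𝒢.src_inv g).symm)), 𝒢.mul_unit]

theorem inv_inv (g : G) : 𝒢.inv (𝒢.inv g) = g :=
  (𝒢.eq_inv_of_mul_eq_unit (𝒢.inv g) g (𝒢.src_inv g)
    ((𝒢.inv_mul g).trans (congrArg 𝒢.unit (𝒢.rng_inv g).symm))).symm

theorem inv_unit (u : U) : 𝒢.inv (𝒢.unit u) = 𝒢.unit u := by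
  refine (𝒢.eq_inv_of_mul_eq_unit (𝒢.unit u) (𝒢.unit u)
    ((𝒢.src_unit u).trans (𝒢.rng_unit u).symm) ?_).symm
  rw [𝒢.mul_congr (g' := 𝒢.unit (𝒢.rng (𝒢.unit u))) (h' := 𝒢.unit u) _
    (congrArg 𝒢.unit (𝒢.rng_unit u).symm) rfl, 𝒢.unit_mul, 𝒢.rng_unit]

theorem inv_mul_rev (g h : G) (p : 𝒢.src g = 𝒢.rng h) :
    𝒢.inv (𝒢.mul g h p) = 𝒢.mul (𝒢.inv h) (𝒢.inv g)
      ((𝒢.src_inv h).trans (p.symm.trans (𝒢.rng_inv g).symm)) := by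
  refine (𝒢.eq_inv_of_mul_eq_unit _ _ ?_ ?_).symm
  · rw [𝒢.src_mul, 𝒢.rng_mul, 𝒢.rng_inv]
  · have q : 𝒢.src (𝒢.inv h) = 𝒢.rng (𝒢.inv g) := by rw [𝒢.src_inv, 𝒢.rng_inv, p]
    have e : 𝒢.mul h (𝒢.mul (𝒢.inv h) (𝒢.inv g) q)
        ((𝒢.rng_inv h).symm.trans (𝒢.rng_mul _ _ q).symm) = 𝒢.inv g := by
      rw [← 𝒢.mul_assoc h (𝒢.inv h) (𝒢.inv g) (𝒢.rng_inv h).symm q,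
        𝒢.mul_congr _ ((𝒢.mul_inv h).trans (congrArg 𝒢.unit
          (p.symm.trans (𝒢.rng_inv g).symm))) rfl, 𝒢.unit_mul]
    rw [𝒢.mul_assoc g h _ p ((𝒢.rng_inv h).symm.trans (𝒢.rng_mul _ _ q).symm),
      𝒢.mul_congr _ rfl e, 𝒢.mul_inv, 𝒢.rng_mul]

/-- Left translation by `η`, as a map `G^{s(η)} → G^{r(η)}` between fibres of the range map. -/
def leftMul (η : G) (γ : {γ : G // 𝒢.rng γ = 𝒢.src η}) : {γ : G // 𝒢.rng γ = 𝒢.rng η} :=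
  ⟨𝒢.mul η γ γ.2.symm, 𝒢.rng_mul _ _ _⟩

/-- Left translation is a homeomorphism of the range fibres. -/
def leftMulHomeo (η : G) :
    {γ : G // 𝒢.rng γ = 𝒢.src η} ≃ₜ {γ : G // 𝒢.rng γ = 𝒢.rng η} where
  toFun := 𝒢.leftMul η
  invFun γ := ⟨𝒢.mul (𝒢.inv η) γ ((𝒢.src_inv η).trans γ.2.symm),
    (𝒢.rng_mul _ _ _).trans (𝒢.rng_inv η)⟩
  left_inv γ := Subtype.ext (𝒢.inv_mul_cancel_left η γ γ.2.symm)
  right_inv γ := by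
    refine Subtype.ext ?_
    have := 𝒢.inv_mul_cancel_left (𝒢.inv η) γ ((𝒢.src_inv η).trans γ.2.symm)
    rw [𝒢.mul_congr _ (𝒢.inv_inv η) rfl] at this
    exact this
  continuous_toFun := by
    refine Continuous.subtype_mk ?_ _
    exact 𝒢.continuous_mul.comp (Continuous.subtype_mk (f := fun γ :
      {γ : G // 𝒢.rng γ = 𝒢.src η} => ((η, γ.1) : G × G)) (by fun_prop) fun γ => γ.2.symm)
  continuous_invFun := by
    refine Continuous.subtype_mk ?_ _
    exact 𝒢.continuous_mul.comp (Continuous.subtype_mk (f := fun γ :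
      {γ : G // 𝒢.rng γ = 𝒢.rng η} => ((𝒢.inv η, γ.1) : G × G)) (by fun_prop)
      fun γ => (𝒢.src_inv η).trans γ.2.symm)

end TopGroupoid

/-- A space is locally compact if every point has a compact Hausdorff neighbourhood. The space
itself need not be Hausdorff. -/
def IsLocallyCompact (X : Type*) [TopologicalSpace X] : Prop :=
  ∀ x : X, ∃ K ∈ nhds x, IsCompact K ∧ T2Space K

/-- The space `C_c(X)` of real-valued test functions on a locally compact, possibly non-Hausdorff
space: the span of the functions that are continuous on some open Hausdorff subset `W` and vanish
outside a compact subset of `W`. -/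
def Cc (X : Type*) [TopologicalSpace X] : Submodule ℝ (X → ℝ) :=
  Submodule.span ℝ {f | ∃ W : Set X, IsOpen W ∧ T2Space W ∧ ContinuousOn f W ∧
    ∃ K ⊆ W, IsCompact K ∧ ∀ x ∉ K, f x = 0}

/-- On a Hausdorff space, `C_c(X)` is the usual space of continuous compactly supported
functions. -/
theorem mem_Cc_iff {X : Type*} [TopologicalSpace X] [T2Space X] (f : X → ℝ) :
    f ∈ Cc X ↔ Continuous f ∧ HasCompactSupport f := by
  constructor
  · intro hf
    induction hf using Submodule.span_induction with
    | mem f hf =>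
      obtain ⟨W, hW, -, hc, K, hKW, hK, h0⟩ := hf
      refine ⟨continuous_iff_continuousAt.2 fun x => ?_, HasCompactSupport.intro hK h0⟩
      by_cases hx : x ∈ W
      · exact hc.continuousAt (hW.mem_nhds hx)
      · have : f =ᶠ[nhds x] fun _ => 0 := by
          filter_upwards [hK.isClosed.isOpen_compl.mem_nhds fun h => hx (hKW h)] with y hy
          exact h0 y hy
        exact this.continuousAt
    | zero => exact ⟨continuous_const, HasCompactSupport.zero⟩
    | add f g _ _ hf hg => exact ⟨hf.1.add hg.1, hf.2.add hg.2⟩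
    | smul a f _ hf => exact ⟨hf.1.const_smul a, hf.2.smul_left (f := fun _ => a)⟩
  · rintro ⟨hc, hs⟩
    exact Submodule.subset_span ⟨Set.univ, isOpen_univ, inferInstance, hc.continuousOn,
      tsupport f, Set.subset_univ _, hs, fun x hx => image_eq_zero_of_notMem_tsupport hx⟩

/-- A proper continuous family of measures along `π : X → V`: for every `v` a σ-finite Radon
measure on the fibre `π⁻¹(v)` whose support is the whole fibre, such that the integral of each
function in `C_c(X)` depends continuously on `v`. -/
structure IsContinuousFamily {X V : Type*} [TopologicalSpace X] [TopologicalSpace V]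
    [MeasurableSpace X] (π : X → V) (ν : ∀ v, Measure {x : X // π x = v}) : Prop where
  regular : ∀ v, (ν v).Regular
  sigmaFinite : ∀ v, SigmaFinite (ν v)
  fullSupport : ∀ v, (ν v).IsOpenPosMeasure
  continuous_integral : ∀ f ∈ Cc X, Continuous fun v => ∫ x : {x : X // π x = v}, f x ∂(ν v)

/-- A (left) Haar system: a continuous family of measures of full support along the range map,
invariant under left translation. -/
structure HaarSystem {G U : Type*} [TopologicalSpace G] [TopologicalSpace U] [MeasurableSpace G]
    (𝒢 : TopGroupoid G U) where
  meas : ∀ u, Measure {γ : G // 𝒢.rng γ = u}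
  isContinuousFamily : IsContinuousFamily 𝒢.rng meas
  invariant : ∀ η, (meas (𝒢.src η)).map (𝒢.leftMul η) = meas (𝒢.rng η)

/-- A left action of a groupoid on a set; `g x` is defined exactly when `src g = mom x`. -/
structure LeftAction {G U : Type*} [TopologicalSpace G] [TopologicalSpace U]
    (𝒢 : TopGroupoid G U) (X : Type*) where
  mom : X → U
  act : (g : G) → (x : X) → 𝒢.src g = mom x → X
  mom_act : ∀ g x p, mom (act g x p) = 𝒢.rng g
  unit_act : ∀ x, act (𝒢.unit (mom x)) x (𝒢.src_unit _) = x
  mul_act : ∀ g h x (q : 𝒢.src g = 𝒢.rng h) (p : 𝒢.src h = mom x),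
    act (𝒢.mul g h q) x ((𝒢.src_mul g h q).trans p) = act g (act h x p) (q.trans (mom_act h x p).symm)

/-- A right action of a groupoid on a set; `x g` is defined exactly when `mom x = rng g`. -/
structure RightAction {G U : Type*} [TopologicalSpace G] [TopologicalSpace U]
    (𝒢 : TopGroupoid G U) (X : Type*) where
  mom : X → U
  act : (x : X) → (g : G) → mom x = 𝒢.rng g → X
  mom_act : ∀ x g p, mom (act x g p) = 𝒢.src g
  act_unit : ∀ x, act x (𝒢.unit (mom x)) (𝒢.rng_unit _).symm = x
  act_mul : ∀ x g h (p : mom x = 𝒢.rng g) (q : 𝒢.src g = 𝒢.rng h),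
    act x (𝒢.mul g h q) (p.trans (𝒢.rng_mul g h q).symm) = act (act x g p) h ((mom_act x g p).trans q)

namespace LeftAction

variable {G U X : Type*} [TopologicalSpace G] [TopologicalSpace U]
  {𝒢 : TopGroupoid G U} (L : LeftAction 𝒢 X)

theorem act_congr {g g' : G} {x x' : X} (p : 𝒢.src g = L.mom x) (hg : g = g') (hx : x = x') :
    L.act g x p = L.act g' x' (hg ▸ hx ▸ p) := by
  subst hg hx; rfl

/-- The space of arrows of the transformation groupoid `G ⋉ X`. -/
abbrev Arrows : Type _ := {p : G × X // 𝒢.src p.1 = L.mom p.2}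

/-- The momentum map and the action map are continuous. -/
structure IsContinuous [TopologicalSpace X] : Prop where
  continuous_mom : Continuous L.mom
  continuous_act : Continuous fun p : L.Arrows => L.act p.1.1 p.1.2 p.2

/-- `Δ : G ⋉ X → ℝ` is a multiplicative `1`-cocycle: it is a homomorphism on the transformation
groupoid, in which `(g, h x) (h, x) = (g h, x)`. -/
def IsCocycle (Δ : L.Arrows → ℝ) : Prop :=
  ∀ (g h : G) (x : X) (q : 𝒢.src g = 𝒢.rng h) (p : 𝒢.src h = L.mom x),
    Δ ⟨(𝒢.mul g h q, x), (𝒢.src_mul g h q).trans p⟩ =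
      Δ ⟨(g, L.act h x p), q.trans (L.mom_act h x p).symm⟩ * Δ ⟨(h, x), p⟩

/-- `Δ` is an adjoining function for the family `ν` along `π : X → V`, i.e. it implements the
`(G, χ)`-quasi-invariance of every measure `ν v`. -/
structure IsAdjoiningFunction {V : Type*} [TopologicalSpace X] [MeasurableSpace G]
    [MeasurableSpace X] (χ : HaarSystem 𝒢) (π : X → V) (ν : ∀ v, Measure {x : X // π x = v})
    (Δ : L.Arrows → ℝ) : Prop where
  continuous : Continuous Δ
  pos : ∀ a, 0 < Δ a
  integral_eq : ∀ v, ∀ F ∈ Cc L.Arrows,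
    ∫ x : {x : X // π x = v}, ∫ γ : {γ : G // 𝒢.rng γ = L.mom x},
        F ⟨(𝒢.inv γ, x), (𝒢.src_inv γ).trans γ.2⟩ ∂(χ.meas (L.mom x)) ∂(ν v) =
    ∫ x : {x : X // π x = v}, ∫ γ : {γ : G // 𝒢.rng γ = L.mom x},
        F ⟨(γ, L.act (𝒢.inv γ) x ((𝒢.src_inv γ).trans γ.2)),
            ((L.mom_act _ _ _).trans (𝒢.rng_inv γ)).symm⟩ *
          Δ ⟨(γ, L.act (𝒢.inv γ) x ((𝒢.src_inv γ).trans γ.2)),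
            ((L.mom_act _ _ _).trans (𝒢.rng_inv γ)).symm⟩ ∂(χ.meas (L.mom x)) ∂(ν v)

end LeftAction

namespace RightAction

variable {G U X : Type*} [TopologicalSpace G] [TopologicalSpace U]
  {𝒢 : TopGroupoid G U} (R : RightAction 𝒢 X)

theorem act_congr {g g' : G} {x x' : X} (p : R.mom x = 𝒢.rng g) (hx : x = x') (hg : g = g') :
    R.act x g p = R.act x' g' (hg ▸ hx ▸ p) := by
  subst hg hx; rfl

theorem act_act_inv (x : X) (g : G) (p : R.mom x = 𝒢.rng g) :
    R.act (R.act x g p) (𝒢.inv g) ((R.mom_act x g p).trans (𝒢.rng_inv g).symm) = x := by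
  rw [← R.act_mul x g (𝒢.inv g) p (𝒢.rng_inv g).symm,
    R.act_congr _ rfl ((𝒢.mul_inv g).trans (congrArg 𝒢.unit p.symm)), R.act_unit]

/-- The fibre product over the units on which the action is defined. -/
abbrev Arrows : Type _ := {p : X × G // R.mom p.1 = 𝒢.rng p.2}

/-- The momentum map and the action map are continuous. -/
structure IsContinuous [TopologicalSpace X] : Prop where
  continuous_mom : Continuous R.mom
  continuous_act : Continuous fun p : R.Arrows => R.act p.1.1 p.1.2 p.2

/-- The action is proper: `(x, g) ↦ (x, x g)` is a proper map. -/
def IsProper [TopologicalSpace X] : Prop :=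
  IsProperMap fun p : R.Arrows => (p.1.1, R.act p.1.1 p.1.2 p.2)

/-- Right translation by `g`, as a map `X_{r(g)} → X_{s(g)}` between fibres of the momentum map. -/
def translate (g : G) (x : {x : X // R.mom x = 𝒢.rng g}) : {x : X // R.mom x = 𝒢.src g} :=
  ⟨R.act x g x.2, R.mom_act _ _ _⟩

/-- Invariance of a family of measures along the momentum map under right translations. -/
def IsInvariant [MeasurableSpace X] (ν : ∀ u, Measure {x : X // R.mom x = u}) : Prop :=
  ∀ g, (ν (𝒢.rng g)).map (R.translate g) = ν (𝒢.src g)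

/-- Two points are equivalent if they are in the same orbit. -/
def orbitSetoid : Setoid X where
  r x y := ∃ (g : G) (p : R.mom x = 𝒢.rng g), y = R.act x g p
  iseqv :=
    { refl := fun x => ⟨𝒢.unit (R.mom x), (𝒢.rng_unit _).symm, (R.act_unit x).symm⟩
      symm := by
        rintro x _ ⟨g, p, rfl⟩
        exact ⟨𝒢.inv g, (R.mom_act x g p).trans (𝒢.rng_inv g).symm, (R.act_act_inv x g p).symm⟩
      trans := by
        rintro x _ _ ⟨g, p, rfl⟩ ⟨h, q, rfl⟩
        exact ⟨𝒢.mul g h ((R.mom_act x g p).symm.trans q), p.trans (𝒢.rng_mul _ _ _).symm,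
          (R.act_mul x g h p _).symm⟩ }

/-- The integral of `f` over the orbits: `x ↦ ∫ f (x γ) dχ^{s(x)}(γ)`. -/
noncomputable def fiberIntegral [MeasurableSpace G] (χ : HaarSystem 𝒢) (f : X → ℝ) (x : X) : ℝ :=
  ∫ γ : {γ : G // 𝒢.rng γ = R.mom x}, f (R.act x γ γ.2.symm) ∂(χ.meas (R.mom x))

theorem fiberIntegral_act [MeasurableSpace G] [BorelSpace G] (χ : HaarSystem 𝒢) (f : X → ℝ)
    (x : X) (η : G) (p : R.mom x = 𝒢.rng η) :
    R.fiberIntegral χ f (R.act x η p) = R.fiberIntegral χ f x := by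
  have aux : ∀ (y : X) (u : U) (hu : R.mom y = u), R.fiberIntegral χ f y =
      ∫ γ : {γ : G // 𝒢.rng γ = u}, f (R.act y γ (hu.trans γ.2.symm)) ∂(χ.meas u) := by
    rintro y u rfl; rfl
  rw [aux _ _ (R.mom_act x η p), aux x _ p, ← χ.invariant η]
  have hemb : MeasurableEmbedding (𝒢.leftMul η) := (𝒢.leftMulHomeo η).measurableEmbedding
  rw [hemb.integral_map]
  refine integral_congr_ae (Filter.Eventually.of_forall fun γ => ?_)
  exact congrArg f (R.act_mul x η γ p γ.2.symm).symm

end RightAction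

/-- A left and a right action on `X` that commute, so that `X` is a bispace. -/
structure ActionsCommute {G U H V X : Type*} [TopologicalSpace G] [TopologicalSpace U]
    [TopologicalSpace H] [TopologicalSpace V] {𝒢 : TopGroupoid G U} {ℋ : TopGroupoid H V}
    (L : LeftAction 𝒢 X) (R : RightAction ℋ X) : Prop where
  mom_left : ∀ x h p, L.mom (R.act x h p) = L.mom x
  mom_right : ∀ g x p, R.mom (L.act g x p) = R.mom x
  act_act : ∀ g x h (p : 𝒢.src g = L.mom x) (q : R.mom x = ℋ.rng h),
    R.act (L.act g x p) h ((mom_right g x p).trans q) =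
      L.act g (R.act x h q) (p.trans (mom_left x h q).symm)

/-- `(X, ν)` is a topological correspondence from `(G, α)` to `(H, β)`: a locally compact
`G`-`H`-bispace on which `H` acts properly, with an `H`-invariant proper continuous
family of measures along the right momentum map which is `(G, α)`-quasi-invariant with a
continuous adjoining function. -/
structure IsTopCorrespondence {G U H V X : Type*} [TopologicalSpace G] [TopologicalSpace U]
    [TopologicalSpace H] [TopologicalSpace V] [TopologicalSpace X] [MeasurableSpace G]
    [MeasurableSpace H] [MeasurableSpace X] {𝒢 : TopGroupoid G U} {ℋ : TopGroupoid H V}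
    (α : HaarSystem 𝒢) (β : HaarSystem ℋ) (L : LeftAction 𝒢 X) (R : RightAction ℋ X)
    (ν : ∀ v, Measure {x : X // R.mom x = v}) : Prop where
  locallyCompact : IsLocallyCompact X
  left_continuous : L.IsContinuous
  right_continuous : R.IsContinuous
  commute : ActionsCommute L R
  proper : R.IsProper
  family : IsContinuousFamily R.mom ν
  invariant : R.IsInvariant ν
  quasiInvariant : ∃ Δ : L.Arrows → ℝ, L.IsAdjoiningFunction α R.mom ν Δ

/-! ### The composite space -/

section Composite

variable {G₁ U₁ G₂ U₂ G₃ U₃ X Y : Type*}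
  [TopologicalSpace G₁] [TopologicalSpace U₁] [TopologicalSpace G₂] [TopologicalSpace U₂]
  [TopologicalSpace G₃] [TopologicalSpace U₃]
  {𝒢₁ : TopGroupoid G₁ U₁} {𝒢₂ : TopGroupoid G₂ U₂} {𝒢₃ : TopGroupoid G₃ U₃}

/-- The fibre product `Z = X ×_{G₂⁰} Y`. -/
abbrev FibreProduct (R₁ : RightAction 𝒢₂ X) (L₂ : LeftAction 𝒢₂ Y) : Type _ :=
  {p : X × Y // R₁.mom p.1 = L₂.mom p.2}

/-- The diagonal action `(x, y) γ = (x γ, γ⁻¹ y)` of `G₂` on `Z`. -/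
def diagAction (R₁ : RightAction 𝒢₂ X) (L₂ : LeftAction 𝒢₂ Y) :
    RightAction 𝒢₂ (FibreProduct R₁ L₂) where
  mom z := R₁.mom z.1.1
  act z γ p := ⟨(R₁.act z.1.1 γ p, L₂.act (𝒢₂.inv γ) z.1.2
      ((𝒢₂.src_inv γ).trans (p.symm.trans z.2))),
    (R₁.mom_act _ _ _).trans ((L₂.mom_act _ _ _).trans (𝒢₂.rng_inv γ)).symm⟩
  mom_act z γ p := R₁.mom_act _ _ _
  act_unit z := by
    refine Subtype.ext (Prod.ext (R₁.act_unit _) ?_)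
    exact (L₂.act_congr _ ((𝒢₂.inv_unit _).trans (congrArg 𝒢₂.unit z.2)) rfl).trans
      (L₂.unit_act _)
  act_mul z g h p q := by
    refine Subtype.ext (Prod.ext (R₁.act_mul _ _ _ _ _) ?_)
    exact (L₂.act_congr _ (𝒢₂.inv_mul_rev g h q) rfl).trans (L₂.mul_act _ _ _ _ _)

/-- The space `Ω = Z / G₂`. -/
def CompositeSpace (R₁ : RightAction 𝒢₂ X) (L₂ : LeftAction 𝒢₂ Y) : Type _ :=
  Quotient (diagAction R₁ L₂).orbitSetoid

/-- The quotient map `Z → Ω`, `(x, y) ↦ [x, y]`. -/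
def CompositeSpace.mk {R₁ : RightAction 𝒢₂ X} {L₂ : LeftAction 𝒢₂ Y} (z : FibreProduct R₁ L₂) :
    CompositeSpace R₁ L₂ :=
  Quotient.mk _ z

instance (R₁ : RightAction 𝒢₂ X) (L₂ : LeftAction 𝒢₂ Y) [TopologicalSpace X]
    [TopologicalSpace Y] : TopologicalSpace (CompositeSpace R₁ L₂) :=
  inferInstanceAs (TopologicalSpace (Quotient (diagAction R₁ L₂).orbitSetoid))

instance (R₁ : RightAction 𝒢₂ X) (L₂ : LeftAction 𝒢₂ Y) [TopologicalSpace X]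
    [TopologicalSpace Y] : MeasurableSpace (CompositeSpace R₁ L₂) :=
  borel _

instance (R₁ : RightAction 𝒢₂ X) (L₂ : LeftAction 𝒢₂ Y) [TopologicalSpace X]
    [TopologicalSpace Y] : BorelSpace (CompositeSpace R₁ L₂) :=
  ⟨rfl⟩

/-- The momentum map `[x, y] ↦ r(x)`. -/
def compositeLeftMom {L₁ : LeftAction 𝒢₁ X} {R₁ : RightAction 𝒢₂ X} (c : ActionsCommute L₁ R₁)
    (L₂ : LeftAction 𝒢₂ Y) : CompositeSpace R₁ L₂ → U₁ :=
  Quotient.lift (fun z => L₁.mom z.1.1) (by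
    rintro z _ ⟨γ, p, rfl⟩
    exact (c.mom_left _ _ _).symm)

/-- The action map `(η, [x, y]) ↦ [η x, y]`. -/
def compositeLeftAct {L₁ : LeftAction 𝒢₁ X} {R₁ : RightAction 𝒢₂ X} (c : ActionsCommute L₁ R₁)
    (L₂ : LeftAction 𝒢₂ Y) (η : G₁) (ω : CompositeSpace R₁ L₂) :
    𝒢₁.src η = compositeLeftMom c L₂ ω → CompositeSpace R₁ L₂ :=
  Quotient.hrecOn (motive := fun ω => 𝒢₁.src η = compositeLeftMom c L₂ ω → CompositeSpace R₁ L₂) ω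
    (fun z p => CompositeSpace.mk ⟨(L₁.act η z.1.1 p, z.1.2), (c.mom_right _ _ _).trans z.2⟩) (by
      rintro z _ ⟨γ, p, rfl⟩
      refine Function.hfunext (congrArg (fun u => 𝒢₁.src η = u) (c.mom_left _ _ _).symm) ?_
      intro q q' _
      refine heq_of_eq (Quotient.sound ⟨γ, (c.mom_right _ _ _).trans p, ?_⟩)
      exact Subtype.ext (Prod.ext (c.act_act _ _ _ _ _).symm rfl))

/-- The left action `η [x, y] = [η x, y]` of `G₁` on `Ω`. -/
def compositeLeft {L₁ : LeftAction 𝒢₁ X} {R₁ : RightAction 𝒢₂ X} (c : ActionsCommute L₁ R₁)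
    (L₂ : LeftAction 𝒢₂ Y) : LeftAction 𝒢₁ (CompositeSpace R₁ L₂) where
  mom := compositeLeftMom c L₂
  act := compositeLeftAct c L₂
  mom_act η ω := by
    induction ω using Quotient.inductionOn with | _ z
    exact fun p => L₁.mom_act η z.1.1 p
  unit_act ω := by
    induction ω using Quotient.inductionOn with | _ z
    exact congrArg CompositeSpace.mk (a₁ := ⟨(L₁.act _ z.1.1 (𝒢₁.src_unit _), z.1.2), _⟩) (a₂ := z)
      (Subtype.ext (Prod.ext (L₁.unit_act _) rfl))
  mul_act g h ω := by
    induction ω using Quotient.inductionOn with | _ z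
    intro q p
    exact congrArg CompositeSpace.mk
      (a₁ := ⟨(L₁.act (𝒢₁.mul g h q) z.1.1 ((𝒢₁.src_mul g h q).trans p), z.1.2),
        (c.mom_right _ _ _).trans z.2⟩)
      (a₂ := ⟨(L₁.act g (L₁.act h z.1.1 p) (q.trans (L₁.mom_act _ _ _).symm), z.1.2),
        (c.mom_right _ _ _).trans ((c.mom_right _ _ _).trans z.2)⟩)
      (Subtype.ext (Prod.ext (L₁.mul_act g h z.1.1 q p) rfl))

/-- The momentum map `[x, y] ↦ s(y)`. -/
def compositeRightMom (R₁ : RightAction 𝒢₂ X) {L₂ : LeftAction 𝒢₂ Y} {R₂ : RightAction 𝒢₃ Y}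
    (c : ActionsCommute L₂ R₂) : CompositeSpace R₁ L₂ → U₃ :=
  Quotient.lift (fun z => R₂.mom z.1.2) (by
    rintro z _ ⟨γ, p, rfl⟩
    exact (c.mom_right _ _ _).symm)

/-- The action map `([x, y], η) ↦ [x, y η]`. -/
def compositeRightAct (R₁ : RightAction 𝒢₂ X) {L₂ : LeftAction 𝒢₂ Y} {R₂ : RightAction 𝒢₃ Y}
    (c : ActionsCommute L₂ R₂) (ω : CompositeSpace R₁ L₂) (η : G₃) :
    compositeRightMom R₁ c ω = 𝒢₃.rng η → CompositeSpace R₁ L₂ :=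
  Quotient.hrecOn (motive := fun ω => compositeRightMom R₁ c ω = 𝒢₃.rng η → CompositeSpace R₁ L₂) ω
    (fun z p => CompositeSpace.mk ⟨(z.1.1, R₂.act z.1.2 η p), z.2.trans (c.mom_left _ _ _).symm⟩)
    (by
      rintro z _ ⟨γ, p, rfl⟩
      refine Function.hfunext (congrArg (fun u => u = 𝒢₃.rng η) (c.mom_right _ _ _).symm) ?_
      intro q q' _
      refine heq_of_eq (Quotient.sound ⟨γ, p, ?_⟩)
      exact Subtype.ext (Prod.ext rfl (c.act_act _ _ _ _ _)))

/-- The right action `[x, y] η = [x, y η]` of `G₃` on `Ω`. -/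
def compositeRight (R₁ : RightAction 𝒢₂ X) {L₂ : LeftAction 𝒢₂ Y} {R₂ : RightAction 𝒢₃ Y}
    (c : ActionsCommute L₂ R₂) : RightAction 𝒢₃ (CompositeSpace R₁ L₂) where
  mom := compositeRightMom R₁ c
  act := compositeRightAct R₁ c
  mom_act ω η := by
    induction ω using Quotient.inductionOn with | _ z
    exact fun p => R₂.mom_act z.1.2 η p
  act_unit ω := by
    induction ω using Quotient.inductionOn with | _ z
    exact congrArg CompositeSpace.mk (a₁ := ⟨(z.1.1, R₂.act z.1.2 _ (𝒢₃.rng_unit _).symm), _⟩)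
      (a₂ := z) (Subtype.ext (Prod.ext rfl (R₂.act_unit _)))
  act_mul ω g h := by
    induction ω using Quotient.inductionOn with | _ z
    intro p q
    exact congrArg CompositeSpace.mk
      (a₁ := ⟨(z.1.1, R₂.act z.1.2 (𝒢₃.mul g h q) (p.trans (𝒢₃.rng_mul g h q).symm)),
        z.2.trans (c.mom_left _ _ _).symm⟩)
      (a₂ := ⟨(z.1.1, R₂.act (R₂.act z.1.2 g p) h ((R₂.mom_act _ _ _).trans q)),
        (z.2.trans (c.mom_left _ _ _).symm).trans (c.mom_left _ _ _).symm⟩)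
      (Subtype.ext (Prod.ext rfl (R₂.act_mul z.1.2 g h p q)))

/-- The integral `∫ f dλ^ω = ∫ f(x γ, γ⁻¹ y) dχ₂(γ)` over the fibre of `Z → Ω` at `ω = [x, y]`. -/
noncomputable def orbitIntegral [MeasurableSpace G₂] [BorelSpace G₂] (χ₂ : HaarSystem 𝒢₂)
    (R₁ : RightAction 𝒢₂ X) (L₂ : LeftAction 𝒢₂ Y) (f : FibreProduct R₁ L₂ → ℝ) :
    CompositeSpace R₁ L₂ → ℝ :=
  Quotient.lift ((diagAction R₁ L₂).fiberIntegral χ₂ f) (by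
    rintro z _ ⟨γ, p, rfl⟩
    exact ((diagAction R₁ L₂).fiberIntegral_act χ₂ f z γ p).symm)

/-- `b` is a continuous positive `G₃`-invariant function on `Z` whose coboundary is the cocycle
`((x, y), γ) ↦ Δ₂(γ⁻¹, y)` on `Z ⋊ G₂`. -/
structure IsTrivializingCochain [TopologicalSpace X] [TopologicalSpace Y]
    (R₁ : RightAction 𝒢₂ X) {L₂ : LeftAction 𝒢₂ Y} {R₂ : RightAction 𝒢₃ Y}
    (c : ActionsCommute L₂ R₂) (Δ₂ : L₂.Arrows → ℝ) (b : FibreProduct R₁ L₂ → ℝ) : Prop where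
  continuous : Continuous b
  pos : ∀ z, 0 < b z
  invariant : ∀ (z : FibreProduct R₁ L₂) (η : G₃) (p : R₂.mom z.1.2 = 𝒢₃.rng η),
    b ⟨(z.1.1, R₂.act z.1.2 η p), z.2.trans (c.mom_left _ _ _).symm⟩ = b z
  coboundary : ∀ (z : FibreProduct R₁ L₂) (γ : G₂) (p : R₁.mom z.1.1 = 𝒢₂.rng γ),
    b ((diagAction R₁ L₂).act z γ p) * (b z)⁻¹ =
      Δ₂ ⟨(𝒢₂.inv γ, z.1.2), (𝒢₂.src_inv γ).trans (p.symm.trans z.2)⟩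

/-- `μ` is a family of Radon measures on the fibres of `Ω → G₃⁰` with `b m_u = μ_u ∘ λ` for all
`u`, where `∫ f dm_u = ∫ ∫ f(x, y) dα_{r(y)}(x) dβ_u(y)`. -/
structure IsCompositeFamily [TopologicalSpace X] [TopologicalSpace Y] [MeasurableSpace X]
    [MeasurableSpace Y] [MeasurableSpace G₂] [BorelSpace G₂] (χ₂ : HaarSystem 𝒢₂)
    {R₁ : RightAction 𝒢₂ X} {L₂ : LeftAction 𝒢₂ Y} {R₂ : RightAction 𝒢₃ Y}
    (c : ActionsCommute L₂ R₂)
    (α : ∀ v, Measure {x : X // R₁.mom x = v}) (β : ∀ u, Measure {y : Y // R₂.mom y = u})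
    (b : FibreProduct R₁ L₂ → ℝ)
    (μ : ∀ u, Measure {ω : CompositeSpace R₁ L₂ // (compositeRight R₁ c).mom ω = u}) : Prop where
  regular : ∀ u, (μ u).Regular
  disintegration : ∀ u, ∀ f : FibreProduct R₁ L₂ → ℝ, Continuous f → HasCompactSupport f →
    ∫ y : {y : Y // R₂.mom y = u}, ∫ x : {x : X // R₁.mom x = L₂.mom y},
        f ⟨(x, y), x.2⟩ * b ⟨(x, y), x.2⟩ ∂(α (L₂.mom y)) ∂(β u) =
      ∫ ω : {ω : CompositeSpace R₁ L₂ // (compositeRight R₁ c).mom ω = u},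
        orbitIntegral χ₂ R₁ L₂ f ω ∂(μ u)

end Composite

/-! ### Test functions on locally compact, possibly non-Hausdorff spaces. -/

section CompactlySupported

open Set Filter Topology

variable {A B : Type*} [TopologicalSpace A] [TopologicalSpace B]

/-! Write `m_u` for the measure `∫ ∫ dα dβ_u` on `Z` and Λ for the orbit integral.

The space `Ω` is the quotient of `Z` by a proper action: properness passes from `X` to `Z` because
the position of `x γ` already confines `γ` (`isProperMap_diagAction`). The range map of `G₂` is
open, since there is a Haar system. Hence `Z → Ω` is an open quotient map with closed orbit
relation, and Λ maps `C_c(Z)` onto `C_c(Ω)` (`exists_orbitIntegral_eq`).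

Adjoining functions are assumed neither multiplicative nor invariant. Both properties come from a
uniqueness principle: for measures of full support a continuous function is determined by its
integrals against test functions. Invariance under a commuting right action follows at once, since a
translate implements the same quasi-invariance. For multiplicativity consider triples `(y, g⁻¹ y,
h⁻¹ y)`. Exchanging the last two points preserves the iterated integral, by Fubini; exchanging the
first two introduces the factor `D` of quasi-invariance. The braid relation of these transpositions
yields two expressions for one integral, and comparing them gives the cocycle identity
(`LeftAction.IsQuasiInvariant.mul_eq`).

A cocycle on a proper groupoid is a coboundary by averaging. Put `S(z) = ∑ aₙ ∫ kₙ(x γ) Δ₂(γ⁻¹, y)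
dχ₂(γ)` with bump functions `kₙ` covering `X` and small weights. Left invariance of `χ₂` and the
cocycle identity give `S(z) = S(z γ) Δ₂(γ⁻¹, y)`, so `b = 1 / S` works.

The factor `b` compensates `Δ₂`: quasi-invariance of `β_u` and invariance of `α` make `b m_u`
symmetric under inversion of `Z ⋊ G₂` (`weightedIntegral_inversion`). Consequently `∫ f Λ(h) b dm_u
= ∫ h Λ(f) b dm_u`. Taking for `h` a cut-off function with orbit integral `1` on the image of the
support of `f` shows that `∫ f b dm_u` depends only on `Λ(f)`, and the Riesz representation theorem
produces `μ_u`. Continuity, full support and invariance of `μ` are read off from `b m_u` through Λ.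

For quasi-invariance under `G₁`, a test function on `G₁ ⋉ Ω` is lifted to `G₁ ⋉ Z` with the help of
a cut-off function. There the quasi-invariance of `α` applies, and the variation of `b` along `G₁`
turns `Δ₁` into `Δ₁₂`.

The groupoids may have non-Hausdorff arrow spaces, but the fibres of their range maps are Hausdorff.
The analytic basis is that integration along a pulled-back family preserves `C_c`
(`pullIntegral_mem_Cc`), proved locally on Hausdorff open sets. -/

theorem T2Space.coe_mono {V W : Set A} (hW : T2Space W) (h : V ⊆ W) : T2Space V :=
  (Topology.IsEmbedding.inclusion h).t2Space

/-- `f` is continuous on the open Hausdorff set `W` and vanishes off a compact subset of `W`. -/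
structure IsCcOn (f : A → ℝ) (W : Set A) : Prop where
  isOpen : IsOpen W
  t2 : T2Space W
  continuousOn : ContinuousOn f W
  exists_compact : ∃ K ⊆ W, IsCompact K ∧ ∀ x ∉ K, f x = 0

theorem IsCcOn.mem_Cc {f : A → ℝ} {W : Set A} (h : IsCcOn f W) : f ∈ Cc A :=
  Submodule.subset_span ⟨W, h.isOpen, h.t2, h.continuousOn, h.exists_compact⟩

theorem IsCcOn.mul_continuousOn {f k : A → ℝ} {W : Set A} (h : IsCcOn f W)
    (hk : ContinuousOn k W) : IsCcOn (fun x => f x * k x) W := by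
  obtain ⟨K, hKW, hK, h0⟩ := h.exists_compact
  exact ⟨h.isOpen, h.t2, h.continuousOn.mul hk, K, hKW, hK, fun x hx => by simp [h0 x hx]⟩

theorem IsCcOn.const_smul {f : A → ℝ} {W : Set A} (h : IsCcOn f W) (c : ℝ) :
    IsCcOn (c • f) W := by
  obtain ⟨K, hKW, hK, h0⟩ := h.exists_compact
  exact ⟨h.isOpen, h.t2, h.continuousOn.const_smul c, K, hKW, hK, fun x hx => by simp [h0 x hx]⟩

/-- A compact set need not be closed in a non-Hausdorff space, but it is closed relative to an open
Hausdorff set containing it. -/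
theorem isOpen_diff_of_isCompact {W K : Set A} (hW : IsOpen W) (h2 : T2Space W) (hKW : K ⊆ W)
    (hK : IsCompact K) : IsOpen (W \ K) := by
  have h1 : IsCompact ((↑) ⁻¹' K : Set W) :=
    Topology.IsInducing.subtypeVal.isCompact_preimage' hK (by simpa using hKW)
  have := hW.isOpenMap_subtype_val _ h1.isClosed.isOpen_compl
  convert this using 1
  ext x
  simp only [Set.mem_sdiff, mem_image, mem_compl_iff, mem_preimage, Subtype.exists,
    exists_and_right, exists_eq_right]
  exact ⟨fun h => ⟨h.1, h.2⟩, fun ⟨h, h'⟩ => ⟨h, h'⟩⟩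

/-- Points of `W'` outside `K` have the neighbourhood `W' \ K`, on which `f` vanishes; this set is
open because `W'` is Hausdorff. -/
theorem IsCcOn.mono {f : A → ℝ} {W W' : Set A} (h : IsCcOn f W) (hWW : W ⊆ W')
    (hW' : IsOpen W') (h2 : T2Space W') : IsCcOn f W' := by
  obtain ⟨K, hKW, hK, h0⟩ := h.exists_compact
  refine ⟨hW', h2, fun x hx => ?_, K, hKW.trans hWW, hK, h0⟩
  by_cases hxK : x ∈ K
  · exact (h.continuousOn.continuousAt (h.isOpen.mem_nhds (hKW hxK))).continuousWithinAt
  · have : f =ᶠ[𝓝 x] fun _ => 0 := by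
      filter_upwards [(isOpen_diff_of_isCompact hW' h2 (hKW.trans hWW) hK).mem_nhds ⟨hx, hxK⟩]
        with y hy using h0 y hy.2
    exact (continuousAt_const.congr this.symm).continuousWithinAt

/-- Continuity is claimed on `V` only: the extension by zero can be discontinuous at points outside
`V` that cannot be separated from the support. -/
theorem isCcOn_extend {V : Set A} (hV : IsOpen V) (h2 : T2Space V) {g : V → ℝ}
    (hg : Continuous g) (hc : HasCompactSupport g) :
    IsCcOn (Function.extend Subtype.val g 0) V := by
  refine ⟨hV, h2, ?_, (↑) '' tsupport g, ?_, hc.image continuous_subtype_val, ?_⟩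
  · rw [continuousOn_iff_continuous_domRestrict]
    convert hg using 1
    ext x
    exact Subtype.val_injective.extend_apply g 0 x
  · rintro _ ⟨x, -, rfl⟩
    exact x.2
  · intro x hx
    by_cases h : x ∈ V
    · rw [show x = ((⟨x, h⟩ : V) : A) from rfl, Subtype.val_injective.extend_apply]
      exact image_eq_zero_of_notMem_tsupport fun h' => hx ⟨_, h', rfl⟩
    · rw [Function.extend_apply' _ _ _ (by rintro ⟨a, rfl⟩; exact h a.2)]
      rfl

theorem IsCcOn.restrict {V : Set A} {f : A → ℝ} (h : IsCcOn f V) :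
    Continuous (fun x : V => f x) ∧ HasCompactSupport fun x : V => f x := by
  obtain ⟨K, hKW, hK, h0⟩ := h.exists_compact
  have := h.t2
  refine ⟨continuousOn_iff_continuous_domRestrict.1 h.continuousOn,
    HasCompactSupport.intro (K := (Subtype.val ⁻¹' K : Set V)) ?_ fun x hx => h0 x hx⟩
  exact Topology.IsInducing.subtypeVal.isCompact_preimage' hK (by simpa using hKW)

namespace IsLocallyCompact

theorem exists_isOpen (h : IsLocallyCompact A) (x : A) :
    ∃ V : Set A, IsOpen V ∧ x ∈ V ∧ T2Space V := by
  obtain ⟨K, hK, -, h2⟩ := h x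
  exact ⟨interior K, isOpen_interior, mem_interior_iff_mem_nhds.2 hK, h2.coe_mono interior_subset⟩

/-- Two points in a common open Hausdorff set are separated there; otherwise that set itself omits
the second point. Closedness of points is what makes slices and fibres closed subspaces. -/
theorem t1Space (h : IsLocallyCompact A) : T1Space A := by
  rw [t1Space_iff_exists_open]
  intro x y hxy
  obtain ⟨V, hV, hxV, h2⟩ := h.exists_isOpen x
  by_cases hy : y ∈ V
  · obtain ⟨u, v, hu, -, hxu, hyv, huv⟩ :=
      t2_separation (show (⟨x, hxV⟩ : V) ≠ ⟨y, hy⟩ from fun e => hxy (congrArg Subtype.val e))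
    refine ⟨(↑) '' u, hV.isOpenMap_subtype_val u hu, ⟨_, hxu, rfl⟩, ?_⟩
    rintro ⟨z, hz, rfl⟩
    exact huv.le_bot ⟨hz, hyv⟩
  · exact ⟨V, hV, hxV, hy⟩

/-- A compact Hausdorff neighbourhood `K` of `x` has arbitrarily small compact neighbourhoods, so
one of them fits into `V`; being a neighbourhood within `K`, it is one in `A`. -/
theorem locallyCompactSpace_coe (h : IsLocallyCompact A) {V : Set A} (hV : IsOpen V)
    (h2 : T2Space V) : LocallyCompactSpace V := by
  suffices WeaklyLocallyCompactSpace V from inferInstance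
  refine ⟨fun x => ?_⟩
  obtain ⟨K, hK, hKc, hK2⟩ := h x
  have : CompactSpace K := isCompact_iff_compactSpace.1 hKc
  obtain ⟨N, hN, hNV, hNc⟩ := local_compact_nhds
    ((hV.preimage continuous_subtype_val).mem_nhds
      (show (⟨x, mem_of_mem_nhds hK⟩ : K) ∈ ((↑) ⁻¹' V : Set K) from x.2))
  have hNx : ((↑) '' N : Set A) ∈ 𝓝 (x : A) := by
    have := image_mem_map (m := ((↑) : K → A)) hN
    rwa [map_nhds_subtype_coe_eq_nhds (mem_of_mem_nhds hK) hK] at this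
  refine ⟨(↑) ⁻¹' ((↑) '' N : Set A), ?_, continuous_subtype_val.continuousAt.preimage_mem_nhds hNx⟩
  refine Topology.IsInducing.subtypeVal.isCompact_preimage' (hNc.image continuous_subtype_val) ?_
  rintro _ ⟨y, hy, rfl⟩
  exact ⟨⟨y, hNV hy⟩, rfl⟩

theorem locallyCompactSpace [T2Space A] (h : IsLocallyCompact A) : LocallyCompactSpace A := by
  suffices WeaklyLocallyCompactSpace A from inferInstance
  exact ⟨fun x => let ⟨K, hK, hKc, _⟩ := h x; ⟨K, hKc, hK⟩⟩

theorem of_locallyCompactSpace [T2Space A] [LocallyCompactSpace A] : IsLocallyCompact A :=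
  fun x => let ⟨K, hK, hx⟩ := exists_compact_mem_nhds x; ⟨K, hx, hK, inferInstance⟩

theorem of_isClosedEmbedding (h : IsLocallyCompact B) {i : A → B} (hi : IsClosedEmbedding i) :
    IsLocallyCompact A := by
  intro x
  obtain ⟨K, hK, hKc, hK2⟩ := h (i x)
  exact ⟨i ⁻¹' K, hi.continuous.continuousAt.preimage_mem_nhds hK, hi.isCompact_preimage hKc,
    (hi.isEmbedding.restrictPreimage K).t2Space⟩

theorem prod (hA : IsLocallyCompact A) (hB : IsLocallyCompact B) : IsLocallyCompact (A × B) := by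
  rintro ⟨a, b⟩
  obtain ⟨K, hK, hKc, hK2⟩ := hA a
  obtain ⟨L, hL, hLc, hL2⟩ := hB b
  exact ⟨K ×ˢ L, prod_mem_nhds hK hL, hKc.prod hLc,
    (Homeomorph.Set.prod K L).isEmbedding.t2Space⟩

end IsLocallyCompact

theorem Cc_mul_continuous {f k : A → ℝ} (hf : f ∈ Cc A) (hk : Continuous k) :
    (fun x => f x * k x) ∈ Cc A := by
  induction hf using Submodule.span_induction with
  | mem f hf =>
    obtain ⟨W, h1, h2, h3, h4⟩ := hf
    exact ((IsCcOn.mk h1 h2 h3 h4).mul_continuousOn hk.continuousOn).mem_Cc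
  | zero => convert (Cc A).zero_mem using 1; ext; simp
  | add f g _ _ hf hg => convert (Cc A).add_mem hf hg using 1; ext; simp [add_mul]
  | smul a f _ hf => convert (Cc A).smul_mem a hf using 1; ext; simp [mul_assoc]

theorem Cc_exists_compact {f : A → ℝ} (hf : f ∈ Cc A) :
    ∃ K : Set A, IsCompact K ∧ ∀ x ∉ K, f x = 0 := by
  induction hf using Submodule.span_induction with
  | mem f hf =>
    obtain ⟨W, h1, h2, h3, K, -, h4⟩ := hf
    exact ⟨K, h4⟩
  | zero => exact ⟨∅, isCompact_empty, fun _ _ => rfl⟩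
  | add f g _ _ hf hg =>
    obtain ⟨K, hK, h⟩ := hf
    obtain ⟨L, hL, h'⟩ := hg
    refine ⟨K ∪ L, hK.union hL, fun x hx => ?_⟩
    rw [mem_union, not_or] at hx
    simp [h x hx.1, h' x hx.2]
  | smul a f _ hf =>
    obtain ⟨K, hK, h⟩ := hf
    exact ⟨K, hK, fun x hx => by simp [h x hx]⟩

theorem IsCcOn.comp_isClosedEmbedding {f : B → ℝ} {W : Set B} (hf : IsCcOn f W) {i : A → B}
    (hi : IsClosedEmbedding i) : IsCcOn (fun a => f (i a)) (i ⁻¹' W) := by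
  obtain ⟨K, hKW, hK, h0⟩ := hf.exists_compact
  have := hf.t2
  exact ⟨hf.isOpen.preimage hi.continuous, (hi.isEmbedding.restrictPreimage W).t2Space,
    hf.continuousOn.comp hi.continuous.continuousOn fun _ h => h, i ⁻¹' K, preimage_mono hKW,
    hi.isCompact_preimage hK, fun x hx => h0 _ hx⟩

theorem Cc_comp_isClosedEmbedding {f : B → ℝ} (hf : f ∈ Cc B) {i : A → B}
    (hi : IsClosedEmbedding i) : (fun a => f (i a)) ∈ Cc A := by
  induction hf using Submodule.span_induction with
  | mem f hf =>
    obtain ⟨W, h1, h2, h3, h4⟩ := hf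
    exact ((IsCcOn.mk h1 h2 h3 h4).comp_isClosedEmbedding hi).mem_Cc
  | zero => exact (Cc A).zero_mem
  | add f g _ _ hf hg => exact (Cc A).add_mem hf hg
  | smul a f _ hf => exact (Cc A).smul_mem a hf

theorem IsCcOn.prod {f : A → ℝ} {g : B → ℝ} {V : Set A} {W : Set B} (hf : IsCcOn f V)
    (hg : IsCcOn g W) : IsCcOn (fun z : A × B => f z.1 * g z.2) (V ×ˢ W) := by
  obtain ⟨K, hKV, hK, h0⟩ := hf.exists_compact
  obtain ⟨L, hLW, hL, h0'⟩ := hg.exists_compact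
  have := hf.t2
  have := hg.t2
  refine ⟨hf.isOpen.prod hg.isOpen, (Homeomorph.Set.prod V W).isEmbedding.t2Space,
    (hf.continuousOn.comp continuousOn_fst fun _ h => h.1).mul
      (hg.continuousOn.comp continuousOn_snd fun _ h => h.2), K ×ˢ L, prod_mono hKV hLW,
    hK.prod hL, fun x hx => ?_⟩
  rw [mem_prod, not_and_or] at hx
  rcases hx with hx | hx
  · simp [h0 _ hx]
  · simp [h0' _ hx]

theorem Cc_prod {f : A → ℝ} {g : B → ℝ} (hf : f ∈ Cc A) (hg : g ∈ Cc B) :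
    (fun z : A × B => f z.1 * g z.2) ∈ Cc (A × B) := by
  induction hf using Submodule.span_induction with
  | mem f hf =>
    obtain ⟨W, h1, h2, h3, h4⟩ := hf
    induction hg using Submodule.span_induction with
    | mem g hg =>
      obtain ⟨V, h1', h2', h3', h4'⟩ := hg
      exact ((IsCcOn.mk h1 h2 h3 h4).prod (IsCcOn.mk h1' h2' h3' h4')).mem_Cc
    | zero => convert (Cc (A × B)).zero_mem using 1; ext; simp
    | add f g _ _ hf hg => convert (Cc (A × B)).add_mem hf hg using 1; ext; simp [mul_add]
    | smul a f _ hf => convert (Cc (A × B)).smul_mem a hf using 1; ext; simp [mul_left_comm]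
  | zero => convert (Cc (A × B)).zero_mem using 1; ext; simp
  | add f g _ _ hf hg => convert (Cc (A × B)).add_mem hf hg using 1; ext; simp [add_mul]
  | smul a f _ hf => convert (Cc (A × B)).smul_mem a hf using 1; ext; simp [mul_assoc]

/-- `C_c(A)` is generated by the functions that live on members of a given open cover. -/
theorem Cc_induction_on_cover (hA : IsLocallyCompact A) {P : (A → ℝ) → Prop} (𝒱 : A → Set A)
    (h𝒱 : ∀ a, IsOpen (𝒱 a)) (ha : ∀ a, a ∈ 𝒱 a)
    (gen : ∀ a f W, W ⊆ 𝒱 a → IsCcOn f W → P f) (zero : P 0)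
    (add : ∀ f g, f ∈ Cc A → g ∈ Cc A → P f → P g → P (f + g)) {f : A → ℝ} (hf : f ∈ Cc A) :
    P f := by
  have hsum : ∀ {n : ℕ} (F : Fin n → A → ℝ), (∀ i, F i ∈ Cc A ∧ P (F i)) → P (∑ i, F i) := by
    intro n F hF
    have : (∑ i, F i) ∈ Cc A ∧ P (∑ i, F i) := by
      refine Finset.sum_induction F (fun f => f ∈ Cc A ∧ P f) ?_ ⟨(Cc A).zero_mem, zero⟩
        fun i _ => hF i
      exact fun f g hf hg => ⟨(Cc A).add_mem hf.1 hg.1, add f g hf.1 hg.1 hf.2 hg.2⟩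
    exact this.2
  -- `P` is not assumed to be stable under scalars, so all multiples are carried through the span
  -- induction; on a generator the scalar is absorbed into the function.
  suffices ∀ c : ℝ, P (c • f) by simpa using this 1
  induction hf using Submodule.span_induction with
  | zero => intro c; simpa using zero
  | add f g hf hg hf' hg' =>
    intro c
    rw [smul_add]
    exact add _ _ ((Cc A).smul_mem c hf) ((Cc A).smul_mem c hg) (hf' c) (hg' c)
  | smul a f _ hf => intro c; rw [smul_smul]; exact hf _
  | mem f hf =>
    intro c
    obtain ⟨W, h1, h2, h3, h4⟩ := hf
    have hfW : IsCcOn (c • f) W := (IsCcOn.mk h1 h2 h3 h4).const_smul c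
    generalize c • f = f at hfW
    have := hA.locallyCompactSpace_coe h1 h2
    obtain ⟨hc, hs⟩ := hfW.restrict
    obtain ⟨t, ht⟩ := hs.elim_finite_subcover (fun a : W => (Subtype.val ⁻¹' 𝒱 a : Set W))
      (fun a => (h𝒱 a).preimage continuous_subtype_val) fun x _ => mem_iUnion.2 ⟨x, ha (x : A)⟩
    let e := t.equivFin
    have hsub : tsupport (fun x : W => f x) ⊆
        ⋃ i : Fin t.card, ((↑) ⁻¹' 𝒱 ((e.symm i).1 : W) : Set W) := by
      intro x hx
      obtain ⟨a, hat, hxa⟩ := mem_iUnion₂.1 (ht hx)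
      exact mem_iUnion.2 ⟨e ⟨a, hat⟩, by simpa using hxa⟩
    -- A partition of unity exists on the Hausdorff set `W`. Each `f * k i`, extended by zero, lives
    -- on `W` intersected with one member of the cover.
    obtain ⟨k, hk1, hk2, -, hk4⟩ := exists_continuous_sum_one_of_isOpen_isCompact
      (fun i => (h𝒱 ((e.symm i).1 : W)).preimage continuous_subtype_val) hs hsub
    let F : Fin t.card → A → ℝ := fun i =>
      Function.extend Subtype.val (fun x : W => f x * k i x) 0
    have hF : f = ∑ i, F i := by
      ext x
      rw [Finset.sum_apply]
      by_cases hx : x ∈ W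
      · have h5 : ∀ i, F i x = f x * k i ⟨x, hx⟩ := fun i =>
          Subtype.val_injective.extend_apply (fun x : W => f x * k i x) 0 ⟨x, hx⟩
        simp_rw [h5, ← Finset.mul_sum]
        by_cases hxs : (⟨x, hx⟩ : W) ∈ tsupport (fun x : W => f x)
        · have := hk2 hxs
          rw [Finset.sum_apply, Pi.one_apply] at this
          rw [this, mul_one]
        · have : f x = 0 := image_eq_zero_of_notMem_tsupport (f := fun x : W => f x) hxs
          rw [this, zero_mul]
      · have h5 : ∀ i, F i x = 0 := fun i => by
          refine Function.extend_apply' _ _ _ ?_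
          rintro ⟨a, rfl⟩
          exact hx a.2
        obtain ⟨K, hKW, -, h0⟩ := hfW.exists_compact
        simp [h5, h0 x fun h => hx (hKW h)]
    rw [hF]
    refine hsum F fun i => ?_
    have hcc : IsCcOn (F i) W :=
      isCcOn_extend h1 h2 (hc.mul (k i).continuous) (hk4 i).mul_left
    refine ⟨hcc.mem_Cc, gen ((e.symm i).1 : W) (F i) (W ∩ 𝒱 ((e.symm i).1 : W))
      inter_subset_right ⟨h1.inter (h𝒱 _), h2.coe_mono inter_subset_left,
        hcc.continuousOn.mono inter_subset_left, (↑) '' tsupport (k i),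
        ?_, (hk4 i).isCompact.image continuous_subtype_val, fun x hx => ?_⟩⟩
    · rintro _ ⟨x, hx, rfl⟩
      exact ⟨x.2, hk1 i hx⟩
    · by_cases hxW : x ∈ W
      · rw [show F i x = f x * k i ⟨x, hxW⟩ from
          Subtype.val_injective.extend_apply (fun x : W => f x * k i x) 0 ⟨x, hxW⟩,
          image_eq_zero_of_notMem_tsupport (f := k i) fun h => hx ⟨_, h, rfl⟩, mul_zero]
      · refine Function.extend_apply' _ _ _ ?_
        rintro ⟨a, rfl⟩
        exact hxW a.2

theorem exists_isCcOn_bump (hA : IsLocallyCompact A) {V : Set A} (hV : IsOpen V)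
    (h2 : T2Space V) {K : Set A} (hKV : K ⊆ V) (hK : IsCompact K) :
    ∃ φ : A → ℝ, IsCcOn φ V ∧ (∀ x, 0 ≤ φ x) ∧ (∀ x, φ x ≤ 1) ∧ ∀ x ∈ K, φ x = 1 := by
  have := hA.locallyCompactSpace_coe hV h2
  have hK' : IsCompact ((↑) ⁻¹' K : Set V) :=
    Topology.IsInducing.subtypeVal.isCompact_preimage' hK (by simpa using hKV)
  obtain ⟨g, hg1, -, hg2, hg3⟩ := exists_continuous_one_zero_of_isCompact hK' isClosed_empty
    (disjoint_empty _)
  have key : ∀ x, Function.extend Subtype.val g 0 x ∈ Icc (0 : ℝ) 1 := fun x => by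
    by_cases hx : x ∈ V
    · rw [show x = ((⟨x, hx⟩ : V) : A) from rfl, Subtype.val_injective.extend_apply]
      exact hg3 _
    · rw [Function.extend_apply' _ _ _ (by rintro ⟨a, rfl⟩; exact hx a.2)]
      simp
  refine ⟨_, isCcOn_extend hV h2 g.continuous hg2, fun x => (key x).1, fun x => (key x).2,
    fun x hx => ?_⟩
  rw [show x = ((⟨x, hKV hx⟩ : V) : A) from rfl, Subtype.val_injective.extend_apply]
  exact hg1 hx

theorem exists_Cc_bump (hA : IsLocallyCompact A) {O : Set A} (hO : IsOpen O) {a : A}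
    (ha : a ∈ O) : ∃ φ ∈ Cc A, (∀ x, 0 ≤ φ x) ∧ φ a = 1 ∧ ∀ x ∉ O, φ x = 0 := by
  obtain ⟨V, hV, haV, h2⟩ := hA.exists_isOpen a
  obtain ⟨φ, h1, h3, -, h4⟩ := exists_isCcOn_bump hA (hV.inter hO) (h2.coe_mono inter_subset_left)
    (singleton_subset_iff.2 ⟨haV, ha⟩) isCompact_singleton
  obtain ⟨K, hK, -, h0⟩ := h1.exists_compact
  exact ⟨φ, h1.mem_Cc, h3, h4 a rfl, fun x hx => h0 x fun h => hx (hK h).2⟩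

/-- Extension of compactly supported continuous functions from a closed subspace of a locally
compact Hausdorff space. -/
theorem exists_extension_of_hasCompactSupport [T2Space B] [LocallyCompactSpace B] {i : A → B}
    (hi : IsClosedEmbedding i) {f : A → ℝ} (hf : Continuous f) (hs : HasCompactSupport f) :
    ∃ g : B → ℝ, Continuous g ∧ HasCompactSupport g ∧ ∀ a, g (i a) = f a := by
  -- `B` need not be normal, so Tietze's theorem is applied on a compact neighbourhood `L` of the
  -- image of the support. The cut-off `φ`, supported in the interior of `L`, makes the extension by
  -- zero continuous.
  obtain ⟨L, hL, hKL⟩ := exists_compact_superset (hs.isCompact.image hi.continuous)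
  have : CompactSpace L := isCompact_iff_compactSpace.1 hL
  obtain ⟨g₀, -, hg₀⟩ := ContinuousMap.exists_extension_forall_mem_of_isClosedEmbedding
    (t := univ) (⟨fun a : i ⁻¹' L => f a, by fun_prop⟩ : C(i ⁻¹' L, ℝ)) (fun _ => trivial)
    univ_nonempty (hi.restrictPreimage L)
  obtain ⟨φ, hφ1, hφ2, hφ3, -⟩ := exists_continuousMap_one_of_isCompact_subset_isOpen
    (hs.isCompact.image hi.continuous) isOpen_interior hKL
  have hval : ∀ (b : B) (h : b ∈ L), Function.extend Subtype.val g₀ 0 b = g₀ ⟨b, h⟩ := fun b h =>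
    Subtype.val_injective.extend_apply g₀ 0 ⟨b, h⟩
  refine ⟨fun b => φ b * Function.extend Subtype.val g₀ 0 b, ?_,
    HasCompactSupport.mul_right hφ2, fun a => ?_⟩
  · refine continuous_iff_continuousAt.2 fun b => ?_
    by_cases hb : b ∈ interior L
    · refine φ.continuous.continuousAt.mul ?_
      have : ContinuousOn (Function.extend Subtype.val g₀ 0) L := by
        rw [continuousOn_iff_continuous_domRestrict]
        convert g₀.continuous using 1
        ext x
        exact hval x x.2
      exact this.continuousAt (mem_interior_iff_mem_nhds.1 hb)
    · have : (fun b => φ b * Function.extend Subtype.val g₀ 0 b) =ᶠ[𝓝 b] fun _ => 0 := by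
        filter_upwards [(isClosed_tsupport φ).isOpen_compl.mem_nhds fun h => hb (hφ3 h)] with y hy
        rw [image_eq_zero_of_notMem_tsupport (f := φ) hy, zero_mul]
      exact continuousAt_const.congr this.symm
  · by_cases ha : a ∈ tsupport f
    · have haL : i a ∈ L := interior_subset (hKL ⟨a, ha, rfl⟩)
      have h1 : φ (i a) = 1 := hφ1 ⟨a, ha, rfl⟩
      have h2 := congrFun hg₀ ⟨a, haL⟩
      simp only [Function.comp_apply, ContinuousMap.coe_mk] at h2
      simp only [h1, one_mul, hval _ haL]
      exact h2
    · have h0 : f a = 0 := image_eq_zero_of_notMem_tsupport ha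
      by_cases haL : i a ∈ L
      · have h2 := congrFun hg₀ ⟨a, haL⟩
        simp only [Function.comp_apply, ContinuousMap.coe_mk] at h2
        have h3 : g₀ ⟨i a, haL⟩ = f a := h2
        simp only [hval _ haL, h3, h0, mul_zero]
      · have : φ (i a) = 0 :=
          image_eq_zero_of_notMem_tsupport fun h => haL (interior_subset (hφ3 h))
        simp only [this, h0, zero_mul]

/-- Restriction of `C_c` to a closed subspace is surjective. -/
theorem Cc_exists_extension (hB : IsLocallyCompact B) {i : A → B} (hi : IsClosedEmbedding i)
    {f : A → ℝ} (hf : f ∈ Cc A) : ∃ g ∈ Cc B, ∀ a, g (i a) = f a := by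
  choose 𝒱 h𝒱 hm h2 using hB.exists_isOpen
  -- It suffices to treat functions living over one open Hausdorff subset of `B`, where the
  -- Hausdorff extension result applies.
  refine Cc_induction_on_cover (P := fun f => ∃ g ∈ Cc B, ∀ a, g (i a) = f a)
    (hB.of_isClosedEmbedding hi) (fun a => i ⁻¹' 𝒱 (i a))
    (fun a => (h𝒱 _).preimage hi.continuous) (fun a => hm _) ?_
    ⟨0, (Cc B).zero_mem, fun _ => rfl⟩ ?_ hf
  · intro a f W hWa hfW
    have h2a := h2 (i a)
    have := hB.locallyCompactSpace_coe (h𝒱 (i a)) h2a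
    have hfa := hfW.mono hWa ((h𝒱 _).preimage hi.continuous)
      (hi.isEmbedding.restrictPreimage (𝒱 (i a))).t2Space
    obtain ⟨hc, hs⟩ := hfa.restrict
    obtain ⟨g, hg1, hg2, hg3⟩ := exists_extension_of_hasCompactSupport
      (hi.restrictPreimage (𝒱 (i a))) hc hs
    refine ⟨_, (isCcOn_extend (h𝒱 _) h2a hg1 hg2).mem_Cc, fun x => ?_⟩
    by_cases hx : i x ∈ 𝒱 (i a)
    · rw [show i x = ((⟨i x, hx⟩ : 𝒱 (i a)) : B) from rfl, Subtype.val_injective.extend_apply]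
      exact hg3 ⟨x, hx⟩
    · rw [Function.extend_apply' _ _ _ (by rintro ⟨y, hy⟩; exact hx (hy ▸ y.2))]
      obtain ⟨K, hK, -, h0⟩ := hfa.exists_compact
      exact (h0 x fun h => hx (hK h)).symm
  · rintro f f' - - ⟨g, hg, h⟩ ⟨g', hg', h'⟩
    exact ⟨g + g', (Cc B).add_mem hg hg', fun a => by simp [h, h']⟩

theorem Cc_integrable [T2Space A] [MeasurableSpace A] [OpensMeasurableSpace A] {f : A → ℝ}
    (hf : f ∈ Cc A) (μ : Measure A) [IsFiniteMeasureOnCompacts μ] : Integrable f μ :=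
  ((mem_Cc_iff f).1 hf).1.integrable_of_hasCompactSupport ((mem_Cc_iff f).1 hf).2

end CompactlySupported

/-! ### Integration along pull-backs of continuous families of measures. -/

section Pullback

open Set Filter Topology

set_option linter.unusedSectionVars false

variable {T V W : Type*} [TopologicalSpace T] [TopologicalSpace V] [TopologicalSpace W]

/-- The fibre product `T ×_V W`. -/
abbrev Pull (p : T → V) (π : W → V) : Type _ := {a : T × W // π a.2 = p a.1}

/-- The integrals of a function on `T ×_V W` along the pull-back of a family of measures. -/
noncomputable def pullIntegral [MeasurableSpace W] {π : W → V}
    (ν : ∀ v, Measure {w : W // π w = v}) (p : T → V) (F : Pull p π → ℝ) (t : T) : ℝ :=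
  ∫ w : {w : W // π w = p t}, F ⟨(t, w), w.2⟩ ∂(ν (p t))

theorem isClosedEmbedding_fibre [T1Space V] {π : W → V} (hπ : Continuous π) (v : V) :
    IsClosedEmbedding (Subtype.val : {w : W // π w = v} → W) :=
  IsClosed.isClosedEmbedding_subtypeVal (isClosed_singleton.preimage hπ)

theorem isClosedEmbedding_pull [T2Space V] {p : T → V} {π : W → V} (hp : Continuous p)
    (hπ : Continuous π) : IsClosedEmbedding (Subtype.val : Pull p π → T × W) :=
  IsClosed.isClosedEmbedding_subtypeVal
    (isClosed_eq (hπ.comp continuous_snd) (hp.comp continuous_fst))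

theorem isClosedEmbedding_prodMk_left' [T1Space T] (t : T) :
    IsClosedEmbedding (fun w : W => (t, w)) := by
  refine ⟨isEmbedding_prodMkRight t, ?_⟩
  convert (isClosed_singleton (x := t)).preimage (continuous_fst (X := T) (Y := W)) using 1
  ext ⟨a, b⟩
  simp [eq_comm]

theorem isClosedEmbedding_slice [T2Space V] [T1Space T] {p : T → V} {π : W → V}
    (hp : Continuous p) (hπ : Continuous π) (t : T) :
    IsClosedEmbedding (fun w : {w : W // π w = p t} => (⟨(t, w), w.2⟩ : Pull p π)) := by
  rw [← IsClosedEmbedding.of_comp_iff (isClosedEmbedding_pull hp hπ)]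
  exact (isClosedEmbedding_prodMk_left' t).comp (isClosedEmbedding_fibre hπ _)

theorem IsLocallyCompact.pull [T2Space V] {p : T → V} {π : W → V} (hT : IsLocallyCompact T)
    (hW : IsLocallyCompact W) (hp : Continuous p) (hπ : Continuous π) :
    IsLocallyCompact (Pull p π) :=
  (hT.prod hW).of_isClosedEmbedding (isClosedEmbedding_pull hp hπ)

variable [MeasurableSpace W] [BorelSpace W]

theorem integrable_slice [T2Space V] [T1Space T] {p : T → V} {π : W → V}
    (hp : Continuous p) (hπ : Continuous π) {ν : ∀ v, Measure {w : W // π w = v}}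
    (hν : IsContinuousFamily π ν) (h2 : ∀ v, T2Space {w : W // π w = v}) {F : Pull p π → ℝ}
    (hF : F ∈ Cc (Pull p π)) (t : T) :
    Integrable (fun w : {w : W // π w = p t} => F ⟨(t, w), w.2⟩) (ν (p t)) := by
  have := hν.regular (p t)
  have := h2 (p t)
  exact Cc_integrable (Cc_comp_isClosedEmbedding hF (isClosedEmbedding_slice hp hπ t)) _

theorem IsContinuousFamily.integrable_fibre [T1Space V] {π : W → V}
    (hπ : Continuous π) {ν : ∀ v, Measure {w : W // π w = v}}
    (hν : IsContinuousFamily π ν) (h2 : ∀ v, T2Space {w : W // π w = v}) {f : W → ℝ}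
    (hf : f ∈ Cc W) (v : V) : Integrable (fun w : {w : W // π w = v} => f w) (ν v) := by
  have := hν.regular v
  have := h2 v
  exact Cc_integrable (Cc_comp_isClosedEmbedding hf (isClosedEmbedding_fibre hπ v)) _

theorem pullIntegral_add [T2Space V] [T1Space T] {p : T → V} {π : W → V}
    (hp : Continuous p) (hπ : Continuous π) {ν : ∀ v, Measure {w : W // π w = v}}
    (hν : IsContinuousFamily π ν) (h2 : ∀ v, T2Space {w : W // π w = v}) {F F' : Pull p π → ℝ}
    (hF : F ∈ Cc (Pull p π)) (hF' : F' ∈ Cc (Pull p π)) :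
    pullIntegral ν p (F + F') = pullIntegral ν p F + pullIntegral ν p F' := by
  ext t
  exact integral_add (integrable_slice hp hπ hν h2 hF t) (integrable_slice hp hπ hν h2 hF' t)

/-- Near `t₀`, a function supported in a product of Hausdorff open sets is uniformly close to a
function that does not depend on `t`. -/
theorem eventually_abs_sub_le_of_isCcOn [T2Space V] {p : T → V} {π : W → V}
    (hp : Continuous p) (hπ : Continuous π) {t₀ : T} {B : Set W}
    (hB : IsOpen B) {O : Set (Pull p π)} (hO : IsOpen O) {F : Pull p π → ℝ}
    (hO' : ∀ a : Pull p π, a.1.1 = t₀ → a.1.2 ∈ B → a ∈ O) (hFc : ContinuousOn F O)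
    {g : W → ℝ} (hg : ContinuousOn g B)
    (hgF : ∀ (w : W) (h : π w = p t₀), F ⟨(t₀, w), h⟩ = g w)
    {L : Set W} (hL : IsCompact L) (hLB : L ⊆ B) {ψ : W → ℝ} (hψ0 : ∀ w, 0 ≤ ψ w)
    (hψ : ∀ w ∈ L, ψ w = 1)
    (hFL : ∀ a : Pull p π, a.1.2 ∉ L → F a = 0) (hgL : ∀ w ∉ L, g w = 0) {ε : ℝ} (hε : 0 < ε) :
    ∀ᶠ t in 𝓝 t₀, ∀ (w : W) (h : π w = p t), |F ⟨(t, w), h⟩ - g w| ≤ ε * ψ w := by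
  -- Uniformity in `w` comes from compactness of `L`: the estimate is only needed near each single
  -- point `(t₀, w)`.
  have key : ∀ᶠ t in 𝓝 t₀, ∀ w ∈ L, ∀ h : π w = p t, |F ⟨(t, w), h⟩ - g w| ≤ ε := by
    refine hL.eventually_forall_of_forall_eventually
      (P := fun t w => ∀ h : π w = p t, |F ⟨(t, w), h⟩ - g w| ≤ ε) fun w hw => ?_
    by_cases h0 : π w = p t₀
    · have hc : ContinuousAt (fun a : Pull p π => F a - g a.1.2) ⟨(t₀, w), h0⟩ := by
        refine (hFc.continuousAt (hO.mem_nhds (hO' _ rfl (hLB hw)))).sub ?_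
        exact (hg.continuousAt (hB.mem_nhds (hLB hw))).comp
          (f := fun a : Pull p π => a.1.2) (by fun_prop)
      have hz : F ⟨(t₀, w), h0⟩ - g w = 0 := by rw [hgF w h0, sub_self]
      have h1 : ∀ᶠ a : Pull p π in 𝓝 ⟨(t₀, w), h0⟩, |F a - g a.1.2| ≤ ε := by
        have := hc.eventually (Metric.closedBall_mem_nhds _ hε)
        filter_upwards [this] with a ha
        have ha' : |F a - g a.1.2 - (F ⟨(t₀, w), h0⟩ - g w)| ≤ ε := by
          simpa only [mem_ofPred_eq, Metric.mem_closedBall, Real.dist_eq] using ha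
        rwa [hz, sub_zero] at ha'
      rw [nhds_subtype_eq_comap, eventually_comap] at h1
      filter_upwards [h1] with z hz h
      exact hz ⟨(z.1, z.2), h⟩ rfl
    -- Here `(t₀, w)` lies outside the fibre product, which is closed since `V` is Hausdorff, so the
    -- estimate is vacuous nearby.
    · have h1 : ∀ᶠ z : T × W in 𝓝 (t₀, w), π z.2 ≠ p z.1 :=
        (isOpen_ne_fun (hπ.comp continuous_snd) (hp.comp continuous_fst)).mem_nhds h0
      filter_upwards [h1] with z hz h using absurd h hz
  filter_upwards [key] with t ht w h
  by_cases hw : w ∈ L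
  · simpa [hψ w hw] using ht w hw h
  · rw [hFL ⟨(t, w), h⟩ hw, hgL w hw, sub_zero, abs_zero]
    exact mul_nonneg hε.le (hψ0 w)

/-- To prove continuity at `t₀`, extend the slice `F(t₀, ·)` to a test function `g` on `W`. The
integrals of `g` vary continuously by the hypothesis on the family. The error is at most `ε ∫ ψ`,
with one bump function `ψ` that is `1` on a compact set `L` containing all the supports involved. -/
theorem pullIntegral_isCcOn [T2Space V] {p : T → V} {π : W → V} (hT : IsLocallyCompact T)
    (hW : IsLocallyCompact W)
    (hp : Continuous p) (hπ : Continuous π) {ν : ∀ v, Measure {w : W // π w = v}}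
    (hν : IsContinuousFamily π ν) (h2 : ∀ v, T2Space {w : W // π w = v})
    {A : Set T} (hA : IsOpen A) (hA2 : T2Space A) {B : Set W} (hB : IsOpen B) (hB2 : T2Space B)
    {F : Pull p π → ℝ} (hF : IsCcOn F {a : Pull p π | a.1.1 ∈ A ∧ a.1.2 ∈ B}) :
    IsCcOn (pullIntegral ν p F) A := by
  have := hT.t1Space
  obtain ⟨K, hKW, hK, h0⟩ := hF.exists_compact
  refine ⟨hA, hA2, fun t₀ ht₀ => ContinuousAt.continuousWithinAt ?_, (fun a => a.1.1) '' K, ?_,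
    hK.image (by fun_prop), fun t ht => ?_⟩
  · have hLC := hW.locallyCompactSpace_coe hB hB2
    -- the slice at `t₀`, as a function on the closed subspace `π ⁻¹' {p t₀} ∩ B` of `B`
    have hslice : IsCcOn (fun w : {w : W // π w = p t₀} => F ⟨(t₀, w), w.2⟩) (Subtype.val ⁻¹' B) :=
      (hF.comp_isClosedEmbedding (isClosedEmbedding_slice hp hπ t₀)).mono (fun w hw => hw.2)
        (hB.preimage continuous_subtype_val)
        ((isClosedEmbedding_fibre hπ _).isEmbedding.restrictPreimage B).t2Space
    obtain ⟨hc, hs⟩ := hslice.restrict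
    obtain ⟨g₀, hg1, hg2, hg3⟩ := exists_extension_of_hasCompactSupport
      ((isClosedEmbedding_fibre hπ (p t₀)).restrictPreimage B) hc hs
    have hg := isCcOn_extend hB hB2 hg1 hg2
    have hgF : ∀ (w : W) (h : π w = p t₀),
        F ⟨(t₀, w), h⟩ = Function.extend Subtype.val g₀ 0 w := by
      intro w h
      by_cases hw : w ∈ B
      · exact ((Subtype.val_injective.extend_apply g₀ 0 (⟨w, hw⟩ : B)).trans
          (hg3 ⟨⟨w, h⟩, hw⟩)).symm
      · rw [Function.extend_apply' _ _ _ (by rintro ⟨y, rfl⟩; exact hw y.2)]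
        exact h0 _ fun h' => hw (hKW h').2
    set g := Function.extend Subtype.val g₀ 0 with hgdef
    obtain ⟨K', hK'B, hK', h0'⟩ := hg.exists_compact
    set L := K' ∪ (fun a : Pull p π => a.1.2) '' K with hLdef
    have hL : IsCompact L := hK'.union (hK.image (by fun_prop))
    have hLB : L ⊆ B := union_subset hK'B (by rintro _ ⟨a, ha, rfl⟩; exact (hKW ha).2)
    obtain ⟨ψ, hψ, hψ0, -, hψ1⟩ := exists_isCcOn_bump hW hB hB2 hLB hL
    have hclose := fun {ε : ℝ} (hε : 0 < ε) => eventually_abs_sub_le_of_isCcOn hp hπ hB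
      (t₀ := t₀) hF.isOpen (fun a ha hb => ⟨by rw [ha]; exact ht₀, hb⟩) hF.continuousOn
      hg.continuousOn hgF hL hLB
      hψ0 hψ1 (fun a ha => h0 a fun h => ha (Or.inr ⟨a, h, rfl⟩))
      (fun w hw => h0' w fun h => hw (Or.inl h)) hε
    have hcg := (hν.continuous_integral g hg.mem_Cc).comp hp
    have hcψ := (hν.continuous_integral ψ hψ.mem_Cc).comp hp
    have hest : ∀ {ε : ℝ}, 0 < ε → ∀ᶠ t in 𝓝 t₀,
        |pullIntegral ν p F t - ∫ w : {w : W // π w = p t}, g w ∂(ν (p t))| ≤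
          ε * ∫ w : {w : W // π w = p t}, ψ w ∂(ν (p t)) := by
      intro ε hε
      filter_upwards [hclose hε] with t ht
      have i1 := integrable_slice hp hπ hν h2 hF.mem_Cc t
      have i2 := hν.integrable_fibre hπ h2 hg.mem_Cc (p t)
      have i3 := hν.integrable_fibre hπ h2 hψ.mem_Cc (p t)
      rw [pullIntegral, ← integral_sub i1 i2, ← integral_const_mul]
      refine abs_integral_le_integral_abs.trans ?_
      exact integral_mono (i1.sub i2).abs (i3.const_mul ε) fun w => ht w w.2
    have hzero : Tendsto (fun t => pullIntegral ν p F t -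
        ∫ w : {w : W // π w = p t}, g w ∂(ν (p t))) (𝓝 t₀) (𝓝 0) := by
      rw [Metric.tendsto_nhds]
      intro ε hε
      set c := ∫ w : {w : W // π w = p t₀}, ψ w ∂(ν (p t₀)) with hcdef
      have hc0 : 0 ≤ c := integral_nonneg fun w => hψ0 w
      -- Near `t₀` the integral of `ψ` is below `c + 1`; dividing by `c + 2` keeps the final
      -- inequality strict.
      have hδ : 0 < ε / (c + 2) := by positivity
      have hev : ∀ᶠ t in 𝓝 t₀, ∫ w : {w : W // π w = p t}, ψ w ∂(ν (p t)) < c + 1 :=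
        hcψ.continuousAt.eventually (gt_mem_nhds (show c < c + 1 by linarith))
      filter_upwards [hest hδ, hev] with t ht ht'
      rw [Real.dist_eq, sub_zero]
      refine ht.trans_lt ?_
      calc ε / (c + 2) * ∫ w : {w : W // π w = p t}, ψ w ∂(ν (p t))
          ≤ ε / (c + 2) * (c + 1) := by gcongr
        _ < ε / (c + 2) * (c + 2) := by gcongr; linarith
        _ = ε := by field_simp
    have hlim := hzero.add hcg.continuousAt
    have h00 : pullIntegral ν p F t₀ = 0 + ∫ w : {w : W // π w = p t₀}, g w ∂(ν (p t₀)) := by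
      rw [zero_add]
      exact integral_congr_ae (Eventually.of_forall fun w => hgF w w.2)
    rw [ContinuousAt, h00]
    refine hlim.congr fun t => ?_
    simp only [Function.comp_apply]
    ring
  · rintro _ ⟨a, ha, rfl⟩
    exact (hKW ha).1
  · have : ∀ w : {w : W // π w = p t}, F ⟨(t, w), w.2⟩ = 0 := fun w =>
      h0 _ fun h => ht ⟨_, h, rfl⟩
    simp [pullIntegral, this]

/-- Integration along the pull-back of a continuous family of measures preserves `C_c`. -/
theorem pullIntegral_mem_Cc [T2Space V] {p : T → V} {π : W → V} (hT : IsLocallyCompact T)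
    (hW : IsLocallyCompact W)
    (hp : Continuous p) (hπ : Continuous π) {ν : ∀ v, Measure {w : W // π w = v}}
    (hν : IsContinuousFamily π ν) (h2 : ∀ v, T2Space {w : W // π w = v})
    {F : Pull p π → ℝ} (hF : F ∈ Cc (Pull p π)) : pullIntegral ν p F ∈ Cc T := by
  have := hT.t1Space
  choose A hA hmA hA2 using hT.exists_isOpen
  choose B hB hmB hB2 using hW.exists_isOpen
  refine Cc_induction_on_cover (P := fun F => pullIntegral ν p F ∈ Cc T) (hT.pull hW hp hπ)
    (fun a => {a' : Pull p π | a'.1.1 ∈ A a.1.1 ∧ a'.1.2 ∈ B a.1.2}) (fun a => ?_)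
    (fun a => ⟨hmA _, hmB _⟩) (fun a F O hO hF => ?_) ?_ (fun f g hf hg hf' hg' => ?_) hF
  · exact ((hA _).preimage (by fun_prop : Continuous fun a' : Pull p π => a'.1.1)).inter
      ((hB _).preimage (by fun_prop : Continuous fun a' : Pull p π => a'.1.2))
  · refine (pullIntegral_isCcOn hT hW hp hπ hν h2 (hA a.1.1) (hA2 _) (hB a.1.2) (hB2 _)
      (hF.mono hO ?_ ?_)).mem_Cc
    · exact ((hA _).preimage (by fun_prop : Continuous fun a' : Pull p π => a'.1.1)).inter
        ((hB _).preimage (by fun_prop : Continuous fun a' : Pull p π => a'.1.2))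
    · have := hA2 a.1.1
      have := hB2 a.1.2
      have h1 : T2Space (A a.1.1 ×ˢ B a.1.2 : Set (T × W)) :=
        (Homeomorph.Set.prod _ _).isEmbedding.t2Space
      exact (Topology.IsEmbedding.subtypeVal.restrictPreimage
        (A a.1.1 ×ˢ B a.1.2 : Set (T × W))).t2Space
  · convert (Cc T).zero_mem using 1
    ext t
    simp [pullIntegral]
  · rw [pullIntegral_add hp hπ hν h2 hf hg]
    exact (Cc T).add_mem hf' hg'

theorem integral_eq_zero_of_Cc {A : Type*} [TopologicalSpace A] [T2Space A] [MeasurableSpace A]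
    [BorelSpace A] {μ : Measure A} [IsFiniteMeasureOnCompacts μ] [μ.IsOpenPosMeasure]
    {f : A → ℝ} (hf : f ∈ Cc A) (h0 : ∀ a, 0 ≤ f a) (h : ∫ a, f a ∂μ = 0) (a : A) : f a = 0 := by
  by_contra hne
  have := ((mem_Cc_iff f).1 hf).1.integral_pos_of_hasCompactSupport_nonneg_nonzero (μ := μ)
    ((mem_Cc_iff f).1 hf).2 h0 hne
  exact this.ne' h

theorem eq_zero_of_pullIntegral_eq_zero [T2Space V] [T1Space T] {p : T → V} {π : W → V}
    (hp : Continuous p) (hπ : Continuous π) {ν : ∀ v, Measure {w : W // π w = v}}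
    (hν : IsContinuousFamily π ν) (h2 : ∀ v, T2Space {w : W // π w = v}) {F : Pull p π → ℝ}
    (hF : F ∈ Cc (Pull p π)) (h0 : ∀ a, 0 ≤ F a) {t : T} (h : pullIntegral ν p F t = 0) (w : W)
    (hw : π w = p t) : F ⟨(t, w), hw⟩ = 0 := by
  have := hν.regular (p t)
  have := hν.fullSupport (p t)
  have := h2 (p t)
  exact integral_eq_zero_of_Cc (μ := ν (p t))
    (Cc_comp_isClosedEmbedding hF (isClosedEmbedding_slice hp hπ t))
    (fun _ => h0 _) h ⟨w, hw⟩

theorem pullIntegral_nonneg {p : T → V} {π : W → V} {ν : ∀ v, Measure {w : W // π w = v}}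
    {F : Pull p π → ℝ} (h0 : ∀ a, 0 ≤ F a) (t : T) : 0 ≤ pullIntegral ν p F t :=
  integral_nonneg fun _ => h0 _

end Pullback

/-! ### Fibres and arrows of groupoids, and quasi-invariance of a single measure. -/

section Groupoids

open Set Filter Topology

set_option linter.unusedSectionVars false

variable {G U : Type*} [TopologicalSpace G] [TopologicalSpace U]

namespace TopGroupoid

variable (𝒢 : TopGroupoid G U)

theorem continuous_mul_of {T : Type*} [TopologicalSpace T] {f g : T → G} (hf : Continuous f)
    (hg : Continuous g) (h : ∀ t, 𝒢.src (f t) = 𝒢.rng (g t)) :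
    Continuous fun t => 𝒢.mul (f t) (g t) (h t) :=
  𝒢.continuous_mul.comp (Continuous.subtype_mk (hf.prodMk hg) h)

/-- The range fibres of a locally compact groupoid with Hausdorff unit space are Hausdorff. -/
theorem t2Space_fibre [T2Space U] (hG : IsLocallyCompact G) (u : U) :
    T2Space {γ : G // 𝒢.rng γ = u} := by
  have := hG.t1Space
  rw [t2_iff_isClosed_diagonal]
  -- The diagonal consists of the pairs with equal sources and `a b⁻¹ = 1_u`. The first condition is
  -- closed because `U` is Hausdorff, the second because points of `G` are closed.
  let E : Set ({γ : G // 𝒢.rng γ = u} × {γ : G // 𝒢.rng γ = u}) :=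
    {q | 𝒢.src q.1.1 = 𝒢.src q.2.1}
  have hE : IsClosed E := isClosed_eq
    (𝒢.continuous_src.comp (by fun_prop)) (𝒢.continuous_src.comp (by fun_prop))
  let φ : E → G := fun q =>
    𝒢.mul q.1.1.1 (𝒢.inv q.1.2.1) (q.2.trans (𝒢.rng_inv _).symm)
  have hφ : Continuous φ := 𝒢.continuous_mul_of (by fun_prop)
    (𝒢.continuous_inv.comp (by fun_prop : Continuous fun q : E => q.1.2.1)) _
  have h1 : IsClosed (φ ⁻¹' {𝒢.unit u}) := isClosed_singleton.preimage hφ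
  convert hE.isClosedEmbedding_subtypeVal.isClosedMap _ h1 using 1
  ext ⟨a, b⟩
  constructor
  · intro hab
    obtain rfl : a = b := hab
    exact ⟨⟨(a, a), rfl⟩, (𝒢.mul_inv a.1).trans (congrArg 𝒢.unit a.2), rfl⟩
  · rintro ⟨⟨⟨a', b'⟩, h⟩, h', e⟩
    obtain ⟨rfl, rfl⟩ := Prod.mk.inj e
    have h2 := 𝒢.eq_inv_of_mul_eq_unit a'.1 (𝒢.inv b'.1) (h.trans (𝒢.rng_inv _).symm)
      (Eq.trans h' (congrArg 𝒢.unit a'.2.symm))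
    refine Subtype.ext ?_
    rw [← 𝒢.inv_inv a'.1, ← h2, 𝒢.inv_inv]

end TopGroupoid

/-- The range map of a locally compact groupoid with a Haar system is open. -/
theorem HaarSystem.isOpenMap_rng [T2Space U] [MeasurableSpace G] [BorelSpace G]
    {𝒢 : TopGroupoid G U} (χ : HaarSystem 𝒢) (hG : IsLocallyCompact G) : IsOpenMap 𝒢.rng := by
  intro O hO
  rw [isOpen_iff_mem_nhds]
  rintro _ ⟨γ, hγ, rfl⟩
  obtain ⟨φ, hφ, h0, h1, hφO⟩ := exists_Cc_bump hG hO hγ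
  have h2 := 𝒢.t2Space_fibre hG (𝒢.rng γ)
  have := χ.isContinuousFamily.regular (𝒢.rng γ)
  have := χ.isContinuousFamily.fullSupport (𝒢.rng γ)
  -- Full support makes the integral of a bump function supported in `O` positive at `r(γ)`. By
  -- continuity it stays positive for nearby `u`, which forces the fibre over `u` to meet `O`.
  have hpos : 0 < ∫ x : {x : G // 𝒢.rng x = 𝒢.rng γ}, φ x ∂(χ.meas (𝒢.rng γ)) := by
    have hc := (mem_Cc_iff _).1
      (Cc_comp_isClosedEmbedding hφ (isClosedEmbedding_fibre 𝒢.continuous_rng (𝒢.rng γ)))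
    exact hc.1.integral_pos_of_hasCompactSupport_nonneg_nonzero (x := ⟨γ, rfl⟩) hc.2
      (fun _ => h0 _) (by simp [h1])
  filter_upwards [(χ.isContinuousFamily.continuous_integral φ hφ).continuousAt.eventually
    (lt_mem_nhds hpos)] with u hu
  by_contra hne
  refine hu.ne' ?_
  have : ∀ x : {x : G // 𝒢.rng x = u}, φ x = 0 := fun x =>
    hφO _ fun hx => hne ⟨x, hx, x.2⟩
  simp [this]

theorem isClosedEmbedding_of_involutive {A : Type*} [TopologicalSpace A] {f : A → A}
    (hf : Continuous f) (h : ∀ a, f (f a) = a) : IsClosedEmbedding f :=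
  (Homeomorph.mk ⟨f, f, h, h⟩ hf hf).isClosedEmbedding

namespace LeftAction

variable {Y : Type*} {𝒢 : TopGroupoid G U} (L : LeftAction 𝒢 Y)

theorem inv_act (g : G) (y : Y) (p : 𝒢.src g = L.mom y)
    (q : 𝒢.src (𝒢.inv g) = L.mom (L.act g y p)) : L.act (𝒢.inv g) (L.act g y p) q = y := by
  rw [← L.mul_act (𝒢.inv g) g y (𝒢.src_inv g) p,
    L.act_congr _ ((𝒢.inv_mul g).trans (congrArg 𝒢.unit p)) rfl, L.unit_act]

theorem act_inv (g : G) (y : Y) (p : 𝒢.src (𝒢.inv g) = L.mom y)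
    (q : 𝒢.src g = L.mom (L.act (𝒢.inv g) y p)) : L.act g (L.act (𝒢.inv g) y p) q = y := by
  have := L.inv_act (𝒢.inv g) y p ((𝒢.src_inv _).trans (L.mom_act _ _ _).symm)
  rwa [L.act_congr _ (𝒢.inv_inv g) rfl] at this

theorem IsContinuous.continuous_act_of [TopologicalSpace Y] {L : LeftAction 𝒢 Y}
    (hL : L.IsContinuous) {T : Type*} [TopologicalSpace T] {f : T → G} {g : T → Y}
    (hf : Continuous f) (hg : Continuous g) (h : ∀ t, 𝒢.src (f t) = L.mom (g t)) :
    Continuous fun t => L.act (f t) (g t) (h t) :=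
  hL.continuous_act.comp (Continuous.subtype_mk (hf.prodMk hg) h)

/-- Arrows of the transformation groupoid, parametrized by `(y, γ)` with `r(γ) = r(y)`: the arrow
`γ` that ends in `y`. -/
abbrev InArrows : Type _ := Pull L.mom 𝒢.rng

/-- The arrow `(γ, γ⁻¹ y)` of `G ⋉ Y`. -/
def toArrow (a : L.InArrows) : L.Arrows :=
  ⟨(a.1.2, L.act (𝒢.inv a.1.2) a.1.1 ((𝒢.src_inv _).trans a.2)),
    ((L.mom_act _ _ _).trans (𝒢.rng_inv _)).symm⟩

/-- The end point and the group element of an arrow of `G ⋉ Y`. -/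
def ofArrow (a : L.Arrows) : L.InArrows :=
  ⟨(L.act a.1.1 a.1.2 a.2, a.1.1), (L.mom_act _ _ _).symm⟩

/-- Inversion of arrows, `(y, γ) ↦ (γ⁻¹ y, γ⁻¹)`. -/
def invArrow (a : L.InArrows) : L.InArrows :=
  ⟨(L.act (𝒢.inv a.1.2) a.1.1 ((𝒢.src_inv _).trans a.2), 𝒢.inv a.1.2), (L.mom_act _ _ _).symm⟩

theorem toArrow_ofArrow (a : L.Arrows) : L.toArrow (L.ofArrow a) = a :=
  Subtype.ext (Prod.ext rfl (L.inv_act _ _ _ _))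

theorem ofArrow_toArrow (a : L.InArrows) : L.ofArrow (L.toArrow a) = a :=
  Subtype.ext (Prod.ext (L.act_inv _ _ _ _) rfl)

theorem invArrow_invArrow (a : L.InArrows) : L.invArrow (L.invArrow a) = a := by
  refine Subtype.ext (Prod.ext ?_ (𝒢.inv_inv _))
  exact (L.act_congr _ (𝒢.inv_inv _) rfl).trans (L.act_inv _ _ _ _)

theorem toArrow_invArrow (a : L.InArrows) :
    L.toArrow (L.invArrow a) = ⟨(𝒢.inv a.1.2, a.1.1), (𝒢.src_inv _).trans a.2⟩ := by
  refine Subtype.ext (Prod.ext rfl ?_)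
  exact (L.act_congr _ (𝒢.inv_inv _) rfl).trans (L.act_inv _ _ _ _)

section Continuity

variable [TopologicalSpace Y] {L} (hL : L.IsContinuous)

include hL

theorem IsContinuous.continuous_toArrow : Continuous L.toArrow :=
  Continuous.subtype_mk ((by fun_prop : Continuous fun a : L.InArrows => a.1.2).prodMk
    (hL.continuous_act_of (𝒢.continuous_inv.comp (by fun_prop)) (by fun_prop) _)) _

theorem IsContinuous.continuous_ofArrow : Continuous L.ofArrow :=
  Continuous.subtype_mk ((hL.continuous_act_of (by fun_prop) (by fun_prop) _).prodMk
    (by fun_prop : Continuous fun a : L.Arrows => a.1.1)) _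

theorem IsContinuous.continuous_invArrow : Continuous L.invArrow :=
  Continuous.subtype_mk ((hL.continuous_act_of (𝒢.continuous_inv.comp (by fun_prop))
    (by fun_prop) _).prodMk (𝒢.continuous_inv.comp (by fun_prop))) _

theorem IsContinuous.isClosedEmbedding_toArrow : IsClosedEmbedding L.toArrow :=
  (Homeomorph.mk ⟨L.toArrow, L.ofArrow, L.ofArrow_toArrow, L.toArrow_ofArrow⟩
    hL.continuous_toArrow hL.continuous_ofArrow).isClosedEmbedding

theorem IsContinuous.isClosedEmbedding_ofArrow : IsClosedEmbedding L.ofArrow :=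
  (Homeomorph.mk ⟨L.ofArrow, L.toArrow, L.toArrow_ofArrow, L.ofArrow_toArrow⟩
    hL.continuous_ofArrow hL.continuous_toArrow).isClosedEmbedding

theorem IsContinuous.isClosedEmbedding_invArrow : IsClosedEmbedding L.invArrow :=
  isClosedEmbedding_of_involutive hL.continuous_invArrow L.invArrow_invArrow

end Continuity

/-- `D` implements the quasi-invariance of the single measure `m`. -/
def IsQuasiInvariant [TopologicalSpace Y] [MeasurableSpace G] [MeasurableSpace Y]
    (χ : HaarSystem 𝒢) (m : Measure Y) (D : L.InArrows → ℝ) : Prop :=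
  ∀ F ∈ Cc L.InArrows,
    ∫ y, pullIntegral χ.meas L.mom (fun a => F (L.invArrow a)) y ∂m =
      ∫ y, pullIntegral χ.meas L.mom (fun a => F a * D a) y ∂m

/-- The action on an invariant subset `π ⁻¹' {v}`. -/
def fibre {V : Type*} (π : Y → V) (hπ : ∀ g y p, π (L.act g y p) = π y) (v : V) :
    LeftAction 𝒢 {y : Y // π y = v} where
  mom y := L.mom y
  act g y p := ⟨L.act g y p, (hπ _ _ _).trans y.2⟩
  mom_act _ _ _ := L.mom_act _ _ _
  unit_act _ := Subtype.ext (L.unit_act _)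
  mul_act _ _ _ _ _ := Subtype.ext (L.mul_act _ _ _ _ _)

theorem IsContinuous.fibre [TopologicalSpace Y] {L : LeftAction 𝒢 Y} (hL : L.IsContinuous)
    {V : Type*} (π : Y → V) (hπ : ∀ g y p, π (L.act g y p) = π y) (v : V) :
    (L.fibre π hπ v).IsContinuous where
  continuous_mom := hL.continuous_mom.comp continuous_subtype_val
  continuous_act := by
    refine Continuous.subtype_mk ?_ _
    exact hL.continuous_act_of
      (f := fun p : (L.fibre π hπ v).Arrows => p.1.1)
      (g := fun p : (L.fibre π hπ v).Arrows => p.1.2.1) (by fun_prop) (by fun_prop)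
      (fun p : (L.fibre π hπ v).Arrows => p.2)

end LeftAction

theorem isClosedEmbedding_pull_comp {T T' V W : Type*} [TopologicalSpace T] [TopologicalSpace T']
    [TopologicalSpace V] [TopologicalSpace W] [T2Space V] {p : T → V} {π : W → V}
    (hp : Continuous p) (hπ : Continuous π) {i : T' → T} (hi : IsClosedEmbedding i) :
    IsClosedEmbedding (fun a : Pull (fun t => p (i t)) π => (⟨(i a.1.1, a.1.2), a.2⟩ : Pull p π)) := by
  rw [← IsClosedEmbedding.of_comp_iff (isClosedEmbedding_pull hp hπ)]
  exact (hi.prodMap IsClosedEmbedding.id).comp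
    (isClosedEmbedding_pull (hp.comp hi.continuous) hπ)

theorem pullIntegral_sub {T V W : Type*} [TopologicalSpace T] [TopologicalSpace V]
    [TopologicalSpace W] [MeasurableSpace W] [BorelSpace W] [T2Space V] [T1Space T]
    {p : T → V} {π : W → V}
    (hp : Continuous p) (hπ : Continuous π) {ν : ∀ v, Measure {w : W // π w = v}}
    (hν : IsContinuousFamily π ν) (h2 : ∀ v, T2Space {w : W // π w = v}) {F F' : Pull p π → ℝ}
    (hF : F ∈ Cc (Pull p π)) (hF' : F' ∈ Cc (Pull p π)) (t : T) :
    pullIntegral ν p (fun a => F a - F' a) t = pullIntegral ν p F t - pullIntegral ν p F' t :=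
  integral_sub (integrable_slice hp hπ hν h2 hF t) (integrable_slice hp hπ hν h2 hF' t)

/-- A continuous function is determined by the integrals of its products with test functions,
for measures given by successive integration. -/
theorem eq_of_forall_integral_mul_eq {T A : Type*} [TopologicalSpace T] [TopologicalSpace A]
    [T2Space T] [MeasurableSpace T] [BorelSpace T] {m : Measure T} [IsFiniteMeasureOnCompacts m]
    [m.IsOpenPosMeasure] (hA : IsLocallyCompact A) (I : (A → ℝ) → T → ℝ)
    (hI : ∀ F ∈ Cc A, I F ∈ Cc T)
    (hsub : ∀ F ∈ Cc A, ∀ F' ∈ Cc A, ∀ t, I (fun a => F a - F' a) t = I F t - I F' t)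
    (h0 : ∀ F ∈ Cc A, (∀ a, 0 ≤ F a) → ∀ t, 0 ≤ I F t)
    (hz : ∀ F ∈ Cc A, (∀ a, 0 ≤ F a) → (∀ t, I F t = 0) → ∀ a, F a = 0)
    {D D' : A → ℝ} (hD : Continuous D) (hD' : Continuous D')
    (h : ∀ F ∈ Cc A, ∫ t, I (fun a => F a * D a) t ∂m = ∫ t, I (fun a => F a * D' a) t ∂m) :
    D = D' := by
  ext a
  obtain ⟨φ, hφ, hφ0, hφ1, -⟩ := exists_Cc_bump hA isOpen_univ (mem_univ a)
  -- Testing against `φ (D - D')` yields the vanishing integral of the nonnegative function `φ (D -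
  -- D')²`, and `φ a = 1`.
  have hF : (fun a => φ a * (D a - D' a)) ∈ Cc A := Cc_mul_continuous hφ (hD.sub hD')
  have h1 := Cc_mul_continuous hF hD
  have h2 := Cc_mul_continuous hF hD'
  have h3 := (Cc A).sub_mem h1 h2
  have hpos : ∀ a, 0 ≤ φ a * (D a - D' a) * D a - φ a * (D a - D' a) * D' a := fun a => by
    rw [← mul_sub, mul_assoc]
    exact mul_nonneg (hφ0 a) (mul_self_nonneg _)
  have h4 : ∫ t, I (fun a => φ a * (D a - D' a) * D a - φ a * (D a - D' a) * D' a) t ∂m = 0 := by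
    simp_rw [hsub _ h1 _ h2]
    rw [integral_sub (Cc_integrable (hI _ h1) m) (Cc_integrable (hI _ h2) m), h _ hF, sub_self]
  have h5 := hz _ h3 hpos (integral_eq_zero_of_Cc (hI _ h3) (h0 _ h3 hpos) h4) a
  simp only [Pi.sub_apply, hφ1, one_mul] at h5
  nlinarith [h5]

section SingleMeasure

variable {Y : Type*} [TopologicalSpace Y] [T2Space U]
  [MeasurableSpace G] [BorelSpace G] [MeasurableSpace Y] [BorelSpace Y]
  {𝒢 : TopGroupoid G U} (χ : HaarSystem 𝒢) {L : LeftAction 𝒢 Y} {m : Measure Y}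

theorem HaarSystem.pullIntegral_mem_Cc (hG : IsLocallyCompact G) {T : Type*} [TopologicalSpace T]
    (hT : IsLocallyCompact T) {p : T → U} (hp : Continuous p) {F : Pull p 𝒢.rng → ℝ}
    (hF : F ∈ Cc (Pull p 𝒢.rng)) : pullIntegral χ.meas p F ∈ Cc T :=
  _root_.pullIntegral_mem_Cc hT hG hp 𝒢.continuous_rng χ.isContinuousFamily (𝒢.t2Space_fibre hG) hF

variable {χ} [T2Space Y] [IsFiniteMeasureOnCompacts m]

/-- The function that implements quasi-invariance is unique. -/
theorem LeftAction.IsQuasiInvariant.unique [m.IsOpenPosMeasure]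
    (hG : IsLocallyCompact G) (hY : IsLocallyCompact Y)
    (hL : L.IsContinuous) {D D' : L.InArrows → ℝ} (hD : Continuous D) (hD' : Continuous D')
    (h : L.IsQuasiInvariant χ m D) (h' : L.IsQuasiInvariant χ m D') : D = D' := by
  have h2 := 𝒢.t2Space_fibre hG
  refine eq_of_forall_integral_mul_eq (m := m) (hY.pull hG hL.continuous_mom 𝒢.continuous_rng)
    (pullIntegral χ.meas L.mom) (fun F hF => χ.pullIntegral_mem_Cc hG hY hL.continuous_mom hF)
    (fun F hF F' hF' => pullIntegral_sub hL.continuous_mom 𝒢.continuous_rng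
      χ.isContinuousFamily h2 hF hF') (fun F _ h0 => pullIntegral_nonneg h0)
    (fun F hF h0 hz a => ?_) hD hD' fun F hF => (h F hF).symm.trans (h' F hF)
  exact eq_zero_of_pullIntegral_eq_zero hL.continuous_mom 𝒢.continuous_rng
    χ.isContinuousFamily h2 hF h0 (hz a.1.1) a.1.2 a.2

end SingleMeasure

end Groupoids

/-! ### Right translations between fibres. -/

section RightTranslation

open Set Filter Topology

variable {G U : Type*} [TopologicalSpace G] [TopologicalSpace U] {𝒢 : TopGroupoid G U}

theorem RightAction.act_inv_act {W : Type*} (R : RightAction 𝒢 W) (x : W) (g : G)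
    (p : R.mom x = 𝒢.rng (𝒢.inv g)) (q : R.mom (R.act x (𝒢.inv g) p) = 𝒢.rng g) :
    R.act (R.act x (𝒢.inv g) p) g q = x :=
  (R.act_congr _ rfl (𝒢.inv_inv g).symm).trans (R.act_act_inv x (𝒢.inv g) p)

theorem RightAction.IsContinuous.continuous_act_of {W : Type*} [TopologicalSpace W]
    {R : RightAction 𝒢 W} (hR : R.IsContinuous) {T : Type*} [TopologicalSpace T] {f : T → W}
    {g : T → G} (hf : Continuous f) (hg : Continuous g) (h : ∀ t, R.mom (f t) = 𝒢.rng (g t)) :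
    Continuous fun t => R.act (f t) (g t) (h t) :=
  hR.continuous_act.comp (Continuous.subtype_mk (hf.prodMk hg) h)

/-- Right translation as a homeomorphism of fibres. -/
def RightAction.translateHomeo {W : Type*} [TopologicalSpace W] {R : RightAction 𝒢 W}
    (hR : R.IsContinuous) (g : G) : {x : W // R.mom x = 𝒢.rng g} ≃ₜ {x : W // R.mom x = 𝒢.src g} where
  toFun := R.translate g
  invFun x := ⟨R.act x (𝒢.inv g) (x.2.trans (𝒢.rng_inv g).symm),
    (R.mom_act _ _ _).trans (𝒢.src_inv g)⟩
  left_inv x := Subtype.ext (R.act_act_inv x g x.2)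
  right_inv x := Subtype.ext (R.act_inv_act x g _ _)
  continuous_toFun := Continuous.subtype_mk (hR.continuous_act_of (by fun_prop) (by fun_prop) _) _
  continuous_invFun := Continuous.subtype_mk (hR.continuous_act_of (by fun_prop) (by fun_prop) _) _

/-- The units `u` and `u'` are variables tied to `g` by equations, so that the formula applies when
the fibres in question are not syntactically those over `r(g)` and `s(g)`. -/
theorem RightAction.IsInvariant.integral_translate {W : Type*} [TopologicalSpace W]
    [MeasurableSpace W] [BorelSpace W] {R : RightAction 𝒢 W} (hR : R.IsContinuous)
    {ν : ∀ u, Measure {x : W // R.mom x = u}} (hν : R.IsInvariant ν) (g : G) {u u' : U}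
    (hu : u = 𝒢.rng g) (hu' : 𝒢.src g = u') (f : {x : W // R.mom x = u'} → ℝ) :
    ∫ x, f x ∂(ν u') =
      ∫ x : {x : W // R.mom x = u}, f ⟨R.act x g (x.2.trans hu), (R.mom_act _ _ _).trans hu'⟩
        ∂(ν u) := by
  subst hu hu'
  rw [← hν g]
  exact (RightAction.translateHomeo hR g).measurableEmbedding.integral_map f

end RightTranslation

/-! ### Quasi-invariance on fibres and fibre products, and multiplicativity from a braid relation.
-/

section AdjoiningFunctions

open Set Filter Topology

set_option linter.unusedSectionVars false

variable {G U Y : Type*} [TopologicalSpace G] [TopologicalSpace U] [TopologicalSpace Y]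
  [T2Space U] [MeasurableSpace G] [BorelSpace G] [MeasurableSpace Y] [BorelSpace Y]
  {𝒢 : TopGroupoid G U} {χ : HaarSystem 𝒢} {L : LeftAction 𝒢 Y}

/-- The adjoining function along the arrows ending in a fibre of `π`. -/
def LeftAction.fibreFunction (L : LeftAction 𝒢 Y) {V : Type*} (π : Y → V)
    (hπ : ∀ g y p, π (L.act g y p) = π y) (Δ : L.Arrows → ℝ) (v : V)
    (a : (L.fibre π hπ v).InArrows) : ℝ :=
  Δ (L.toArrow ⟨(a.1.1, a.1.2), a.2⟩)

theorem LeftAction.continuous_fibreFunction (hL : L.IsContinuous) {V : Type*} (π : Y → V)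
    (hπ : ∀ g y p, π (L.act g y p) = π y) {Δ : L.Arrows → ℝ} (hΔ : Continuous Δ) (v : V) :
    Continuous (L.fibreFunction π hπ Δ v) :=
  hΔ.comp (hL.continuous_toArrow.comp (Continuous.subtype_mk (by fun_prop) _))

theorem LeftAction.isClosedEmbedding_fibre_toArrow {V : Type*} [TopologicalSpace V] [T1Space V]
    {π : Y → V} (hc : Continuous π)
    (hπ : ∀ g y p, π (L.act g y p) = π y) (hL : L.IsContinuous) (v : V) :
    IsClosedEmbedding (fun a : (L.fibre π hπ v).InArrows => L.toArrow ⟨(a.1.1, a.1.2), a.2⟩) :=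
  hL.isClosedEmbedding_toArrow.comp (isClosedEmbedding_pull_comp hL.continuous_mom
    𝒢.continuous_rng (isClosedEmbedding_fibre hc v))

/-- A continuous positive function is adjoining if and only if it implements the quasi-invariance
of the measure on each fibre. -/
theorem LeftAction.isAdjoiningFunction_iff (hG : IsLocallyCompact G) (hY : IsLocallyCompact Y)
    (hL : L.IsContinuous) {V : Type*} [TopologicalSpace V] [T1Space V] {π : Y → V}
    (hc : Continuous π) (hπ : ∀ g y p, π (L.act g y p) = π y)
    {ν : ∀ v, Measure {y : Y // π y = v}} {Δ : L.Arrows → ℝ} :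
    L.IsAdjoiningFunction χ π ν Δ ↔ Continuous Δ ∧ (∀ a, 0 < Δ a) ∧
      ∀ v, (L.fibre π hπ v).IsQuasiInvariant χ (ν v) (L.fibreFunction π hπ Δ v) := by
  have hY' : IsLocallyCompact L.Arrows :=
    (hY.pull hG hL.continuous_mom 𝒢.continuous_rng).of_isClosedEmbedding hL.isClosedEmbedding_ofArrow
  have key : ∀ (v : V) (F : L.Arrows → ℝ),
      (∫ x : {x : Y // π x = v}, ∫ γ : {γ : G // 𝒢.rng γ = L.mom x},
        F ⟨(𝒢.inv γ, x), (𝒢.src_inv γ).trans γ.2⟩ ∂(χ.meas (L.mom x)) ∂(ν v)) =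
      ∫ y, pullIntegral χ.meas (L.fibre π hπ v).mom (fun a : (L.fibre π hπ v).InArrows =>
        F (L.toArrow ⟨(((L.fibre π hπ v).invArrow a).1.1, ((L.fibre π hπ v).invArrow a).1.2),
          ((L.fibre π hπ v).invArrow a).2⟩)) y ∂(ν v) := by
    intro v F
    refine integral_congr_ae (Eventually.of_forall fun y => ?_)
    refine integral_congr_ae (Eventually.of_forall fun γ => ?_)
    exact congrArg F (L.toArrow_invArrow ⟨(y, γ), γ.2⟩).symm
  constructor
  · intro h
    refine ⟨h.continuous, h.pos, fun v F hF => ?_⟩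
    -- Quasi-invariance on one fibre follows from the global statement because the arrows over the
    -- fibre form a closed subspace, from which test functions extend.
    obtain ⟨F', hF', he⟩ := Cc_exists_extension hY'
      (L.isClosedEmbedding_fibre_toArrow hc hπ hL v) hF
    have h1 := h.integral_eq v F' hF'
    rw [key] at h1
    simp_rw [he] at h1
    refine h1.trans ?_
    refine integral_congr_ae (Eventually.of_forall fun y => ?_)
    refine integral_congr_ae (Eventually.of_forall fun γ => ?_)
    exact congrArg (· * _) (he ⟨(y, γ), γ.2⟩)
  · rintro ⟨h1, h2, h3⟩
    refine ⟨h1, h2, fun v F hF => ?_⟩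
    rw [key]
    exact h3 v _ (Cc_comp_isClosedEmbedding hF (L.isClosedEmbedding_fibre_toArrow hc hπ hL v))

section Twist

variable {W : Type*} [TopologicalSpace W] (L) (R : RightAction 𝒢 W)

/-- The map `(y, γ, x) ↦ (γ⁻¹ y, γ⁻¹, x γ)`. -/
def LeftAction.twist (a : Pull (fun a : L.InArrows => L.mom a.1.1) R.mom) :
    Pull (fun a : L.InArrows => L.mom a.1.1) R.mom :=
  ⟨(L.invArrow a.1.1, R.act a.1.2 a.1.1.1.2 (a.2.trans a.1.1.2.symm)),
    (R.mom_act _ _ _).trans ((𝒢.rng_inv _).symm.trans (L.mom_act _ _ _).symm)⟩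

theorem LeftAction.twist_twist (a : Pull (fun a : L.InArrows => L.mom a.1.1) R.mom) :
    L.twist R (L.twist R a) = a :=
  Subtype.ext (Prod.ext (L.invArrow_invArrow _) (R.act_act_inv _ _ _))

variable {L R}

theorem LeftAction.continuous_twist (hL : L.IsContinuous) (hR : R.IsContinuous) :
    Continuous (L.twist R) :=
  Continuous.subtype_mk ((hL.continuous_invArrow.comp (by fun_prop)).prodMk
    (hR.continuous_act_of (by fun_prop) (by fun_prop) _)) _

variable [MeasurableSpace W] [BorelSpace W] {ν : ∀ u, Measure {x : W // R.mom x = u}}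

/-- Quasi-invariance on the fibre product of a left and a right space. -/
theorem LeftAction.IsQuasiInvariant.twist (hG : IsLocallyCompact G) (hY : IsLocallyCompact Y)
    (hW : IsLocallyCompact W) (hL : L.IsContinuous) (hR : R.IsContinuous)
    (hν : IsContinuousFamily R.mom ν) (h2 : ∀ u, T2Space {x : W // R.mom x = u})
    (hinv : R.IsInvariant ν) {m : Measure Y} {D : L.InArrows → ℝ} (h : L.IsQuasiInvariant χ m D)
    {F : Pull (fun a : L.InArrows => L.mom a.1.1) R.mom → ℝ} (hF : F ∈ Cc _) :
    ∫ y, pullIntegral χ.meas L.mom (pullIntegral ν (fun a => L.mom a.1.1) F) y ∂m =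
      ∫ y, pullIntegral χ.meas L.mom (pullIntegral ν (fun a => L.mom a.1.1)
        fun a => F (L.twist R a) * D a.1.1) y ∂m := by
  have hP := hY.pull hG hL.continuous_mom 𝒢.continuous_rng
  have h1 : pullIntegral ν (fun a : L.InArrows => L.mom a.1.1) F ∈ Cc L.InArrows :=
    pullIntegral_mem_Cc hP hW (hL.continuous_mom.comp (by fun_prop)) hR.continuous_mom hν h2 hF
  -- Quasi-invariance is applied to the `ν`-integral of `F` composed with inversion, so that the two
  -- inversions on the left cancel.
  have h3 := h _ (Cc_comp_isClosedEmbedding h1 hL.isClosedEmbedding_invArrow)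
  simp_rw [L.invArrow_invArrow] at h3
  refine h3.trans ?_
  congr 1
  ext y
  congr 1
  ext a
  -- Invariance of `ν` replaces the integral over the fibre at `s(γ)` by one over the fibre at
  -- `r(γ)`, with `x` replaced by `x γ`.
  exact (congrArg (· * D a) (hinv.integral_translate hR a.1.2 a.2.symm
    ((𝒢.rng_inv _).symm.trans (L.mom_act _ _ _).symm) _)).trans (integral_mul_const _ _).symm

end Twist

section Swap

variable {T V W W' : Type*} [TopologicalSpace T] [TopologicalSpace V] [TopologicalSpace W]
  [TopologicalSpace W'] [T2Space V] {p : T → V} {π : W → V} {π' : W' → V}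

/-- Exchange of the factors of an iterated fibre product. -/
def Pull.swap (a : Pull (fun a : Pull p π => p a.1.1) π') :
    Pull (fun a : Pull p π' => p a.1.1) π :=
  ⟨(⟨(a.1.1.1.1, a.1.2), a.2⟩, a.1.1.1.2), a.1.1.2⟩

theorem Pull.continuous_swap :
    Continuous (Pull.swap (p := p) (π := π) (π' := π')) :=
  Continuous.subtype_mk (Continuous.prodMk (Continuous.subtype_mk (by fun_prop) _)
    (by fun_prop)) _

theorem Pull.isClosedEmbedding_swap :
    IsClosedEmbedding (Pull.swap (p := p) (π := π) (π' := π')) :=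
  (Homeomorph.mk ⟨Pull.swap (p := p) (π := π) (π' := π'), Pull.swap, fun _ => rfl, fun _ => rfl⟩
    Pull.continuous_swap Pull.continuous_swap).isClosedEmbedding

theorem isClosedEmbedding_slice_slice [T1Space T] (hp : Continuous p) (hπ : Continuous π)
    (hπ' : Continuous π') (t : T) :
    IsClosedEmbedding (fun w : {w : W // π w = p t} × {w : W' // π' w = p t} =>
      (⟨(⟨(t, w.1), w.1.2⟩, w.2), w.2.2⟩ : Pull (fun a : Pull p π => p a.1.1) π')) := by
  rw [← IsClosedEmbedding.of_comp_iff (isClosedEmbedding_pull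
    (hp.comp (by fun_prop : Continuous fun a : Pull p π => a.1.1)) hπ')]
  exact (isClosedEmbedding_slice hp hπ t).prodMap (isClosedEmbedding_fibre hπ' _)

variable [MeasurableSpace W] [BorelSpace W] [MeasurableSpace W'] [BorelSpace W']
  {ν : ∀ v, Measure {w : W // π w = v}} {ν' : ∀ v, Measure {w : W' // π' w = v}}

/-- Restricted to the closed slice over `t`, `F` is continuous with compact support on a product of
two Hausdorff fibres, where Fubini holds for measures finite on compact sets. -/
theorem pullIntegral_pullIntegral_swap [T1Space T] (hp : Continuous p) (hπ : Continuous π)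
    (hπ' : Continuous π') (hν : IsContinuousFamily π ν) (h2 : ∀ v, T2Space {w : W // π w = v})
    (hν' : IsContinuousFamily π' ν') (h2' : ∀ v, T2Space {w : W' // π' w = v})
    {F : Pull (fun a : Pull p π => p a.1.1) π' → ℝ} (hF : F ∈ Cc _) (t : T) :
    pullIntegral ν p (pullIntegral ν' (fun a => p a.1.1) F) t =
      pullIntegral ν' p (pullIntegral ν (fun a => p a.1.1) fun a => F a.swap) t := by
  have := h2 (p t)
  have := h2' (p t)
  have := hν.regular (p t)
  have := hν'.regular (p t)
  have hF' := (mem_Cc_iff _).1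
    (Cc_comp_isClosedEmbedding hF (isClosedEmbedding_slice_slice hp hπ hπ' t))
  exact integral_integral_swap_of_hasCompactSupport
    (f := fun (w : {w : W // π w = p t}) (w' : {w : W' // π' w = p t}) =>
      F ⟨(⟨(t, w), w.2⟩, w'), w'.2⟩) (μ := ν (p t)) (ν := ν' (p t)) hF'.1 hF'.2

end Swap

/-- A groupoid acts on its arrows from the right by `(x, g) ↦ g⁻¹ x`. -/
abbrev TopGroupoid.invMulAction (𝒢 : TopGroupoid G U) : RightAction 𝒢 G where
  mom := 𝒢.rng
  act x g p := 𝒢.mul (𝒢.inv g) x ((𝒢.src_inv g).trans p.symm)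
  mom_act x g p := (𝒢.rng_mul _ _ _).trans (𝒢.rng_inv g)
  act_unit x := by
    rw [𝒢.mul_congr _ (𝒢.inv_unit _) rfl, 𝒢.unit_mul]
  act_mul x g h p q := by
    rw [𝒢.mul_congr _ (𝒢.inv_mul_rev g h q) rfl, 𝒢.mul_assoc]

theorem TopGroupoid.invMulAction_isContinuous : 𝒢.invMulAction.IsContinuous where
  continuous_mom := 𝒢.continuous_rng
  continuous_act := 𝒢.continuous_mul_of (𝒢.continuous_inv.comp (by fun_prop)) (by fun_prop) _

theorem HaarSystem.isInvariant_invMulAction (χ : HaarSystem 𝒢) :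
    𝒢.invMulAction.IsInvariant χ.meas := by
  intro g
  have key : ∀ (u u' : U) (hu : 𝒢.src (𝒢.inv g) = u) (hu' : 𝒢.rng (𝒢.inv g) = u'),
      (χ.meas u).map (fun x : {x : G // 𝒢.rng x = u} =>
        (⟨𝒢.mul (𝒢.inv g) x (hu.trans x.2.symm), (𝒢.rng_mul _ _ _).trans hu'⟩ :
          {x : G // 𝒢.rng x = u'})) = χ.meas u' := by
    rintro _ _ rfl rfl
    exact χ.invariant (𝒢.inv g)
  exact key _ _ (𝒢.src_inv g) (𝒢.rng_inv g)

/-- Let `(y, g, h)` stand for the triple of points `(y, g⁻¹ y, h⁻¹ y)`. The twist exchanges the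
first two points and the swap exchanges the last two, so this is the braid relation of two
transpositions in the symmetric group on three letters. -/
theorem LeftAction.twist_invMul_braid (a : Pull (fun a : L.InArrows => L.mom a.1.1) 𝒢.rng) :
    L.twist 𝒢.invMulAction (Pull.swap (L.twist 𝒢.invMulAction a)) =
      Pull.swap (L.twist 𝒢.invMulAction (Pull.swap a)) := by
  obtain ⟨⟨⟨⟨y, g⟩, hg⟩, h⟩, hh⟩ := a
  simp only at hg hh
  have e : 𝒢.mul (𝒢.inv (𝒢.mul (𝒢.inv g) h ((𝒢.src_inv g).trans (hg.trans hh.symm))))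
      (𝒢.inv g) (by rw [𝒢.src_inv, 𝒢.rng_mul]) = 𝒢.inv h := by
    rw [𝒢.mul_congr _ (𝒢.inv_mul_rev _ _ _) rfl, 𝒢.mul_congr _ (𝒢.mul_congr _ rfl
      (𝒢.inv_inv g)) rfl, 𝒢.mul_assoc _ _ _ _ (𝒢.rng_inv g).symm, 𝒢.mul_congr _ rfl (𝒢.mul_inv g),
      𝒢.mul_congr (g' := 𝒢.inv h) (h' := 𝒢.unit (𝒢.src (𝒢.inv h))) _ rfl
        (congrArg 𝒢.unit (hg.trans (hh.symm.trans (𝒢.src_inv h).symm))), 𝒢.mul_unit]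
  refine Subtype.ext (Prod.ext (Subtype.ext (Prod.ext ?_ ?_)) ?_)
  · exact (L.mul_act _ _ _ _ _).symm.trans (L.act_congr _ e rfl)
  · change 𝒢.inv _ = 𝒢.mul _ _ _
    exact (𝒢.inv_mul_rev _ _ _).trans (𝒢.mul_congr _ rfl (𝒢.inv_inv g))
  · exact e

/-- The function implementing quasi-invariance is multiplicative, in the parametrization of arrows
by their end points. -/
theorem LeftAction.IsQuasiInvariant.mul_eq [T2Space Y] {m : Measure Y}
    [IsFiniteMeasureOnCompacts m] [m.IsOpenPosMeasure]
    (hG : IsLocallyCompact G) (hY : IsLocallyCompact Y)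
    (hL : L.IsContinuous) {D : L.InArrows → ℝ} (hD : Continuous D)
    (h : L.IsQuasiInvariant χ m D) (a : Pull (fun a : L.InArrows => L.mom a.1.1) 𝒢.rng) :
    D a.swap.1.1 = D (L.twist 𝒢.invMulAction a).swap.1.1 * D a.1.1 := by
  have h2 := 𝒢.t2Space_fibre hG
  have hR := 𝒢.invMulAction_isContinuous
  have hp : Continuous fun a : L.InArrows => L.mom a.1.1 := hL.continuous_mom.comp (by fun_prop)
  have hP : IsLocallyCompact L.InArrows := hY.pull hG hL.continuous_mom 𝒢.continuous_rng
  have := hP.t1Space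
  have hτ := L.continuous_twist hL hR
  have hσ := Pull.continuous_swap (p := L.mom) (π := 𝒢.rng) (π' := 𝒢.rng)
  have hτe := isClosedEmbedding_of_involutive hτ (L.twist_twist 𝒢.invMulAction)
  have hσe := Pull.isClosedEmbedding_swap (p := L.mom) (π := 𝒢.rng) (π' := 𝒢.rng)
  have hD1 : Continuous fun a : Pull (fun a : L.InArrows => L.mom a.1.1) 𝒢.rng => D a.1.1 :=
    hD.comp (by fun_prop)
  have hD2 : Continuous fun a : Pull (fun a : L.InArrows => L.mom a.1.1) 𝒢.rng => D a.swap.1.1 :=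
    hD1.comp hσ
  -- With `σ` the swap and `τ` the twist, `hS` says that `σ` preserves the iterated integral and
  -- `hT` that `τ` changes it by the factor `D`. Processing one test function along `σ τ σ` and
  -- along `τ σ τ` collects `D ∘ σ` and `(D ∘ σ ∘ τ) * D` respectively.
  let I : (Pull (fun a : L.InArrows => L.mom a.1.1) 𝒢.rng → ℝ) → Y → ℝ := fun F =>
    pullIntegral χ.meas L.mom (pullIntegral χ.meas (fun a => L.mom a.1.1) F)
  have hI1 : ∀ F ∈ Cc (Pull (fun a : L.InArrows => L.mom a.1.1) 𝒢.rng),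
      pullIntegral χ.meas (fun a : L.InArrows => L.mom a.1.1) F ∈ Cc L.InArrows :=
    fun F hF => χ.pullIntegral_mem_Cc hG hP hp hF
  have hS : ∀ F ∈ Cc (Pull (fun a : L.InArrows => L.mom a.1.1) 𝒢.rng),
      ∫ y, I F y ∂m = ∫ y, I (fun a => F a.swap) y ∂m := fun F hF => by
    refine integral_congr_ae (Eventually.of_forall fun y => ?_)
    exact pullIntegral_pullIntegral_swap hL.continuous_mom 𝒢.continuous_rng 𝒢.continuous_rng
      χ.isContinuousFamily h2 χ.isContinuousFamily h2 hF y
  have hT : ∀ F ∈ Cc (Pull (fun a : L.InArrows => L.mom a.1.1) 𝒢.rng),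
      ∫ y, I F y ∂m = ∫ y, I (fun a => F (L.twist 𝒢.invMulAction a) * D a.1.1) y ∂m :=
    fun F hF => h.twist hG hY hG hL hR χ.isContinuousFamily h2 χ.isInvariant_invMulAction hF
  have key := eq_of_forall_integral_mul_eq (m := m) (hP.pull hG hp 𝒢.continuous_rng) I
    (fun F hF => χ.pullIntegral_mem_Cc hG hY hL.continuous_mom (hI1 F hF))
    (fun F hF F' hF' t => ?_)
    (fun F _ h0 => pullIntegral_nonneg (pullIntegral_nonneg h0))
    (fun F hF h0 hz a => ?_) (D := fun a => D a.swap.1.1)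
    (D' := fun a => D (L.twist 𝒢.invMulAction a).swap.1.1 * D a.1.1) hD2
    ((hD2.comp hτ).mul hD1) fun F hF => ?_
  · exact congrFun key a
  · rw [← pullIntegral_sub hL.continuous_mom 𝒢.continuous_rng χ.isContinuousFamily h2
      (hI1 F hF) (hI1 F' hF')]
    refine congrArg (fun f => pullIntegral χ.meas L.mom f t) (funext fun a => ?_)
    exact pullIntegral_sub hp 𝒢.continuous_rng χ.isContinuousFamily h2 hF hF' a
  · refine eq_zero_of_pullIntegral_eq_zero hp 𝒢.continuous_rng χ.isContinuousFamily h2 hF h0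
      (t := a.1.1) ?_ a.1.2 a.2
    exact eq_zero_of_pullIntegral_eq_zero hL.continuous_mom 𝒢.continuous_rng χ.isContinuousFamily
      h2 (hI1 F hF) (pullIntegral_nonneg h0) (hz a.1.1.1.1) a.1.1.1.2 a.1.1.2
  · -- both sides are the integral of `F` composed with the braid `σ τ σ = τ σ τ`
    set τ := L.twist 𝒢.invMulAction with hτdef
    have hF1 := Cc_comp_isClosedEmbedding hF (hσe.comp (hτe.comp hσe))
    have e1 := hS _ hF1
    rw [hT _ (Cc_comp_isClosedEmbedding hF1 hσe), hS _ (Cc_mul_continuous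
      (Cc_comp_isClosedEmbedding (Cc_comp_isClosedEmbedding hF1 hσe) hτe) hD1)] at e1
    have e2 := hT _ hF1
    rw [hS _ (Cc_mul_continuous (Cc_comp_isClosedEmbedding hF1 hτe) hD1),
      hT _ (Cc_comp_isClosedEmbedding (Cc_mul_continuous
        (Cc_comp_isClosedEmbedding hF1 hτe) hD1) hσe)] at e2
    have e3 := e1.symm.trans e2
    have r1 : ∀ a, (Pull.swap ∘ τ ∘ Pull.swap) ((τ (Pull.swap a)).swap) = a := fun a => by
      change Pull.swap (τ (τ (Pull.swap a))) = a
      rw [hτdef, L.twist_twist]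
      rfl
    have r2 : ∀ a, (Pull.swap ∘ τ ∘ Pull.swap) (τ (Pull.swap (τ a))) = a := fun a => by
      rw [hτdef, L.twist_invMul_braid]
      exact r1 a
    simp_rw [r1, r2, mul_assoc] at e3
    exact e3

end AdjoiningFunctions

/-! ### Uniqueness, multiplicativity and invariance of adjoining functions. -/

section AdjoiningCocycle

open Set Filter Topology

set_option linter.unusedSectionVars false

/-- The fibres over `p (i t)` and `p' t` are equal only propositionally; this change of base point
absorbs the transport between them. -/
theorem pullIntegral_map {T T' V W : Type*} [MeasurableSpace W] {π : W → V}
    {ν : ∀ v, Measure {w : W // π w = v}} {p : T → V} {p' : T' → V} (i : T' → T)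
    (hi : ∀ t, p (i t) = p' t) (F : Pull p π → ℝ) (t : T') :
    pullIntegral ν p F (i t) =
      pullIntegral ν p' (fun a => F ⟨(i a.1.1, a.1.2), a.2.trans (hi _).symm⟩) t := by
  have key : ∀ (v : V) (hv : p (i t) = v), pullIntegral ν p F (i t) =
      ∫ w : {w : W // π w = v}, F ⟨(i t, w), w.2.trans hv.symm⟩ ∂(ν v) := by
    rintro _ rfl
    rfl
  exact key _ (hi t)

variable {G U Y : Type*} [TopologicalSpace G] [TopologicalSpace U] [TopologicalSpace Y]
  [T2Space U] [MeasurableSpace G] [BorelSpace G] [MeasurableSpace Y] [BorelSpace Y]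
  {𝒢 : TopGroupoid G U} {χ : HaarSystem 𝒢} {L : LeftAction 𝒢 Y}

/-- Quasi-invariance is transported along equivariant homeomorphisms. -/
theorem LeftAction.IsQuasiInvariant.comp_homeomorph {Y' : Type*} [TopologicalSpace Y']
    [MeasurableSpace Y'] [BorelSpace Y'] {L' : LeftAction 𝒢 Y'} (e : Y ≃ₜ Y')
    (hmom : ∀ y, L'.mom (e y) = L.mom y)
    (hact : ∀ g y p, e (L.act g y p) = L'.act g (e y) (p.trans (hmom y).symm))
    {m : Measure Y} {m' : Measure Y'} (hm : m.map e = m') {D : L'.InArrows → ℝ}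
    (h : L'.IsQuasiInvariant χ m' D) :
    L.IsQuasiInvariant χ m
      (fun a => D ⟨(e a.1.1, a.1.2), a.2.trans (hmom a.1.1).symm⟩) := by
  intro F hF
  have hmom' : ∀ y, L.mom (e.symm y) = L'.mom y := fun y => by
    rw [← hmom, e.apply_symm_apply]
  let i : L.InArrows → L'.InArrows := fun a => ⟨(e a.1.1, a.1.2), a.2.trans (hmom a.1.1).symm⟩
  let j : L'.InArrows → L.InArrows :=
    fun a => ⟨(e.symm a.1.1, a.1.2), a.2.trans (hmom' a.1.1).symm⟩
  have hij : ∀ a, i (j a) = a := fun a => Subtype.ext (Prod.ext (e.apply_symm_apply _) rfl)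
  have hji : ∀ a, j (i a) = a := fun a => Subtype.ext (Prod.ext (e.symm_apply_apply _) rfl)
  have hi : Continuous i := Continuous.subtype_mk (by fun_prop) _
  have hj : Continuous j := Continuous.subtype_mk (by fun_prop) _
  have hje : IsClosedEmbedding j := (Homeomorph.mk ⟨j, i, hij, hji⟩ hj hi).isClosedEmbedding
  have h1 := h _ (Cc_comp_isClosedEmbedding hF hje)
  rw [← hm, e.measurableEmbedding.integral_map, e.measurableEmbedding.integral_map] at h1
  simp_rw [pullIntegral_map e hmom] at h1
  have hinv : ∀ a, j (L'.invArrow (i a)) = L.invArrow a := fun a => by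
    rw [← hji (L.invArrow a)]
    refine congrArg j (Subtype.ext (Prod.ext ?_ rfl))
    exact (hact _ _ _).symm
  have e1 : (fun a : L.InArrows => F (j (L'.invArrow (i a)))) = fun a => F (L.invArrow a) :=
    funext fun a => congrArg F (hinv a)
  have e2 : (fun a : L.InArrows => F (j (i a)) * D (i a)) = fun a => F a * D (i a) :=
    funext fun a => by rw [hji]
  exact (congrArg (fun f => ∫ y, pullIntegral χ.meas L.mom f y ∂m) e1).symm.trans
    (h1.trans (congrArg (fun f => ∫ y, pullIntegral χ.meas L.mom f y ∂m) e2))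

variable {V : Type*} [TopologicalSpace V] [T2Space V] [T2Space Y] {π : Y → V}
  {ν : ∀ v, Measure {y : Y // π y = v}} {Δ : L.Arrows → ℝ}

/-- Adjoining functions are unique. -/
theorem LeftAction.IsAdjoiningFunction.unique (hG : IsLocallyCompact G) (hY : IsLocallyCompact Y)
    (hL : L.IsContinuous) (hc : Continuous π) (hπ : ∀ g y p, π (L.act g y p) = π y)
    (hν : IsContinuousFamily π ν) {Δ' : L.Arrows → ℝ} (h : L.IsAdjoiningFunction χ π ν Δ)
    (h' : L.IsAdjoiningFunction χ π ν Δ') : Δ = Δ' := by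
  ext a
  rw [L.isAdjoiningFunction_iff hG hY hL hc hπ] at h h'
  have := hν.regular (π a.1.2)
  have := hν.fullSupport (π a.1.2)
  have := (h.2.2 (π a.1.2)).unique hG (hY.of_isClosedEmbedding (isClosedEmbedding_fibre hc _))
    (hL.fibre π hπ _) (L.continuous_fibreFunction hL π hπ h.1 _)
    (L.continuous_fibreFunction hL π hπ h'.1 _) (h'.2.2 (π a.1.2))
  have h1 := congrFun this ⟨(⟨L.act a.1.1 a.1.2 a.2, hπ _ _ _⟩, a.1.1), (L.mom_act _ _ _).symm⟩
  have h2 := L.toArrow_ofArrow a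
  exact (congrArg Δ h2).symm.trans (h1.trans (congrArg Δ' h2))

/-- Adjoining functions are cocycles. -/
theorem LeftAction.IsAdjoiningFunction.isCocycle (hG : IsLocallyCompact G)
    (hY : IsLocallyCompact Y)
    (hL : L.IsContinuous) (hc : Continuous π) (hπ : ∀ g y p, π (L.act g y p) = π y)
    (hν : IsContinuousFamily π ν) (h : L.IsAdjoiningFunction χ π ν Δ) : L.IsCocycle Δ := by
  intro g k x q p
  rw [L.isAdjoiningFunction_iff hG hY hL hc hπ] at h
  have := hν.regular (π x)
  have := hν.fullSupport (π x)
  -- Multiplicativity is used at the point `(g k) x`, where the arrows `g` and `g k` both end; the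
  -- twist turns the second one into `g⁻¹ (g k) = k`.
  have h1 := (h.2.2 (π x)).mul_eq hG (hY.of_isClosedEmbedding (isClosedEmbedding_fibre hc _))
    (hL.fibre π hπ _) (L.continuous_fibreFunction hL π hπ h.1 _)
    ⟨(⟨(⟨L.act (𝒢.mul g k q) x ((𝒢.src_mul _ _ _).trans p), hπ _ _ _⟩, g),
      (𝒢.rng_mul g k q).symm.trans (L.mom_act _ _ _).symm⟩, 𝒢.mul g k q), (L.mom_act _ _ _).symm⟩
  have e0 : L.act (𝒢.inv g) (L.act (𝒢.mul g k q) x ((𝒢.src_mul _ _ _).trans p))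
      ((𝒢.src_inv g).trans ((𝒢.rng_mul g k q).symm.trans (L.mom_act _ _ _).symm)) =
        L.act k x p := by
    rw [L.act_congr _ rfl (L.mul_act g k x q p), L.inv_act]
  have e1 := L.toArrow_ofArrow ⟨(𝒢.mul g k q, x), (𝒢.src_mul g k q).trans p⟩
  have e2 : L.toArrow ⟨(L.act (𝒢.mul g k q) x ((𝒢.src_mul _ _ _).trans p), g),
      (𝒢.rng_mul g k q).symm.trans (L.mom_act _ _ _).symm⟩ =
      ⟨(g, L.act k x p), q.trans (L.mom_act k x p).symm⟩ := Subtype.ext (Prod.ext rfl e0)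
  have e3 : L.toArrow ⟨(L.act (𝒢.inv g) (L.act (𝒢.mul g k q) x ((𝒢.src_mul _ _ _).trans p))
      ((𝒢.src_inv g).trans ((𝒢.rng_mul g k q).symm.trans (L.mom_act _ _ _).symm)),
      𝒢.mul (𝒢.inv g) (𝒢.mul g k q) ((𝒢.src_inv g).trans (𝒢.rng_mul g k q).symm)),
      (𝒢.rng_mul _ _ _).trans (L.mom_act _ _ _).symm⟩ = ⟨(k, x), p⟩ := by
    rw [← L.toArrow_ofArrow ⟨(k, x), p⟩]
    exact congrArg L.toArrow (Subtype.ext (Prod.ext e0 (𝒢.inv_mul_cancel_left g k q)))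
  rw [mul_comm]
  exact (congrArg Δ e1).symm.trans (h1.trans (congrArg₂ (· * ·) (congrArg Δ e3) (congrArg Δ e2)))

/-- Adjoining functions are invariant under a commuting right action. -/
theorem LeftAction.IsAdjoiningFunction.act_right {H : Type*} [TopologicalSpace H]
    {ℋ : TopGroupoid H V} {R : RightAction ℋ Y}
    {ν : ∀ v, Measure {y : Y // R.mom y = v}} (hG : IsLocallyCompact G)
    (hY : IsLocallyCompact Y) (hL : L.IsContinuous) (hR : R.IsContinuous)
    (c : ActionsCommute L R) (hν : IsContinuousFamily R.mom ν) (hinv : R.IsInvariant ν)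
    (h : L.IsAdjoiningFunction χ R.mom ν Δ) (g : G) (y : Y) (p : 𝒢.src g = L.mom y) (η : H)
    (q : R.mom y = ℋ.rng η) :
    Δ ⟨(g, R.act y η q), p.trans (c.mom_left _ _ _).symm⟩ = Δ ⟨(g, y), p⟩ := by
  rw [L.isAdjoiningFunction_iff hG hY hL hR.continuous_mom c.mom_right] at h
  have := hν.regular (ℋ.rng η)
  have := hν.fullSupport (ℋ.rng η)
  -- Translation by `η` is a `G`-equivariant homeomorphism carrying `ν` at `r(η)` to `ν` at `s(η)`.
  -- The translated function therefore implements the quasi-invariance at `r(η)`, and uniqueness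
  -- identifies it with `Δ`.
  have h1 := (h.2.2 (ℋ.src η)).comp_homeomorph (L := L.fibre R.mom c.mom_right (ℋ.rng η))
    (L' := L.fibre R.mom c.mom_right (ℋ.src η))
    (RightAction.translateHomeo hR η) (fun y => c.mom_left _ _ _)
    (fun g y p => Subtype.ext (c.act_act g y.1 η p y.2)) (m := ν (ℋ.rng η)) (hinv η)
  have h2 := h1.unique hG (hY.of_isClosedEmbedding (isClosedEmbedding_fibre hR.continuous_mom _))
    (hL.fibre _ _ _) ((L.continuous_fibreFunction hL _ c.mom_right h.1 _).comp
      (Continuous.subtype_mk (((RightAction.translateHomeo hR η).continuous.comp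
        (by fun_prop)).prodMk (by fun_prop)) _))
    (L.continuous_fibreFunction hL _ c.mom_right h.1 _) (h.2.2 (ℋ.rng η))
  have h3 := congrFun h2 ⟨(⟨L.act g y p, (c.mom_right _ _ _).trans q⟩, g), (L.mom_act _ _ _).symm⟩
  refine Eq.trans (congrArg Δ ?_) (h3.trans (congrArg Δ (L.toArrow_ofArrow ⟨(g, y), p⟩)))
  rw [← L.toArrow_ofArrow ⟨(g, R.act y η q), p.trans (c.mom_left _ _ _).symm⟩]
  exact congrArg L.toArrow (Subtype.ext (Prod.ext (c.act_act _ _ _ _ _).symm rfl))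

end AdjoiningCocycle

/-! ### The quotient `Ω` and orbit integrals. -/

section QuotientSpace

open Set Filter Topology

set_option linter.unusedSectionVars false

theorem isOpenMap_pull_fst {T V W : Type*} [TopologicalSpace T] [TopologicalSpace V]
    [TopologicalSpace W] {p : T → V} {π : W → V} (hp : Continuous p) (hπ : IsOpenMap π) :
    IsOpenMap (fun a : Pull p π => a.1.1) := by
  refine IsOpenMap.of_nhds_le fun a s hs => ?_
  rw [Filter.mem_map, nhds_subtype_eq_comap, mem_comap] at hs
  obtain ⟨O, hO, hOs⟩ := hs
  obtain ⟨A, hA, B, hB, hAB⟩ := mem_nhds_prod_iff.1 hO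
  have h1 : π '' B ∈ 𝓝 (p a.1.1) := by
    rw [← a.2]
    exact hπ.image_mem_nhds hB
  filter_upwards [hA, hp.continuousAt.preimage_mem_nhds h1] with t htA ⟨w, hw, e⟩
  exact hOs (a := ⟨(t, w), e⟩) (hAB ⟨htA, hw⟩)

variable {G U X : Type*} [TopologicalSpace G] [TopologicalSpace U] [TopologicalSpace X]
  {𝒢 : TopGroupoid G U}

/-- Reordering of the arrows of a right transformation groupoid. -/
def RightAction.pullArrow (R : RightAction 𝒢 X) (a : Pull R.mom 𝒢.rng) : R.Arrows := ⟨a.1, a.2.symm⟩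

theorem RightAction.isClosedEmbedding_pullArrow (R : RightAction 𝒢 X) :
    IsClosedEmbedding R.pullArrow :=
  (Homeomorph.mk ⟨R.pullArrow, fun a => ⟨a.1, a.2.symm⟩, fun _ => rfl, fun _ => rfl⟩
    (Continuous.subtype_mk (by fun_prop) _) (Continuous.subtype_mk (by fun_prop) _)).isClosedEmbedding

theorem RightAction.isOpenQuotientMap_mk (R : RightAction 𝒢 X) (hR : R.IsContinuous)
    (hr : IsOpenMap 𝒢.rng) :
    IsOpenQuotientMap (Quotient.mk R.orbitSetoid) := by
  refine ⟨Quotient.mk_surjective, continuous_quotient_mk', fun O hO => ?_⟩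
  rw [isOpen_coinduced]
  have h1 : IsOpen {a : Pull R.mom 𝒢.rng | R.act a.1.1 a.1.2 a.2.symm ∈ O} :=
    hO.preimage (hR.continuous_act.comp R.isClosedEmbedding_pullArrow.continuous)
  convert isOpenMap_pull_fst hR.continuous_mom hr _ h1 using 1
  ext x
  constructor
  · rintro ⟨y, hy, e⟩
    obtain ⟨g, p, rfl⟩ := R.orbitSetoid.symm (Quotient.exact e)
    exact ⟨⟨(x, g), p.symm⟩, hy, rfl⟩
  · rintro ⟨⟨⟨x', g⟩, p⟩, h, rfl⟩
    exact ⟨_, h, Quotient.sound (R.orbitSetoid.symm ⟨g, p.symm, rfl⟩)⟩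

theorem IsOpenQuotientMap.exists_isCompact_image_eq {A B : Type*} [TopologicalSpace A]
    [TopologicalSpace B] [LocallyCompactSpace A] {q : A → B} (hq : IsOpenQuotientMap q) {K : Set B}
    (hK : IsCompact K) : ∃ K' : Set A, IsCompact K' ∧ K ⊆ q '' K' := by
  choose N hN hmN using fun a : A => exists_compact_mem_nhds a
  obtain ⟨t, ht⟩ := hK.elim_finite_subcover (fun a => q '' interior (N a))
    (fun a => hq.isOpenMap _ isOpen_interior) fun b _ => by
      obtain ⟨a, rfl⟩ := hq.surjective b
      exact mem_iUnion.2 ⟨a, a, mem_interior_iff_mem_nhds.2 (hmN a), rfl⟩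
  refine ⟨⋃ a ∈ t, N a, t.isCompact_biUnion fun a _ => hN a, fun b hb => ?_⟩
  obtain ⟨a, hat, x, hx, rfl⟩ := mem_iUnion₂.1 (ht hb)
  exact ⟨x, mem_iUnion₂.2 ⟨a, hat, interior_subset hx⟩, rfl⟩

variable {Y : Type*} [TopologicalSpace Y] {R₁ : RightAction 𝒢 X} {L₂ : LeftAction 𝒢 Y}

theorem isClosedEmbedding_fibreProduct [T2Space U] (hR : R₁.IsContinuous) (hL : L₂.IsContinuous) :
    IsClosedEmbedding (Subtype.val : FibreProduct R₁ L₂ → X × Y) :=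
  IsClosed.isClosedEmbedding_subtypeVal
    (isClosed_eq (hR.continuous_mom.comp continuous_fst) (hL.continuous_mom.comp continuous_snd))

theorem locallyCompactSpace_fibreProduct [T2Space U] (hR : R₁.IsContinuous) (hL : L₂.IsContinuous)
    [LocallyCompactSpace X] [LocallyCompactSpace Y] : LocallyCompactSpace (FibreProduct R₁ L₂) :=
  (isClosedEmbedding_fibreProduct hR hL).locallyCompactSpace

theorem diagAction_isContinuous (hR : R₁.IsContinuous) (hL : L₂.IsContinuous) :
    (diagAction R₁ L₂).IsContinuous where
  continuous_mom := hR.continuous_mom.comp (by fun_prop)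
  continuous_act := Continuous.subtype_mk
    ((hR.continuous_act_of (f := fun p : (diagAction R₁ L₂).Arrows => p.1.1.1.1)
      (g := fun p => p.1.2) (by fun_prop) (by fun_prop) fun p => p.2).prodMk
    (hL.continuous_act_of (f := fun p : (diagAction R₁ L₂).Arrows => 𝒢.inv p.1.2)
      (g := fun p => p.1.1.1.2) (𝒢.continuous_inv.comp (by fun_prop)) (by fun_prop) _)) _

/-- Properness on `X` suffices: the pairs `(x, γ)` with `x` in the projection of `K` and `x γ ∈ C`
form a compact set, and the arrows in question embed as a closed subset of the product of `K` with
it. -/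
theorem isCompact_arrows_of_isProper [T2Space X] [T2Space Y] [T2Space U] (hR : R₁.IsContinuous)
    (hP : R₁.IsProper)
    {K : Set (FibreProduct R₁ L₂)} {C : Set X} (hK : IsCompact K) (hC : IsCompact C) :
    IsCompact {a : (diagAction R₁ L₂).Arrows | a.1.1 ∈ K ∧ R₁.act a.1.1.1.1 a.1.2 a.2 ∈ C} := by
  have hS := hP.isCompact_preimage
    ((hK.image (by fun_prop : Continuous fun z : FibreProduct R₁ L₂ => z.1.1)).prod hC)
  let i : (diagAction R₁ L₂).Arrows → FibreProduct R₁ L₂ × R₁.Arrows :=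
    fun a => (a.1.1, ⟨(a.1.1.1.1, a.1.2), a.2⟩)
  have hi : IsClosedEmbedding i := by
    let j : FibreProduct R₁ L₂ × R₁.Arrows → FibreProduct R₁ L₂ × G := fun b => (b.1, b.2.1.2)
    have hj : Continuous j := by fun_prop
    have hic : Continuous i :=
      (by fun_prop : Continuous fun a : (diagAction R₁ L₂).Arrows => a.1.1).prodMk
        (Continuous.subtype_mk (by fun_prop) _)
    have hji : Topology.IsEmbedding (j ∘ i) := Topology.IsEmbedding.subtypeVal
    refine ⟨Topology.IsEmbedding.of_comp hic hj hji, ?_⟩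
    convert isClosed_eq (by fun_prop : Continuous fun b : FibreProduct R₁ L₂ × R₁.Arrows =>
      b.1.1.1) (by fun_prop : Continuous fun b : FibreProduct R₁ L₂ × R₁.Arrows => b.2.1.1) using 1
    ext ⟨z, ⟨⟨x, g⟩, h⟩⟩
    constructor
    · rintro ⟨a, e⟩
      rw [← e]
      rfl
    · intro e
      obtain rfl : z.1.1 = x := e
      exact ⟨⟨(z, g), h⟩, rfl⟩
  have h1 := hi.isCompact_preimage (hK.prod hS)
  refine h1.of_isClosed_subset ?_ fun a ha => ⟨ha.1, ⟨_, ha.1, rfl⟩, ha.2⟩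
  exact (hK.isClosed.preimage (by fun_prop)).inter
    (hC.isClosed.preimage (hR.continuous_act_of (by fun_prop) (by fun_prop) _))

section OrbitIntegral

variable [MeasurableSpace G] [BorelSpace G] (χ : HaarSystem 𝒢)

theorem orbitIntegral_mk (f : FibreProduct R₁ L₂ → ℝ) (z : FibreProduct R₁ L₂) :
    orbitIntegral χ R₁ L₂ f (CompositeSpace.mk z) = pullIntegral χ.meas (diagAction R₁ L₂).mom
      (fun a => f ((diagAction R₁ L₂).act a.1.1 a.1.2 a.2.symm)) z :=
  rfl

theorem orbitIntegral_eq_zero {f : FibreProduct R₁ L₂ → ℝ} {K : Set (FibreProduct R₁ L₂)}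
    (hf : ∀ z ∉ K, f z = 0) {ω : CompositeSpace R₁ L₂} (hω : ω ∉ CompositeSpace.mk '' K) :
    orbitIntegral χ R₁ L₂ f ω = 0 := by
  obtain ⟨z, rfl⟩ : ∃ z, CompositeSpace.mk z = ω := Quotient.mk_surjective ω
  rw [orbitIntegral_mk]
  have : ∀ γ : {γ : G // 𝒢.rng γ = (diagAction R₁ L₂).mom z},
      f ((diagAction R₁ L₂).act z γ γ.2.symm) = 0 := fun γ => by
    refine hf _ fun h => hω ⟨_, h, ?_⟩
    exact Quotient.sound ((diagAction R₁ L₂).orbitSetoid.symm ⟨γ, γ.2.symm, rfl⟩)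
  simp [pullIntegral, this]

theorem orbitIntegral_mul_mk (f : FibreProduct R₁ L₂ → ℝ) (h : CompositeSpace R₁ L₂ → ℝ)
    (ω : CompositeSpace R₁ L₂) :
    orbitIntegral χ R₁ L₂ (fun z => f z * h (CompositeSpace.mk z)) ω =
      orbitIntegral χ R₁ L₂ f ω * h ω := by
  obtain ⟨z, rfl⟩ : ∃ z, CompositeSpace.mk z = ω := Quotient.mk_surjective ω
  rw [orbitIntegral_mk, orbitIntegral_mk, pullIntegral, pullIntegral, ← integral_mul_const]
  refine integral_congr_ae (Eventually.of_forall fun γ => ?_)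
  have : (CompositeSpace.mk ((diagAction R₁ L₂).act z γ γ.2.symm) : CompositeSpace R₁ L₂) =
      CompositeSpace.mk z :=
    Quotient.sound ((diagAction R₁ L₂).orbitSetoid.symm ⟨γ, γ.2.symm, rfl⟩)
  simp only [this]

end OrbitIntegral

variable [T2Space X] [T2Space Y] [T2Space U] [LocallyCompactSpace X] [LocallyCompactSpace Y]

/-- The map `(z, γ) ↦ (z, x γ)` is proper by the compactness just shown. It factors through `(z, γ)
↦ (z, z γ)`, and a continuous first factor with Hausdorff target `Z × Z` inherits properness. -/
theorem isProperMap_diagAction (hR : R₁.IsContinuous) (hL : L₂.IsContinuous) (hP : R₁.IsProper) :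
    (diagAction R₁ L₂).IsProper := by
  have := locallyCompactSpace_fibreProduct hR hL
  have hc := diagAction_isContinuous hR hL
  have h1 : IsProperMap (fun a : (diagAction R₁ L₂).Arrows =>
      (a.1.1, R₁.act a.1.1.1.1 a.1.2 a.2)) := by
    have hcont : Continuous fun a : (diagAction R₁ L₂).Arrows =>
        (a.1.1, R₁.act a.1.1.1.1 a.1.2 a.2) :=
      (by fun_prop : Continuous fun a : (diagAction R₁ L₂).Arrows => a.1.1).prodMk
        (hR.continuous_act_of (by fun_prop) (by fun_prop) _)
    rw [isProperMap_iff_isCompact_preimage]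
    refine ⟨hcont, fun K hK => ?_⟩
    refine (isCompact_arrows_of_isProper hR hP (hK.image continuous_fst)
      (hK.image continuous_snd)).of_isClosed_subset (hK.isClosed.preimage hcont) fun a ha => ?_
    exact ⟨⟨_, ha, rfl⟩, ⟨_, ha, rfl⟩⟩
  refine isProperMap_of_comp_of_t2 (g := fun b : FibreProduct R₁ L₂ × FibreProduct R₁ L₂ =>
    (b.1, b.2.1.1)) ?_ (by fun_prop) h1
  exact (by fun_prop : Continuous fun a : (diagAction R₁ L₂).Arrows => a.1.1).prodMk
    hc.continuous_act

theorem CompositeSpace.isOpenQuotientMap_mk (hR : R₁.IsContinuous) (hL : L₂.IsContinuous)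
    (hr : IsOpenMap 𝒢.rng) :
    IsOpenQuotientMap (CompositeSpace.mk : FibreProduct R₁ L₂ → CompositeSpace R₁ L₂) :=
  (diagAction R₁ L₂).isOpenQuotientMap_mk (diagAction_isContinuous hR hL) hr

/-- For an open quotient map the quotient is Hausdorff exactly when the relation is closed. The
orbit relation is the range of the proper, hence closed, map `(z, γ) ↦ (z, z γ)`. -/
theorem CompositeSpace.t2Space (hR : R₁.IsContinuous) (hL : L₂.IsContinuous)
    (hr : IsOpenMap 𝒢.rng) (hP : R₁.IsProper) : T2Space (CompositeSpace R₁ L₂) := by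
  rw [t2Space_iff_of_isOpenQuotientMap (CompositeSpace.isOpenQuotientMap_mk hR hL hr)]
  convert (isProperMap_diagAction hR hL hP).isClosedMap.isClosed_range using 1
  ext ⟨z, z'⟩
  constructor
  · intro h
    obtain ⟨g, p, e⟩ := Quotient.exact h
    exact ⟨⟨(z, g), p⟩, congrArg (Prod.mk z) e.symm⟩
  · rintro ⟨⟨⟨z'', g⟩, p⟩, e⟩
    obtain ⟨rfl, rfl⟩ := Prod.mk.inj e
    exact Quotient.sound ⟨g, p, rfl⟩

theorem CompositeSpace.secondCountableTopology [SecondCountableTopology X]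
    [SecondCountableTopology Y] (hR : R₁.IsContinuous) (hL : L₂.IsContinuous)
    (hr : IsOpenMap 𝒢.rng) : SecondCountableTopology (CompositeSpace R₁ L₂) :=
  have h := CompositeSpace.isOpenQuotientMap_mk hR hL hr
  have := (isClosedEmbedding_fibreProduct hR hL).isEmbedding.secondCountableTopology
  h.isQuotientMap.secondCountableTopology h.isOpenMap

theorem CompositeSpace.locallyCompactSpace (hR : R₁.IsContinuous) (hL : L₂.IsContinuous)
    (hr : IsOpenMap 𝒢.rng) : LocallyCompactSpace (CompositeSpace R₁ L₂) :=
  have := locallyCompactSpace_fibreProduct hR hL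
  (CompositeSpace.isOpenQuotientMap_mk hR hL hr).locallyCompactSpace

variable [MeasurableSpace G] [BorelSpace G] (χ : HaarSystem 𝒢)

/-- Continuity of integrals over the orbits of the diagonal action, for functions whose support is
proper over `Z`. -/
theorem continuous_integral_orbit (hG : IsLocallyCompact G) (hR : R₁.IsContinuous)
    (hL : L₂.IsContinuous) (hP : R₁.IsProper) (hZ : T2Space (diagAction R₁ L₂).Arrows)
    {φ : (diagAction R₁ L₂).Arrows → ℝ} (hφ : Continuous φ) {C : Set X} (hC : IsCompact C)
    (h0 : ∀ a, R₁.act a.1.1.1.1 a.1.2 a.2 ∉ C → φ a = 0) :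
    Continuous (pullIntegral χ.meas (diagAction R₁ L₂).mom
      fun a => φ ((diagAction R₁ L₂).pullArrow a)) := by
  have := locallyCompactSpace_fibreProduct hR hL
  have hc := diagAction_isContinuous hR hL
  refine continuous_iff_continuousAt.2 fun z₀ => ?_
  -- The support of `φ` is compact only over compact subsets of `Z`. Multiplying by `k(z)` with
  -- `k(z₀) = 1` produces a function in `C_c` of the Hausdorff arrow space, and `k` is divided out
  -- again near `z₀`.
  obtain ⟨k, hk1, -, hk2, -⟩ := exists_continuous_one_zero_of_isCompact
    (isCompact_singleton (x := z₀)) isClosed_empty (disjoint_empty _)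
  have h1 : (fun a : (diagAction R₁ L₂).Arrows => k a.1.1 * φ a) ∈ Cc _ := by
    refine (mem_Cc_iff _).2 ⟨(k.continuous.comp (by fun_prop)).mul hφ,
      HasCompactSupport.intro (isCompact_arrows_of_isProper hR hP hk2.isCompact hC)
        fun a ha => ?_⟩
    by_cases h : R₁.act a.1.1.1.1 a.1.2 a.2 ∈ C
    · rw [image_eq_zero_of_notMem_tsupport (f := k) fun h' => ha ⟨h', h⟩, zero_mul]
    · rw [h0 a h, mul_zero]
  have h2 := ((mem_Cc_iff _).1 (χ.pullIntegral_mem_Cc hG IsLocallyCompact.of_locallyCompactSpace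
    hc.continuous_mom (Cc_comp_isClosedEmbedding h1
      (diagAction R₁ L₂).isClosedEmbedding_pullArrow))).1
  have hk0 : k z₀ = 1 := hk1 rfl
  have hne : ∀ᶠ z in 𝓝 z₀, k z ≠ 0 := k.continuous.continuousAt.eventually_ne (by simp [hk0])
  have h3 := h2.continuousAt.mul (k.continuous.continuousAt.inv₀ (a := z₀) (by simp [hk0]))
  refine h3.congr ?_
  filter_upwards [hne] with z hz
  have : pullIntegral χ.meas (diagAction R₁ L₂).mom
      (fun a => k ((diagAction R₁ L₂).pullArrow a).1.1 * φ ((diagAction R₁ L₂).pullArrow a)) z =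
      k z * pullIntegral χ.meas (diagAction R₁ L₂).mom
        (fun a => φ ((diagAction R₁ L₂).pullArrow a)) z :=
    integral_const_mul (k z) fun γ : {γ : G // 𝒢.rng γ = (diagAction R₁ L₂).mom z} =>
      φ ⟨(z, γ), γ.2.symm⟩
  exact (congrArg (· * (k z)⁻¹) this).trans (by field_simp)

variable (hG : IsLocallyCompact G) (hR : R₁.IsContinuous) (hL : L₂.IsContinuous)
  (hP : R₁.IsProper) (hZ : T2Space (diagAction R₁ L₂).Arrows)

include hG hR hL hP hZ

theorem continuous_orbitIntegral {f : FibreProduct R₁ L₂ → ℝ} (hf : Continuous f)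
    (hs : HasCompactSupport f) : Continuous (orbitIntegral χ R₁ L₂ f) := by
  rw [(CompositeSpace.isOpenQuotientMap_mk hR hL (χ.isOpenMap_rng hG)).isQuotientMap.continuous_iff]
  refine continuous_integral_orbit χ hG hR hL hP hZ
    (φ := fun a => f ((diagAction R₁ L₂).act a.1.1 a.1.2 a.2))
    (hf.comp (diagAction_isContinuous hR hL).continuous_act)
    (hs.isCompact.image (by fun_prop : Continuous fun z : FibreProduct R₁ L₂ => z.1.1))
    fun a ha => image_eq_zero_of_notMem_tsupport fun h => ha ⟨_, h, rfl⟩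

theorem orbitIntegral_mem_Cc {f : FibreProduct R₁ L₂ → ℝ} (hf : f ∈ Cc (FibreProduct R₁ L₂)) :
    orbitIntegral χ R₁ L₂ f ∈ Cc (CompositeSpace R₁ L₂) := by
  have := CompositeSpace.t2Space hR hL (χ.isOpenMap_rng hG) hP
  have hq := CompositeSpace.isOpenQuotientMap_mk hR hL (χ.isOpenMap_rng hG)
  obtain ⟨hc, hs⟩ := (mem_Cc_iff _).1 hf
  refine (mem_Cc_iff _).2 ⟨continuous_orbitIntegral χ hG hR hL hP hZ hc hs,
    HasCompactSupport.intro (hs.isCompact.image hq.continuous) fun ω hω =>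
      orbitIntegral_eq_zero χ (fun z hz => image_eq_zero_of_notMem_tsupport hz) hω⟩

/-- The function `γ ↦ f (z γ)` has compact support. -/
theorem slice_orbit {f : FibreProduct R₁ L₂ → ℝ} (hf : f ∈ Cc (FibreProduct R₁ L₂))
    (z : FibreProduct R₁ L₂) :
    (fun γ : {γ : G // 𝒢.rng γ = (diagAction R₁ L₂).mom z} =>
      f ((diagAction R₁ L₂).act z γ γ.2.symm)) ∈ Cc _ := by
  have h2 := 𝒢.t2Space_fibre hG ((diagAction R₁ L₂).mom z)
  obtain ⟨hc, hs⟩ := (mem_Cc_iff _).1 hf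
  have hd := diagAction_isContinuous hR hL
  have := hG.t1Space
  have he := (diagAction R₁ L₂).isClosedEmbedding_pullArrow.comp
    (isClosedEmbedding_slice hd.continuous_mom 𝒢.continuous_rng z)
  refine (mem_Cc_iff _).2 ⟨hc.comp (hd.continuous_act.comp he.continuous), ?_⟩
  refine HasCompactSupport.intro (he.isCompact_preimage
    ((isProperMap_diagAction hR hL hP).isCompact_preimage
      ((isCompact_singleton (x := z)).prod hs.isCompact))) fun γ hγ => ?_
  exact image_eq_zero_of_notMem_tsupport fun h => hγ ⟨rfl, h⟩

theorem orbitIntegral_pos {f : FibreProduct R₁ L₂ → ℝ} (hf : f ∈ Cc (FibreProduct R₁ L₂))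
    (h0 : ∀ z, 0 ≤ f z) {z : FibreProduct R₁ L₂} (hz : 0 < f z) :
    0 < orbitIntegral χ R₁ L₂ f (CompositeSpace.mk z) := by
  have h2 := 𝒢.t2Space_fibre hG ((diagAction R₁ L₂).mom z)
  have := χ.isContinuousFamily.regular ((diagAction R₁ L₂).mom z)
  have := χ.isContinuousFamily.fullSupport ((diagAction R₁ L₂).mom z)
  have hc := (mem_Cc_iff _).1 (slice_orbit hG hR hL hP hZ hf z)
  refine hc.1.integral_pos_of_hasCompactSupport_nonneg_nonzero
    (x := ⟨𝒢.unit ((diagAction R₁ L₂).mom z), 𝒢.rng_unit _⟩) hc.2 (fun _ => h0 _) ?_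
  simp only
  rw [(diagAction R₁ L₂).act_unit]
  exact hz.ne'

/-- Every function in `C_c(Ω)` is an orbit integral. -/
theorem exists_orbitIntegral_eq {g : CompositeSpace R₁ L₂ → ℝ}
    (hg : g ∈ Cc (CompositeSpace R₁ L₂)) :
    ∃ f ∈ Cc (FibreProduct R₁ L₂), orbitIntegral χ R₁ L₂ f = g ∧
      ((∀ ω, 0 ≤ g ω) → ∀ z, 0 ≤ f z) := by
  have := CompositeSpace.t2Space hR hL (χ.isOpenMap_rng hG) hP
  have := locallyCompactSpace_fibreProduct hR hL
  have hq := CompositeSpace.isOpenQuotientMap_mk hR hL (χ.isOpenMap_rng hG)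
  obtain ⟨hgc, hgs⟩ := (mem_Cc_iff _).1 hg
  -- With `k = 1` on a compact set whose image covers the support of `g`, the orbit integral of `k`
  -- is positive there, and `k · (g / Λ(k))` has orbit integral `g`.
  obtain ⟨K, hK, hgK⟩ := hq.exists_isCompact_image_eq hgs.isCompact
  obtain ⟨k, hk1, -, hk2, hk3⟩ := exists_continuous_one_zero_of_isCompact hK isClosed_empty
    (disjoint_empty _)
  have hkc : ⇑k ∈ Cc (FibreProduct R₁ L₂) := (mem_Cc_iff _).2 ⟨k.continuous, hk2⟩
  have hΛ := continuous_orbitIntegral χ hG hR hL hP hZ k.continuous hk2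
  have hpos : ∀ ω ∈ tsupport g, 0 < orbitIntegral χ R₁ L₂ k ω := fun ω hω => by
    obtain ⟨z, hz, rfl⟩ := hgK hω
    refine orbitIntegral_pos χ hG hR hL hP hZ hkc (fun z => (hk3 z).1) ?_
    rw [hk1 hz]
    exact one_pos
  have hc : Continuous fun ω => g ω / orbitIntegral χ R₁ L₂ k ω := by
    refine continuous_iff_continuousAt.2 fun ω => ?_
    by_cases hω : ω ∈ tsupport g
    · exact hgc.continuousAt.div hΛ.continuousAt (hpos ω hω).ne'
    · have : (fun ω => g ω / orbitIntegral χ R₁ L₂ k ω) =ᶠ[𝓝 ω] fun _ => 0 := by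
        filter_upwards [(isClosed_tsupport g).isOpen_compl.mem_nhds hω] with ω' h
        rw [image_eq_zero_of_notMem_tsupport (f := g) h, zero_div]
      exact continuousAt_const.congr this.symm
  refine ⟨fun z => k z * (g (CompositeSpace.mk z) / orbitIntegral χ R₁ L₂ k (CompositeSpace.mk z)),
    Cc_mul_continuous hkc (hc.comp hq.continuous), funext fun ω => ?_, fun h0 z => ?_⟩
  · rw [orbitIntegral_mul_mk χ k fun ω => g ω / orbitIntegral χ R₁ L₂ k ω]
    by_cases hω : ω ∈ tsupport g
    · have := (hpos ω hω).ne'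
      field_simp
    · rw [image_eq_zero_of_notMem_tsupport (f := g) hω, zero_div, mul_zero]
  · refine mul_nonneg (hk3 z).1 (div_nonneg (h0 _) ?_)
    exact integral_nonneg fun _ => (hk3 _).1

/-- Cut-off functions: there is `e ∈ C_c(Z)` with orbit integral `1` on a given compact set. -/
theorem exists_orbitIntegral_eq_one {K : Set (CompositeSpace R₁ L₂)} (hK : IsCompact K) :
    ∃ e ∈ Cc (FibreProduct R₁ L₂), ∀ ω ∈ K, orbitIntegral χ R₁ L₂ e ω = 1 := by
  have := CompositeSpace.t2Space hR hL (χ.isOpenMap_rng hG) hP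
  have := CompositeSpace.locallyCompactSpace hR hL (χ.isOpenMap_rng hG)
  obtain ⟨k, hk1, -, hk2, -⟩ := exists_continuous_one_zero_of_isCompact hK isClosed_empty
    (disjoint_empty _)
  obtain ⟨e, he, h, -⟩ := exists_orbitIntegral_eq χ hG hR hL hP hZ
    ((mem_Cc_iff _).2 ⟨k.continuous, hk2⟩)
  exact ⟨e, he, fun ω hω => by rw [h]; exact hk1 hω⟩

end QuotientSpace

/-! ### Cocycles on the proper groupoid `Z ⋊ G₂` are coboundaries. -/

section TrivializingCochain

open Set Filter Topology

set_option linter.unusedSectionVars false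

variable {G₁ U₁ G₂ U₂ G₃ U₃ X Y : Type*}
  [TopologicalSpace G₁] [TopologicalSpace U₁] [T2Space U₁]
  [TopologicalSpace G₂] [TopologicalSpace U₂] [T2Space U₂]
  [TopologicalSpace G₃] [TopologicalSpace U₃] [T2Space U₃]
  [MeasurableSpace G₁] [BorelSpace G₁] [MeasurableSpace G₂] [BorelSpace G₂]
  [MeasurableSpace G₃] [BorelSpace G₃]
  [TopologicalSpace X] [T2Space X] [SecondCountableTopology X] [MeasurableSpace X] [BorelSpace X]
  [TopologicalSpace Y] [T2Space Y] [SecondCountableTopology Y] [MeasurableSpace Y] [BorelSpace Y]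
  {𝒢₁ : TopGroupoid G₁ U₁} {𝒢₂ : TopGroupoid G₂ U₂} {𝒢₃ : TopGroupoid G₃ U₃}
  {χ₁ : HaarSystem 𝒢₁} {χ₂ : HaarSystem 𝒢₂} {χ₃ : HaarSystem 𝒢₃}
  {L₁ : LeftAction 𝒢₁ X} {R₁ : RightAction 𝒢₂ X} {α : ∀ v, Measure {x : X // R₁.mom x = v}}
  {L₂ : LeftAction 𝒢₂ Y} {R₂ : RightAction 𝒢₃ Y} {β : ∀ u, Measure {y : Y // R₂.mom y = u}}

/-- The integral `∫ k(x γ) Δ₂(γ⁻¹, y) dχ₂(γ)`. -/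
noncomputable def cochainIntegral (χ₂ : HaarSystem 𝒢₂) (R₁ : RightAction 𝒢₂ X)
    {L₂ : LeftAction 𝒢₂ Y} (Δ₂ : L₂.Arrows → ℝ) (k : X → ℝ) (z : FibreProduct R₁ L₂) : ℝ :=
  ∫ γ : {γ : G₂ // 𝒢₂.rng γ = R₁.mom z.1.1}, k (R₁.act z.1.1 γ γ.2.symm) *
    Δ₂ ⟨(𝒢₂.inv γ, z.1.2), (𝒢₂.src_inv _).trans (γ.2.trans z.2)⟩ ∂(χ₂.meas (R₁.mom z.1.1))

/-- The cocycle identity `Δ₂(γ⁻¹, y) = Δ₂(γ⁻¹ η, η⁻¹ y) Δ₂(η⁻¹, y)` separates off a factor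
independent of `γ`; left invariance of `χ₂` under `γ ↦ η⁻¹ γ` identifies what remains with the
integral at `(x η, η⁻¹ y)`. -/
theorem cochainIntegral_act {Δ₂ : L₂.Arrows → ℝ} (hc : L₂.IsCocycle Δ₂) (k : X → ℝ)
    (z : FibreProduct R₁ L₂) (η : G₂) (p : R₁.mom z.1.1 = 𝒢₂.rng η) :
    cochainIntegral χ₂ R₁ Δ₂ k z = cochainIntegral χ₂ R₁ Δ₂ k ((diagAction R₁ L₂).act z η p) *
      Δ₂ ⟨(𝒢₂.inv η, z.1.2), (𝒢₂.src_inv _).trans (p.symm.trans z.2)⟩ := by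
  refine Eq.trans (Eq.trans (integral_congr_ae (Eventually.of_forall fun γ => ?_))
    (integral_mul_const _ _)) (congrArg (· * _) (χ₂.isInvariant_invMulAction.integral_translate
      𝒢₂.invMulAction_isContinuous η p (R₁.mom_act z.1.1 η p).symm
      fun γ => k (R₁.act (R₁.act z.1.1 η p) γ γ.2.symm) * Δ₂ ⟨(𝒢₂.inv γ,
        L₂.act (𝒢₂.inv η) z.1.2 ((𝒢₂.src_inv _).trans (p.symm.trans z.2))),
        (𝒢₂.src_inv _).trans (γ.2.trans ((diagAction R₁ L₂).act z η p).2)⟩).symm)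
  simp only
  have q : 𝒢₂.src (𝒢₂.inv η) = 𝒢₂.rng γ := (𝒢₂.src_inv η).trans (p.symm.trans γ.2.symm)
  have e1 : R₁.act (R₁.act z.1.1 η p) (𝒢₂.mul (𝒢₂.inv η) γ q)
      ((R₁.mom_act _ _ _).trans ((𝒢₂.rng_inv η).symm.trans (𝒢₂.rng_mul _ _ _).symm)) =
      R₁.act z.1.1 γ γ.2.symm := by
    rw [R₁.act_mul _ _ _ ((R₁.mom_act _ _ _).trans (𝒢₂.rng_inv η).symm) q]
    exact R₁.act_congr _ (R₁.act_act_inv _ _ _) rfl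
  have q' : 𝒢₂.src (𝒢₂.inv γ) = 𝒢₂.rng η := (𝒢₂.src_inv _).trans (γ.2.trans p)
  have e2 : 𝒢₂.inv (𝒢₂.mul (𝒢₂.inv η) γ q) = 𝒢₂.mul (𝒢₂.inv γ) η q' := by
    rw [𝒢₂.inv_mul_rev]
    exact 𝒢₂.mul_congr _ rfl (𝒢₂.inv_inv η)
  have e3 : 𝒢₂.mul (𝒢₂.mul (𝒢₂.inv γ) η q') (𝒢₂.inv η)
      ((𝒢₂.src_mul _ _ _).trans (𝒢₂.rng_inv _).symm) = 𝒢₂.inv γ := by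
    rw [𝒢₂.mul_assoc _ _ _ q' (𝒢₂.rng_inv η).symm, 𝒢₂.mul_congr _ rfl ((𝒢₂.mul_inv η).trans
      (congrArg 𝒢₂.unit q'.symm)), 𝒢₂.mul_unit]
  have h1 := hc (𝒢₂.mul (𝒢₂.inv γ) η q') (𝒢₂.inv η) z.1.2
    ((𝒢₂.src_mul _ _ _).trans (𝒢₂.rng_inv _).symm) ((𝒢₂.src_inv _).trans (p.symm.trans z.2))
  have h2 : ∀ (g : G₂) (h : 𝒢₂.src g = L₂.mom z.1.2), g = 𝒢₂.inv γ →
      Δ₂ ⟨(𝒢₂.inv γ, z.1.2), (𝒢₂.src_inv _).trans (γ.2.trans z.2)⟩ = Δ₂ ⟨(g, z.1.2), h⟩ := by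
    rintro _ _ rfl
    rfl
  rw [h2 _ ((𝒢₂.src_mul _ _ _).trans ((𝒢₂.src_inv _).trans (p.symm.trans z.2))) e3, h1, ← mul_assoc]
  refine congrArg (· * _) (congrArg₂ (· * ·) (congrArg k e1.symm) (congrArg Δ₂ ?_))
  exact Subtype.ext (Prod.ext e2.symm rfl)

theorem continuous_cochainIntegral (hG₂ : IsLocallyCompact G₂) (hR : R₁.IsContinuous)
    (hL : L₂.IsContinuous) (hP : R₁.IsProper) (hZ : T2Space (diagAction R₁ L₂).Arrows)
    [LocallyCompactSpace X] [LocallyCompactSpace Y]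
    {Δ₂ : L₂.Arrows → ℝ} (hΔ₂ : Continuous Δ₂) {k : X → ℝ} (hk : Continuous k)
    (hs : HasCompactSupport k) : Continuous (cochainIntegral χ₂ R₁ Δ₂ k) := by
  refine continuous_integral_orbit χ₂ hG₂ hR hL hP hZ
    (φ := fun a => k (R₁.act a.1.1.1.1 a.1.2 a.2) *
      Δ₂ ⟨(𝒢₂.inv a.1.2, a.1.1.1.2), (𝒢₂.src_inv _).trans (a.2.symm.trans a.1.1.2)⟩)
    ((hk.comp (hR.continuous_act_of (by fun_prop) (by fun_prop) _)).mul
      (hΔ₂.comp (Continuous.subtype_mk ((𝒢₂.continuous_inv.comp (by fun_prop)).prodMk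
        (by fun_prop)) _))) hs.isCompact fun a ha => ?_
  rw [image_eq_zero_of_notMem_tsupport ha, zero_mul]

theorem cochainIntegral_pos (hG₂ : IsLocallyCompact G₂) (hR : R₁.IsContinuous)
    (hP : R₁.IsProper)
    {Δ₂ : L₂.Arrows → ℝ} (hΔ₂ : Continuous Δ₂) (hpos : ∀ a, 0 < Δ₂ a) {k : X → ℝ}
    (hk : Continuous k) (hs : HasCompactSupport k) (h0 : ∀ x, 0 ≤ k x) (z : FibreProduct R₁ L₂)
    (hz : 0 < k z.1.1) : 0 < cochainIntegral χ₂ R₁ Δ₂ k z := by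
  have h2 := 𝒢₂.t2Space_fibre hG₂ (R₁.mom z.1.1)
  have := χ₂.isContinuousFamily.regular (R₁.mom z.1.1)
  have := χ₂.isContinuousFamily.fullSupport (R₁.mom z.1.1)
  have he := (diagAction R₁ L₂).isClosedEmbedding_pullArrow.comp
    (isClosedEmbedding_slice (p := (diagAction R₁ L₂).mom)
      (hR.continuous_mom.comp (by fun_prop)) 𝒢₂.continuous_rng z)
  have hc : Continuous fun γ : {γ : G₂ // 𝒢₂.rng γ = R₁.mom z.1.1} =>
      k (R₁.act z.1.1 γ γ.2.symm) *
        Δ₂ ⟨(𝒢₂.inv γ, z.1.2), (𝒢₂.src_inv _).trans (γ.2.trans z.2)⟩ :=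
    (hk.comp (hR.continuous_act_of (by fun_prop) (by fun_prop) _)).mul
      (hΔ₂.comp (Continuous.subtype_mk ((𝒢₂.continuous_inv.comp (by fun_prop)).prodMk
        (by fun_prop)) _))
  refine hc.integral_pos_of_hasCompactSupport_nonneg_nonzero
    (x := ⟨𝒢₂.unit (R₁.mom z.1.1), 𝒢₂.rng_unit _⟩) ?_ (fun γ => mul_nonneg (h0 _) (hpos _).le) ?_
  · refine HasCompactSupport.intro (he.isCompact_preimage
      (isCompact_arrows_of_isProper hR hP (isCompact_singleton (x := z)) hs.isCompact))
      fun γ hγ => ?_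
    have h : k (R₁.act z.1.1 γ γ.2.symm) = 0 :=
      image_eq_zero_of_notMem_tsupport (f := k) fun h => hγ ⟨rfl, h⟩
    rw [h, zero_mul]
  · simp only
    rw [R₁.act_unit]
    exact mul_ne_zero hz.ne' (hpos _).ne'

/-- A weighted sum of countably many nonnegative continuous functions converges locally uniformly
for suitable weights. -/
theorem exists_weights_continuous_tsum {Z : Type*} [TopologicalSpace Z] [LocallyCompactSpace Z]
    [SigmaCompactSpace Z] (I : ℕ → Z → ℝ) (hI : ∀ n, Continuous (I n)) :
    ∃ a : ℕ → ℝ, (∀ n, 0 < a n) ∧ (∀ z, Summable fun n => a n * I n z) ∧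
      Continuous fun z => ∑' n, a n * I n z := by
  let K := CompactExhaustion.choice Z
  have hb : ∀ n m, ∃ C, ∀ z ∈ K m, ‖I n z‖ ≤ C := fun n m =>
    (K.isCompact m).exists_bound_of_continuousOn (hI n).continuousOn
  choose C hC using hb
  -- On `K m` with `m ≤ n` the bound `C n n` for `I n` applies, and this weight brings the `n`-th
  -- term below `2⁻ⁿ`.
  let a : ℕ → ℝ := fun n => (1 / 2) ^ n / (1 + |C n n|)
  have ha : ∀ n, 0 < a n := fun n => by positivity
  -- On `K N` only the finitely many terms with `n < N` escape the geometric bound; they are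
  -- majorized individually, which does not affect summability.
  let v : ℕ → ℕ → ℝ := fun N n => (1 / 2) ^ n + if n < N then a n * |C n N| else 0
  have hv : ∀ N, Summable (v N) := fun N => by
    refine Summable.add (summable_geometric_of_lt_one (by norm_num) (by norm_num)) ?_
    refine summable_of_ne_finset_zero (s := Finset.range N) fun n hn => ?_
    rw [if_neg (by simpa using hn)]
  have hbd : ∀ N n, ∀ z ∈ K N, ‖a n * I n z‖ ≤ v N n := fun N n z hz => by
    rw [norm_mul, Real.norm_of_nonneg (ha n).le]
    by_cases h : n < N
    · simp only [v, if_pos h]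
      have h1 : a n * ‖I n z‖ ≤ a n * |C n N| :=
        mul_le_mul_of_nonneg_left ((hC n N z hz).trans (le_abs_self _)) (ha n).le
      have : (0 : ℝ) ≤ (1 / 2) ^ n := by positivity
      linarith
    · simp only [v, if_neg h, add_zero]
      have h1 : ‖I n z‖ ≤ 1 + |C n n| :=
        (hC n n z (K.subset (not_lt.1 h) hz)).trans ((le_abs_self _).trans (by linarith))
      calc a n * ‖I n z‖ ≤ a n * (1 + |C n n|) := mul_le_mul_of_nonneg_left h1 (ha n).le
        _ = (1 / 2) ^ n := by
          have : (1 + |C n n|) ≠ 0 := by positivity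
          simp only [a]
          field_simp
  refine ⟨a, ha, fun z => ?_, continuous_iff_continuousAt.2 fun z => ?_⟩
  · obtain ⟨N, hN⟩ := K.exists_mem z
    exact Summable.of_norm_bounded (hv N) fun n => hbd N n z hN
  · obtain ⟨N, hN⟩ := K.exists_mem z
    have hO : K (N + 1) ∈ 𝓝 z := mem_interior_iff_mem_nhds.1 (K.subset_interior_succ N hN)
    exact (continuousOn_tsum (fun n => ((hI n).const_mul (a n)).continuousOn) (hv (N + 1))
      fun n z hz => hbd (N + 1) n z hz).continuousAt hO

theorem exists_seq_cover_of_hasCompactSupport (X : Type*) [TopologicalSpace X] [T2Space X]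
    [SecondCountableTopology X] [LocallyCompactSpace X] [Nonempty X] :
    ∃ k : ℕ → X → ℝ, (∀ n, Continuous (k n) ∧ HasCompactSupport (k n) ∧ ∀ x, 0 ≤ k n x) ∧
      ∀ x, ∃ n, 0 < k n x := by
  have h : ∀ x : X, ∃ k : X → ℝ, (Continuous k ∧ HasCompactSupport k ∧ ∀ x, 0 ≤ k x) ∧ 0 < k x :=
    fun x => by
      obtain ⟨k, h1, h2, h3⟩ := exists_continuous_nonneg_pos x
      exact ⟨k, ⟨k.continuous, h1, h2⟩, lt_of_le_of_ne (h2 x) h3.symm⟩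
  choose k hk hkx using h
  obtain ⟨s, hs, hsu⟩ := TopologicalSpace.countable_cover_nhds
    (f := fun x => {y | 0 < k x y}) fun x => (isOpen_lt continuous_const (hk x).1).mem_nhds (hkx x)
  have hne : s.Nonempty := by
    rw [nonempty_iff_ne_empty]
    rintro rfl
    simp only [mem_empty_iff_false, iUnion_of_empty, iUnion_empty] at hsu
    exact empty_ne_univ hsu
  obtain ⟨e, rfl⟩ := hs.exists_eq_range hne
  refine ⟨fun n => k (e n), fun n => hk _, fun x => ?_⟩
  obtain ⟨y, hy, hx⟩ := mem_iUnion₂.1 (hsu.symm ▸ mem_univ x)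
  obtain ⟨n, rfl⟩ := hy
  exact ⟨n, hx⟩

/-- The cocycle `Δ₂(γ⁻¹, y)` on the proper transformation groupoid `Z ⋊ G₂` is a coboundary. -/
theorem exists_isTrivializingCochain (hG₂ : IsLocallyCompact G₂) (hR : R₁.IsContinuous)
    (hP : R₁.IsProper) (hX : LocallyCompactSpace X) (hY : IsTopCorrespondence χ₂ χ₃ L₂ R₂ β)
    (hZ : T2Space (diagAction R₁ L₂).Arrows)
    {Δ₂ : L₂.Arrows → ℝ} (hΔ₂ : L₂.IsAdjoiningFunction χ₂ R₂.mom β Δ₂) :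
    ∃ b : FibreProduct R₁ L₂ → ℝ, IsTrivializingCochain R₁ hY.commute Δ₂ b := by
  have hYl := hY.locallyCompact.locallyCompactSpace
  have hL := hY.left_continuous
  -- A sequence of bump functions covering `X` can be enumerated only for nonempty `X`; otherwise
  -- `Z` is empty.
  rcases isEmpty_or_nonempty X with hem | hne
  · have : IsEmpty (FibreProduct R₁ L₂) := ⟨fun z => hem.elim z.1.1⟩
    exact ⟨fun _ => 1, continuous_const, fun _ => one_pos, fun _ _ _ => rfl,
      fun z => (this.false z).elim⟩
  have := locallyCompactSpace_fibreProduct hR hL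
  have := (isClosedEmbedding_fibreProduct hR hL).isEmbedding.secondCountableTopology
  have hcoc := hΔ₂.isCocycle hG₂ hY.locallyCompact hL hY.right_continuous.continuous_mom
    hY.commute.mom_right hY.family
  obtain ⟨k, hk, hcov⟩ := exists_seq_cover_of_hasCompactSupport X
  obtain ⟨a, ha, hsum, hcont⟩ := exists_weights_continuous_tsum
    (fun n => cochainIntegral χ₂ R₁ Δ₂ (k n)) fun n =>
      continuous_cochainIntegral hG₂ hR hL hP hZ hΔ₂.continuous (hk n).1 (hk n).2.1
  -- A single `kₙ` has compact support and gives an integral that may vanish; the weighted sum over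
  -- a cover is positive everywhere. Each term satisfies `S(z) = S(z γ) Δ₂(γ⁻¹, y)`, so the
  -- reciprocal has the required coboundary.
  set S : FibreProduct R₁ L₂ → ℝ := fun z => ∑' n, a n * cochainIntegral χ₂ R₁ Δ₂ (k n) z with hS
  have hnn : ∀ n z, 0 ≤ a n * cochainIntegral χ₂ R₁ Δ₂ (k n) z := fun n z =>
    mul_nonneg (ha n).le (integral_nonneg fun γ => mul_nonneg ((hk n).2.2 _) (hΔ₂.pos _).le)
  have hSpos : ∀ z, 0 < S z := fun z => by
    obtain ⟨n, hn⟩ := hcov z.1.1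
    exact (hsum z).tsum_pos (fun n => hnn n z) n (mul_pos (ha n)
      (cochainIntegral_pos hG₂ hR hP hΔ₂.continuous hΔ₂.pos (hk n).1 (hk n).2.1 (hk n).2.2 z hn))
  refine ⟨fun z => (S z)⁻¹, hcont.inv₀ fun z => (hSpos z).ne', fun z => inv_pos.2 (hSpos z),
    fun z η p => ?_, fun z γ p => ?_⟩
  · refine congrArg (fun s => s⁻¹) (tsum_congr fun n => congrArg (a n * ·) ?_)
    refine integral_congr_ae (Eventually.of_forall fun γ => congrArg (_ * ·) ?_)
    exact hΔ₂.act_right hG₂ hY.locallyCompact hL hY.right_continuous hY.commute hY.family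
      hY.invariant _ _ _ _ _
  · have h1 : S z = S ((diagAction R₁ L₂).act z γ p) *
        Δ₂ ⟨(𝒢₂.inv γ, z.1.2), (𝒢₂.src_inv γ).trans (p.symm.trans z.2)⟩ := by
      simp only [hS]
      rw [← tsum_mul_right]
      refine tsum_congr fun n => ?_
      rw [cochainIntegral_act hcoc (k n) z γ p, mul_assoc]
    have h2 := (hSpos ((diagAction R₁ L₂).act z γ p)).ne'
    simp only [inv_inv]
    rw [h1]
    field_simp

end TrivializingCochain

/-! ### Construction and uniqueness of the measures `μ_u`. -/

section CompositeMeasure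

open Set Filter Topology CompactlySupported

set_option linter.unusedSectionVars false

variable {G₁ U₁ G₂ U₂ G₃ U₃ X Y : Type*}
  [TopologicalSpace G₁] [TopologicalSpace U₁] [T2Space U₁]
  [TopologicalSpace G₂] [TopologicalSpace U₂] [T2Space U₂]
  [TopologicalSpace G₃] [TopologicalSpace U₃] [T2Space U₃]
  [MeasurableSpace G₁] [BorelSpace G₁] [MeasurableSpace G₂] [BorelSpace G₂]
  [MeasurableSpace G₃] [BorelSpace G₃]
  [TopologicalSpace X] [T2Space X] [SecondCountableTopology X] [MeasurableSpace X] [BorelSpace X]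
  [TopologicalSpace Y] [T2Space Y] [SecondCountableTopology Y] [MeasurableSpace Y] [BorelSpace Y]
  {𝒢₁ : TopGroupoid G₁ U₁} {𝒢₂ : TopGroupoid G₂ U₂} {𝒢₃ : TopGroupoid G₃ U₃}
  {χ₁ : HaarSystem 𝒢₁} {χ₂ : HaarSystem 𝒢₂} {χ₃ : HaarSystem 𝒢₃}
  {L₁ : LeftAction 𝒢₁ X} {R₁ : RightAction 𝒢₂ X} {α : ∀ v, Measure {x : X // R₁.mom x = v}}
  {L₂ : LeftAction 𝒢₂ Y} {R₂ : RightAction 𝒢₃ Y} {β : ∀ u, Measure {y : Y // R₂.mom y = u}}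

/-- Inversion of arrows, `(x, γ) ↦ (x γ, γ⁻¹)`. -/
def RightAction.invArrow {G U X : Type*} [TopologicalSpace G] [TopologicalSpace U]
    {𝒢 : TopGroupoid G U} (R : RightAction 𝒢 X) (a : R.Arrows) : R.Arrows :=
  ⟨(R.act a.1.1 a.1.2 a.2, 𝒢.inv a.1.2), (R.mom_act _ _ _).trans (𝒢.rng_inv _).symm⟩

/-- The point `(x, y)` of `Z` for `y` in the fibre `Y_u`. -/
def fibreMk {u : U₃} (a : Pull (fun y : {y : Y // R₂.mom y = u} => L₂.mom y) R₁.mom) :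
    FibreProduct R₁ L₂ :=
  ⟨(a.1.2, a.1.1), a.2⟩

/-- The arrow `((x, y), γ)` of `Z ⋊ G₂` for `y` in the fibre `Y_u`. -/
def fibreArrow {u : U₃} (a : Pull (fun a : Pull (fun y : {y : Y // R₂.mom y = u} => L₂.mom y)
    R₁.mom => L₂.mom a.1.1) 𝒢₂.rng) : (diagAction R₁ L₂).Arrows :=
  ⟨(fibreMk a.1.1, a.1.2), a.1.1.2.trans a.2.symm⟩

/-- The integral `∫ ∫ f(x, y) b(x, y) dα_{r(y)}(x) dβ_u(y)`. -/
noncomputable def weightedIntegral (α : ∀ v, Measure {x : X // R₁.mom x = v})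
    (β : ∀ u, Measure {y : Y // R₂.mom y = u}) (b f : FibreProduct R₁ L₂ → ℝ) (u : U₃) : ℝ :=
  ∫ y : {y : Y // R₂.mom y = u}, ∫ x : {x : X // R₁.mom x = L₂.mom y},
    f ⟨(x, y), x.2⟩ * b ⟨(x, y), x.2⟩ ∂(α (L₂.mom y)) ∂(β u)

theorem isClosedEmbedding_fibreMk (hR : R₁.IsContinuous) (hL : L₂.IsContinuous)
    (hc : Continuous R₂.mom) (u : U₃) :
    IsClosedEmbedding (fibreMk : Pull (fun y : {y : Y // R₂.mom y = u} => L₂.mom y) R₁.mom →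
      FibreProduct R₁ L₂) := by
  rw [← IsClosedEmbedding.of_comp_iff (isClosedEmbedding_fibreProduct hR hL)]
  exact (Homeomorph.prodComm Y X).isClosedEmbedding.comp
    (((isClosedEmbedding_fibre hc u).prodMap IsClosedEmbedding.id).comp
      (isClosedEmbedding_pull (hL.continuous_mom.comp continuous_subtype_val) hR.continuous_mom))

theorem isClosedEmbedding_fibreArrow (hR : R₁.IsContinuous) (hL : L₂.IsContinuous)
    (hc : Continuous R₂.mom) (u : U₃) :
    IsClosedEmbedding (fibreArrow : Pull (fun a : Pull (fun y : {y : Y // R₂.mom y = u} =>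
      L₂.mom y) R₁.mom => L₂.mom a.1.1) 𝒢₂.rng → (diagAction R₁ L₂).Arrows) := by
  have h : IsClosedEmbedding (Subtype.val : (diagAction R₁ L₂).Arrows → FibreProduct R₁ L₂ × G₂) :=
    IsClosed.isClosedEmbedding_subtypeVal
      (isClosed_eq ((diagAction_isContinuous hR hL).continuous_mom.comp continuous_fst)
        (𝒢₂.continuous_rng.comp continuous_snd))
  rw [← IsClosedEmbedding.of_comp_iff h]
  exact ((isClosedEmbedding_fibreMk hR hL hc u).prodMap IsClosedEmbedding.id).comp
    (isClosedEmbedding_pull (p := fun a : Pull (fun y : {y : Y // R₂.mom y = u} => L₂.mom y) R₁.mom =>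
      L₂.mom a.1.1) (hL.continuous_mom.comp (by fun_prop)) 𝒢₂.continuous_rng)

/-- This is the coboundary equation at the point `z γ` and the arrow `γ⁻¹`, the form in which `b`
cancels the factor produced by quasi-invariance of `β`. -/
theorem IsTrivializingCochain.act_mul {c : ActionsCommute L₂ R₂} {Δ₂ : L₂.Arrows → ℝ}
    {b : FibreProduct R₁ L₂ → ℝ} (hb : IsTrivializingCochain R₁ c Δ₂ b) (z : FibreProduct R₁ L₂)
    (γ : G₂) (p : R₁.mom z.1.1 = 𝒢₂.rng γ) (q : 𝒢₂.src (𝒢₂.inv γ) = L₂.mom z.1.2)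
    (q' : 𝒢₂.src γ = L₂.mom (L₂.act (𝒢₂.inv γ) z.1.2 q)) :
    b ((diagAction R₁ L₂).act z γ p) * Δ₂ ⟨(γ, L₂.act (𝒢₂.inv γ) z.1.2 q), q'⟩ = b z := by
  have h1 := hb.coboundary ((diagAction R₁ L₂).act z γ p) (𝒢₂.inv γ)
    ((R₁.mom_act _ _ _).trans (𝒢₂.rng_inv γ).symm)
  have h2 : ∀ (g : G₂) (h : 𝒢₂.src g = L₂.mom (L₂.act (𝒢₂.inv γ) z.1.2 q)), g = γ →
      Δ₂ ⟨(g, L₂.act (𝒢₂.inv γ) z.1.2 q), h⟩ = Δ₂ ⟨(γ, L₂.act (𝒢₂.inv γ) z.1.2 q), q'⟩ := by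
    rintro _ _ rfl
    rfl
  rw [(diagAction R₁ L₂).act_act_inv z γ p] at h1
  have h3 := h1.trans (h2 _ _ (𝒢₂.inv_inv γ))
  rw [← h3]
  have := (hb.pos ((diagAction R₁ L₂).act z γ p)).ne'
  field_simp

variable (hG₂ : IsLocallyCompact G₂) (hX : IsTopCorrespondence χ₁ χ₂ L₁ R₁ α)
  (hY : IsTopCorrespondence χ₂ χ₃ L₂ R₂ β) (hZ : T2Space (diagAction R₁ L₂).Arrows)
  {Δ₂ : L₂.Arrows → ℝ} (hΔ₂ : L₂.IsAdjoiningFunction χ₂ R₂.mom β Δ₂)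
  {b : FibreProduct R₁ L₂ → ℝ} (hb : IsTrivializingCochain R₁ hY.commute Δ₂ b)

include hG₂ hX hY hΔ₂ hb

/-- The measures `b m_u` on `Z` are symmetric with respect to the inversion of `Z ⋊ G₂`. -/
theorem weightedIntegral_inversion (u : U₃) {F : (diagAction R₁ L₂).Arrows → ℝ} (hF : F ∈ Cc _) :
    ∫ y : {y : Y // R₂.mom y = u}, pullIntegral α (fun y : {y : Y // R₂.mom y = u} => L₂.mom y)
      (pullIntegral χ₂.meas (fun a => L₂.mom a.1.1) fun a => F (fibreArrow a) *
        b (fibreMk a.1.1)) y ∂(β u) =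
    ∫ y : {y : Y // R₂.mom y = u}, pullIntegral α (fun y : {y : Y // R₂.mom y = u} => L₂.mom y)
      (pullIntegral χ₂.meas (fun a => L₂.mom a.1.1) fun a =>
        F ((diagAction R₁ L₂).invArrow (fibreArrow a)) * b (fibreMk a.1.1)) y ∂(β u) := by
  have hL := hY.left_continuous
  have hR := hX.right_continuous
  have hc := hY.right_continuous.continuous_mom
  let L := L₂.fibre R₂.mom hY.commute.mom_right u
  have hL' : L.IsContinuous := hL.fibre R₂.mom hY.commute.mom_right u
  have hq := ((LeftAction.isAdjoiningFunction_iff hG₂ hY.locallyCompact hL hc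
    hY.commute.mom_right).1 hΔ₂).2.2 u
  have hD := LeftAction.continuous_fibreFunction hL R₂.mom hY.commute.mom_right hΔ₂.continuous u
  have h2 := 𝒢₂.t2Space_fibre hG₂
  have h2' : ∀ v, T2Space {x : X // R₁.mom x = v} := fun _ => inferInstance
  let Φ : Pull (fun a : Pull L.mom R₁.mom => L.mom a.1.1) 𝒢₂.rng → ℝ :=
    fun a => F (fibreArrow a) * b (fibreMk a.1.1)
  have hΦ : Φ ∈ Cc _ := Cc_mul_continuous
    (Cc_comp_isClosedEmbedding hF (isClosedEmbedding_fibreArrow hR hL hc u))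
    (hb.continuous.comp ((isClosedEmbedding_fibreMk hR hL hc u).continuous.comp (by fun_prop)))
  have hΦ' : (fun a => Φ (Pull.swap a)) ∈ Cc _ :=
    Cc_comp_isClosedEmbedding hΦ Pull.isClosedEmbedding_swap
  have hΨ : (fun a => Φ (L.twist R₁ a).swap * L₂.fibreFunction R₂.mom hY.commute.mom_right Δ₂ u
      a.1.1) ∈ Cc _ := Cc_mul_continuous (Cc_comp_isClosedEmbedding hΦ'
    (isClosedEmbedding_of_involutive (LeftAction.continuous_twist hL' hR) (L.twist_twist R₁)))
    (hD.comp (by fun_prop))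
  -- Fubini brings the integral over `X` innermost, the twist inverts the arrow at the cost of
  -- `Δ₂(γ, γ⁻¹ y)`, and Fubini restores the order. The new factor combines with `b(z γ)` to give
  -- `b(z)`.
  refine (integral_congr_ae (Eventually.of_forall fun y => pullIntegral_pullIntegral_swap
    hL'.continuous_mom hR.continuous_mom 𝒢₂.continuous_rng hX.family h2' χ₂.isContinuousFamily
    h2 hΦ y)).trans ((hq.twist hG₂ (hY.locallyCompact.of_isClosedEmbedding
      (isClosedEmbedding_fibre hc u)) hX.locallyCompact hL' hR hX.family h2' hX.invariant hΦ').trans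
      (integral_congr_ae (Eventually.of_forall fun y => (pullIntegral_pullIntegral_swap
    hL'.continuous_mom 𝒢₂.continuous_rng hR.continuous_mom χ₂.isContinuousFamily
    h2 hX.family h2' hΨ y).trans ?_)))
  refine congrArg (fun F => pullIntegral α L.mom (pullIntegral χ₂.meas (fun a => L.mom a.1.1) F) y)
    (funext fun a => ?_)
  refine (mul_assoc _ _ _).trans (congrArg (F ((diagAction R₁ L₂).invArrow (fibreArrow a)) * ·) ?_)
  exact hb.act_mul (fibreMk a.1.1) a.1.2 (a.1.1.2.trans a.2.symm) _ _

include hZ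

/-- Both sides are integrals over arrows, of `f(z) h(z γ)` and of the same function after inversion.
Properness of the diagonal action makes that function compactly supported. -/
theorem weightedIntegral_mul_orbitIntegral_comm {f h : FibreProduct R₁ L₂ → ℝ} (hf : f ∈ Cc _)
    (hh : h ∈ Cc _) (u : U₃) :
    weightedIntegral α β b (fun z => f z * orbitIntegral χ₂ R₁ L₂ h (CompositeSpace.mk z)) u =
      weightedIntegral α β b (fun z => h z * orbitIntegral χ₂ R₁ L₂ f (CompositeSpace.mk z)) u := by
  have := hX.locallyCompact.locallyCompactSpace
  have := hY.locallyCompact.locallyCompactSpace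
  have hR := hX.right_continuous
  have hd := diagAction_isContinuous hR hY.left_continuous
  have hf' := (mem_Cc_iff _).1 hf
  have hh' := (mem_Cc_iff _).1 hh
  let F : (diagAction R₁ L₂).Arrows → ℝ := fun a => f a.1.1 *
    h ((diagAction R₁ L₂).act a.1.1 a.1.2 a.2)
  have hF : F ∈ Cc _ := by
    refine (mem_Cc_iff _).2 ⟨(hf'.1.comp (by fun_prop)).mul (hh'.1.comp hd.continuous_act),
      HasCompactSupport.intro ((isProperMap_diagAction hR hY.left_continuous
        hX.proper).isCompact_preimage (hf'.2.isCompact.prod hh'.2.isCompact)) fun a ha => ?_⟩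
    by_cases h1 : a.1.1 ∈ tsupport f
    · exact mul_eq_zero_of_right _ (image_eq_zero_of_notMem_tsupport fun h2 => ha ⟨h1, h2⟩)
    · exact mul_eq_zero_of_left (image_eq_zero_of_notMem_tsupport h1) _
  have key : ∀ (k g : FibreProduct R₁ L₂ → ℝ) (F : (diagAction R₁ L₂).Arrows → ℝ),
      (∀ (z : FibreProduct R₁ L₂) (γ : G₂) (p), F ⟨(z, γ), p⟩ = k z *
        g ((diagAction R₁ L₂).act z γ p)) →
      weightedIntegral α β b (fun z => k z * orbitIntegral χ₂ R₁ L₂ g (CompositeSpace.mk z)) u =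
      ∫ y : {y : Y // R₂.mom y = u}, pullIntegral α (fun y : {y : Y // R₂.mom y = u} => L₂.mom y)
        (pullIntegral χ₂.meas (fun a => L₂.mom a.1.1) fun a => F (fibreArrow a) *
          b (fibreMk a.1.1)) y ∂(β u) := by
    intro k g F hF
    refine integral_congr_ae (Eventually.of_forall fun y =>
      integral_congr_ae (Eventually.of_forall fun x => ?_))
    let t : Pull (fun y : {y : Y // R₂.mom y = u} => L₂.mom y) R₁.mom := ⟨(y, x), x.2⟩
    refine Eq.trans (b := ∫ γ : {γ : G₂ // 𝒢₂.rng γ = L₂.mom y}, (k (fibreMk t) *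
      g ((diagAction R₁ L₂).act (fibreMk t) γ (x.2.trans γ.2.symm))) * b (fibreMk t)
        ∂(χ₂.meas (L₂.mom y))) ?_ (integral_congr_ae (Eventually.of_forall fun γ =>
          congrArg (· * b (fibreMk t)) (hF (fibreMk t) γ (x.2.trans γ.2.symm)).symm))
    rw [integral_mul_const, integral_const_mul]
    refine congrArg (fun s => k (fibreMk t) * s * b (fibreMk t)) ?_
    exact pullIntegral_map fibreMk (fun t => t.2)
      (fun a => g ((diagAction R₁ L₂).act a.1.1 a.1.2 a.2.symm)) t
  refine (key f h F fun z γ p => rfl).trans ((weightedIntegral_inversion hG₂ hX hY hΔ₂ hb u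
    hF).trans (key h f (fun a => F ((diagAction R₁ L₂).invArrow a)) fun z γ p => ?_).symm)
  refine (mul_comm _ _).trans (congrArg (· * f ((diagAction R₁ L₂).act z γ p)) ?_)
  exact congrArg h ((diagAction R₁ L₂).act_act_inv z γ p)

omit hG₂ hX hY hΔ₂ hb hZ in
theorem weightedIntegral_congr {f f' : FibreProduct R₁ L₂ → ℝ} {u : U₃}
    (h : ∀ z : FibreProduct R₁ L₂, R₂.mom z.1.2 = u → f z = f' z) :
    weightedIntegral α β b f u = weightedIntegral α β b f' u := by
  refine integral_congr_ae (Eventually.of_forall fun y =>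
    integral_congr_ae (Eventually.of_forall fun x => ?_))
  exact congrArg (· * _) (h ⟨(x, y), x.2⟩ y.2)

/-- This makes the functional `Λ(f) ↦ ∫ f b dm_u` well defined. If `Λ(e) = 1` on the image of the
supports, then `∫ f b dm_u = ∫ f Λ(e) b dm_u = ∫ e Λ(f) b dm_u`, and the last integral involves `f`
only through `Λ(f)`. -/
theorem weightedIntegral_eq_of_orbitIntegral_eq {f f' : FibreProduct R₁ L₂ → ℝ} (hf : f ∈ Cc _)
    (hf' : f' ∈ Cc _) {u : U₃}
    (h : ∀ z : FibreProduct R₁ L₂, R₂.mom z.1.2 = u → orbitIntegral χ₂ R₁ L₂ f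
      (CompositeSpace.mk z) = orbitIntegral χ₂ R₁ L₂ f' (CompositeSpace.mk z)) :
    weightedIntegral α β b f u = weightedIntegral α β b f' u := by
  have := hX.locallyCompact.locallyCompactSpace
  have := hY.locallyCompact.locallyCompactSpace
  have hq := CompositeSpace.isOpenQuotientMap_mk hX.right_continuous hY.left_continuous
    (χ₂.isOpenMap_rng hG₂)
  obtain ⟨e, he, he1⟩ := exists_orbitIntegral_eq_one χ₂ hG₂ hX.right_continuous hY.left_continuous
    hX.proper hZ ((((mem_Cc_iff _).1 hf).2.isCompact.union
      ((mem_Cc_iff _).1 hf').2.isCompact).image hq.continuous)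
  have key : ∀ k : FibreProduct R₁ L₂ → ℝ, k ∈ Cc _ → tsupport k ⊆ tsupport f ∪ tsupport f' →
      weightedIntegral α β b k u = weightedIntegral α β b
        (fun z => e z * orbitIntegral χ₂ R₁ L₂ k (CompositeSpace.mk z)) u := fun k hk hks => by
    rw [← weightedIntegral_mul_orbitIntegral_comm hG₂ hX hY hZ hΔ₂ hb hk he]
    refine weightedIntegral_congr fun z _ => ?_
    by_cases hz : z ∈ tsupport k
    · rw [he1 _ ⟨z, hks hz, rfl⟩, mul_one]
    · rw [image_eq_zero_of_notMem_tsupport hz, zero_mul]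
  rw [key f hf subset_union_left, key f' hf' subset_union_right]
  exact weightedIntegral_congr fun z hz => by rw [h z hz]

omit hG₂ hZ hΔ₂ in
theorem pullIntegral_weighted_mem_Cc {f : FibreProduct R₁ L₂ → ℝ} (hf : f ∈ Cc _) (u : U₃) :
    pullIntegral α (fun y : {y : Y // R₂.mom y = u} => L₂.mom y)
      (fun a => f (fibreMk a) * b (fibreMk a)) ∈ Cc _ := by
  have hc := hY.right_continuous.continuous_mom
  have hi := isClosedEmbedding_fibreMk hX.right_continuous hY.left_continuous hc u
  exact pullIntegral_mem_Cc (hY.locallyCompact.of_isClosedEmbedding (isClosedEmbedding_fibre hc u))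
    hX.locallyCompact (hY.left_continuous.continuous_mom.comp continuous_subtype_val)
    hX.right_continuous.continuous_mom hX.family (fun _ => inferInstance)
    (Cc_mul_continuous (Cc_comp_isClosedEmbedding hf hi) (hb.continuous.comp hi.continuous))

omit hG₂ hZ hΔ₂ in
theorem weightedIntegral_add {f f' : FibreProduct R₁ L₂ → ℝ} (hf : f ∈ Cc _) (hf' : f' ∈ Cc _)
    (u : U₃) : weightedIntegral α β b (f + f') u =
      weightedIntegral α β b f u + weightedIntegral α β b f' u := by
  have := hY.family.regular u
  have hc := hY.right_continuous.continuous_mom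
  have hi := isClosedEmbedding_fibreMk hX.right_continuous hY.left_continuous hc u
  refine Eq.trans (integral_congr_ae (Eventually.of_forall fun y => ?_)) (integral_add
    (Cc_integrable (pullIntegral_weighted_mem_Cc hX hY hb hf u) (β u))
    (Cc_integrable (pullIntegral_weighted_mem_Cc hX hY hb hf' u) (β u)))
  have h1 : ∀ k : FibreProduct R₁ L₂ → ℝ, k ∈ Cc _ → (fun a :
      Pull (fun y : {y : Y // R₂.mom y = u} => L₂.mom y) R₁.mom => k (fibreMk a) *
        b (fibreMk a)) ∈ Cc _ := fun k hk =>
    Cc_mul_continuous (Cc_comp_isClosedEmbedding hk hi) (hb.continuous.comp hi.continuous)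
  refine Eq.trans ?_ (congrFun (pullIntegral_add
    (hY.left_continuous.continuous_mom.comp continuous_subtype_val)
    hX.right_continuous.continuous_mom hX.family (fun _ => inferInstance) (h1 f hf) (h1 f' hf')) y)
  exact integral_congr_ae (Eventually.of_forall fun x => add_mul _ _ _)

omit hG₂ hX hY hΔ₂ hb hZ in
theorem weightedIntegral_smul (s : ℝ) (f : FibreProduct R₁ L₂ → ℝ) (u : U₃) :
    weightedIntegral α β b (s • f) u = s * weightedIntegral α β b f u := by
  refine Eq.trans (integral_congr_ae (Eventually.of_forall fun y => ?_)) (integral_const_mul _ _)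
  exact Eq.trans (integral_congr_ae (Eventually.of_forall fun x => mul_assoc _ _ _))
    (integral_const_mul _ _)

omit hΔ₂ hb in
theorem orbitIntegral_add {f f' : FibreProduct R₁ L₂ → ℝ} (hf : f ∈ Cc _) (hf' : f' ∈ Cc _)
    (ω : CompositeSpace R₁ L₂) : orbitIntegral χ₂ R₁ L₂ (f + f') ω =
      orbitIntegral χ₂ R₁ L₂ f ω + orbitIntegral χ₂ R₁ L₂ f' ω := by
  have := hX.locallyCompact.locallyCompactSpace
  have := hY.locallyCompact.locallyCompactSpace
  obtain ⟨z, rfl⟩ : ∃ z, CompositeSpace.mk z = ω := Quotient.mk_surjective ω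
  have h2 := 𝒢₂.t2Space_fibre hG₂ ((diagAction R₁ L₂).mom z)
  have := χ₂.isContinuousFamily.regular ((diagAction R₁ L₂).mom z)
  have hs := fun (k : FibreProduct R₁ L₂ → ℝ) (hk : k ∈ Cc _) => Cc_integrable
    (slice_orbit hG₂ hX.right_continuous hY.left_continuous hX.proper hZ hk z)
    (χ₂.meas ((diagAction R₁ L₂).mom z))
  exact integral_add (hs f hf) (hs f' hf')

omit [T2Space U₂] [T2Space X] [T2Space Y] hG₂ hX hY hΔ₂ hb hZ in
theorem orbitIntegral_smul (s : ℝ) (f : FibreProduct R₁ L₂ → ℝ) (ω : CompositeSpace R₁ L₂) :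
    orbitIntegral χ₂ R₁ L₂ (s • f) ω = s * orbitIntegral χ₂ R₁ L₂ f ω := by
  obtain ⟨z, rfl⟩ : ∃ z, CompositeSpace.mk z = ω := Quotient.mk_surjective ω
  exact integral_const_mul _ _

omit hΔ₂ hb hZ in
theorem continuous_compositeRight_mom : Continuous (compositeRight R₁ hY.commute).mom := by
  have := hX.locallyCompact.locallyCompactSpace
  have := hY.locallyCompact.locallyCompactSpace
  have hq := CompositeSpace.isOpenQuotientMap_mk hX.right_continuous hY.left_continuous
    (χ₂.isOpenMap_rng hG₂)
  rw [hq.isQuotientMap.continuous_iff]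
  exact hY.right_continuous.continuous_mom.comp (by fun_prop :
    Continuous fun z : FibreProduct R₁ L₂ => z.1.2)

omit hΔ₂ hb in
/-- Every test function on a fibre `Ω_u` is the restriction of an orbit integral. -/
theorem exists_orbitIntegral_fibre_eq {u : U₃}
    {g : {ω : CompositeSpace R₁ L₂ // (compositeRight R₁ hY.commute).mom ω = u} → ℝ}
    (hg : g ∈ Cc _) : ∃ f ∈ Cc (FibreProduct R₁ L₂), (∀ ω, orbitIntegral χ₂ R₁ L₂ f ω.1 = g ω) ∧
      ((∀ ω, 0 ≤ g ω) → ∀ z, 0 ≤ f z) := by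
  have := hX.locallyCompact.locallyCompactSpace
  have := hY.locallyCompact.locallyCompactSpace
  have hR := hX.right_continuous
  have hL := hY.left_continuous
  have hr := χ₂.isOpenMap_rng hG₂
  have := CompositeSpace.t2Space hR hL hr hX.proper
  have := CompositeSpace.locallyCompactSpace hR hL hr
  obtain ⟨k, hk, hkg⟩ := Cc_exists_extension IsLocallyCompact.of_locallyCompactSpace
    (isClosedEmbedding_fibre (continuous_compositeRight_mom hG₂ hX hY) u) hg
  by_cases h0 : ∀ ω, 0 ≤ g ω
  · have hk' := (mem_Cc_iff _).1 hk
    -- An extension of a nonnegative function may be negative off the fibre; its positive part is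
    -- still an extension.
    have hm : (fun ω => max (k ω) 0) ∈ Cc _ := (mem_Cc_iff _).2
      ⟨hk'.1.max continuous_const, HasCompactSupport.intro hk'.2 fun ω hω => by
        rw [image_eq_zero_of_notMem_tsupport hω, max_self]⟩
    obtain ⟨f, hf, h1, h2⟩ := exists_orbitIntegral_eq χ₂ hG₂ hR hL hX.proper hZ hm
    refine ⟨f, hf, fun ω => ?_, fun _ => h2 fun ω => le_max_right _ _⟩
    rw [h1]
    exact (congrArg (max · 0) (hkg ω)).trans (max_eq_left (h0 ω))
  · obtain ⟨f, hf, h1, -⟩ := exists_orbitIntegral_eq χ₂ hG₂ hR hL hX.proper hZ hk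
    exact ⟨f, hf, fun ω => by rw [h1, hkg], fun h => absurd h h0⟩

omit hΔ₂ hb in
theorem orbitIntegral_fibre_mem_Cc {f : FibreProduct R₁ L₂ → ℝ} (hf : f ∈ Cc _) (u : U₃) :
    (fun ω : {ω : CompositeSpace R₁ L₂ // (compositeRight R₁ hY.commute).mom ω = u} =>
      orbitIntegral χ₂ R₁ L₂ f ω) ∈ Cc _ := by
  have := hX.locallyCompact.locallyCompactSpace
  have := hY.locallyCompact.locallyCompactSpace
  exact Cc_comp_isClosedEmbedding (orbitIntegral_mem_Cc χ₂ hG₂ hX.right_continuous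
    hY.left_continuous hX.proper hZ hf)
    (isClosedEmbedding_fibre (continuous_compositeRight_mom hG₂ hX hY) u)

/-- The chosen lift `F g` of a test function `g` on `Ω_u` need not be linear in `g`. Its weighted
integral depends only on `g`, however, and is therefore linear; it is positive because nonnegative
functions have nonnegative lifts. Riesz's theorem then applies. -/
theorem exists_isCompositeFamily : ∃ μ, IsCompositeFamily χ₂ hY.commute α β b μ := by
  have := hX.locallyCompact.locallyCompactSpace
  have := hY.locallyCompact.locallyCompactSpace
  have hR := hX.right_continuous
  have hL := hY.left_continuous
  have hr := χ₂.isOpenMap_rng hG₂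
  have := CompositeSpace.t2Space hR hL hr hX.proper
  have := CompositeSpace.locallyCompactSpace hR hL hr
  have key : ∀ u, ∃ m : Measure {ω : CompositeSpace R₁ L₂ //
      (compositeRight R₁ hY.commute).mom ω = u}, m.Regular ∧ ∀ f : FibreProduct R₁ L₂ → ℝ,
        f ∈ Cc _ → weightedIntegral α β b f u = ∫ ω, orbitIntegral χ₂ R₁ L₂ f ω.1 ∂m := fun u => by
    have := (isClosedEmbedding_fibre
      (continuous_compositeRight_mom hG₂ hX hY) u).locallyCompactSpace
    have hex := fun g : C_c({ω : CompositeSpace R₁ L₂ //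
      (compositeRight R₁ hY.commute).mom ω = u}, ℝ) => exists_orbitIntegral_fibre_eq hG₂ hX hY hZ
        ((mem_Cc_iff _).2 ⟨g.continuous, g.hasCompactSupport⟩)
    choose F hF hFg hF0 using hex
    have huniq := fun (f : FibreProduct R₁ L₂ → ℝ) (hf : f ∈ Cc _) (g : C_c({ω :
        CompositeSpace R₁ L₂ // (compositeRight R₁ hY.commute).mom ω = u}, ℝ))
        (h : ∀ ω, orbitIntegral χ₂ R₁ L₂ f ω.1 = g ω) =>
      weightedIntegral_eq_of_orbitIntegral_eq hG₂ hX hY hZ hΔ₂ hb (hF g) hf (u := u) fun z hz =>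
        (hFg g ⟨CompositeSpace.mk z, hz⟩).trans (h ⟨CompositeSpace.mk z, hz⟩).symm
    let ℓ : C_c({ω : CompositeSpace R₁ L₂ // (compositeRight R₁ hY.commute).mom ω = u}, ℝ) →ₗ[ℝ]
        ℝ :=
      { toFun := fun g => weightedIntegral α β b (F g) u
        map_add' := fun g g' => by
          rw [← weightedIntegral_add hX hY hb (hF g) (hF g')]
          refine huniq _ (Submodule.add_mem _ (hF g) (hF g')) _ fun ω => ?_
          rw [orbitIntegral_add hG₂ hX hY hZ (hF g) (hF g'), hFg, hFg]
          rfl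
        map_smul' := fun s g => by
          refine Eq.trans ?_ (weightedIntegral_smul s (F g) u)
          refine huniq _ (Submodule.smul_mem _ s (hF g)) _ fun ω => ?_
          rw [orbitIntegral_smul, hFg]
          rfl }
    have hℓ : ∀ g, 0 ≤ g → 0 ≤ ℓ g := fun g hg => integral_nonneg fun y =>
      integral_nonneg fun x => mul_nonneg (hF0 g hg _) (hb.pos _).le
    refine ⟨RealRMK.rieszMeasure (PositiveLinearMap.mk₀ ℓ hℓ), inferInstance, fun f hf => ?_⟩
    have h1 := (mem_Cc_iff _).1 (orbitIntegral_fibre_mem_Cc hG₂ hX hY hZ hf u)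
    exact (huniq f hf ⟨⟨_, h1.1⟩, h1.2⟩ fun ω => rfl).symm.trans
      (RealRMK.integral_rieszMeasure (PositiveLinearMap.mk₀ ℓ hℓ) (⟨⟨_, h1.1⟩, h1.2⟩ : C_c({ω : CompositeSpace R₁ L₂ //
        (compositeRight R₁ hY.commute).mom ω = u}, ℝ))).symm
  choose μ hμ h using key
  exact ⟨μ, hμ, fun u f hf hs => h u f ((mem_Cc_iff _).2 ⟨hf, hs⟩)⟩

omit hΔ₂ hb in
theorem IsCompositeFamily.unique
    {μ μ' : ∀ u, Measure {ω : CompositeSpace R₁ L₂ // (compositeRight R₁ hY.commute).mom ω = u}}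
    (hμ : IsCompositeFamily χ₂ hY.commute α β b μ)
    (hμ' : IsCompositeFamily χ₂ hY.commute α β b μ') : μ = μ' := by
  have := hX.locallyCompact.locallyCompactSpace
  have := hY.locallyCompact.locallyCompactSpace
  have hR := hX.right_continuous
  have hL := hY.left_continuous
  have hr := χ₂.isOpenMap_rng hG₂
  have := CompositeSpace.t2Space hR hL hr hX.proper
  have := CompositeSpace.locallyCompactSpace hR hL hr
  funext u
  have := (isClosedEmbedding_fibre
    (continuous_compositeRight_mom hG₂ hX hY) u).locallyCompactSpace
  have := hμ.regular u
  have := hμ'.regular u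
  refine Measure.ext_of_integral_eq_on_compactlySupported fun g => ?_
  obtain ⟨f, hf, hfg, -⟩ := exists_orbitIntegral_fibre_eq hG₂ hX hY hZ
    ((mem_Cc_iff _).2 ⟨g.continuous, g.hasCompactSupport⟩)
  have h1 := (mem_Cc_iff _).1 hf
  have h2 := fun m : Measure _ => integral_congr_ae (μ := m) (Eventually.of_forall hfg)
  exact ((h2 _).symm.trans (hμ.disintegration u f h1.1 h1.2).symm).trans
    ((hμ'.disintegration u f h1.1 h1.2).trans (h2 _))

end CompositeMeasure

/-! ### The bispace structure of `Ω`. -/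

section CompositeBispace

open Set Filter Topology CompactlySupported

set_option linter.unusedSectionVars false

variable {G₁ U₁ G₂ U₂ G₃ U₃ X Y : Type*}
  [TopologicalSpace G₁] [TopologicalSpace U₁] [T2Space U₁]
  [TopologicalSpace G₂] [TopologicalSpace U₂] [T2Space U₂]
  [TopologicalSpace G₃] [TopologicalSpace U₃] [T2Space U₃]
  [MeasurableSpace G₁] [BorelSpace G₁] [MeasurableSpace G₂] [BorelSpace G₂]
  [MeasurableSpace G₃] [BorelSpace G₃]
  [TopologicalSpace X] [T2Space X] [SecondCountableTopology X] [MeasurableSpace X] [BorelSpace X]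
  [TopologicalSpace Y] [T2Space Y] [SecondCountableTopology Y] [MeasurableSpace Y] [BorelSpace Y]
  {𝒢₁ : TopGroupoid G₁ U₁} {𝒢₂ : TopGroupoid G₂ U₂} {𝒢₃ : TopGroupoid G₃ U₃}
  {χ₁ : HaarSystem 𝒢₁} {χ₂ : HaarSystem 𝒢₂} {χ₃ : HaarSystem 𝒢₃}
  {L₁ : LeftAction 𝒢₁ X} {R₁ : RightAction 𝒢₂ X} {α : ∀ v, Measure {x : X // R₁.mom x = v}}
  {L₂ : LeftAction 𝒢₂ Y} {R₂ : RightAction 𝒢₃ Y} {β : ∀ u, Measure {y : Y // R₂.mom y = u}}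

variable [LocallyCompactSpace X] [LocallyCompactSpace Y]

theorem IsOpenQuotientMap.subtype {A B : Type*} [TopologicalSpace A] [TopologicalSpace B]
    {q : A → B} (hq : IsOpenQuotientMap q) (P : B → Prop) :
    IsOpenQuotientMap (fun a : {a // P (q a)} => (⟨q a, a.2⟩ : {b // P b})) := by
  refine ⟨?_, (hq.continuous.comp continuous_subtype_val).subtype_mk _,
    hq.isOpenMap.restrictPreimage {b | P b}⟩
  rintro ⟨b, hb⟩
  obtain ⟨a, rfl⟩ := hq.surjective b
  exact ⟨⟨a, hb⟩, rfl⟩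

/-- Openness is essential here: open quotient maps are stable under products and under restriction
to saturated subspaces, which lets continuity on `G₁ ⋉ Ω` be checked on `G₁ ⋉ Z`. -/
theorem isOpenQuotientMap_leftArrows (hR : R₁.IsContinuous) (hL : L₂.IsContinuous)
    (hr : IsOpenMap 𝒢₂.rng) (c : ActionsCommute L₁ R₁) :
    IsOpenQuotientMap (fun a : {a : G₁ × FibreProduct R₁ L₂ // 𝒢₁.src a.1 = L₁.mom a.2.1.1} =>
      (⟨(a.1.1, CompositeSpace.mk a.1.2), a.2⟩ : (compositeLeft c L₂).Arrows)) :=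
  (IsOpenQuotientMap.id.prodMap (CompositeSpace.isOpenQuotientMap_mk hR hL hr)).subtype
    (fun a => 𝒢₁.src a.1 = (compositeLeft c L₂).mom a.2)

theorem isOpenQuotientMap_rightArrows (hR : R₁.IsContinuous) (hL : L₂.IsContinuous)
    (hr : IsOpenMap 𝒢₂.rng) (c : ActionsCommute L₂ R₂) :
    IsOpenQuotientMap (fun a : {a : FibreProduct R₁ L₂ × G₃ // R₂.mom a.1.1.2 = 𝒢₃.rng a.2} =>
      (⟨(CompositeSpace.mk a.1.1, a.1.2), a.2⟩ : (compositeRight R₁ c).Arrows)) :=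
  ((CompositeSpace.isOpenQuotientMap_mk hR hL hr).prodMap IsOpenQuotientMap.id).subtype
    (fun a => (compositeRight R₁ c).mom a.1 = 𝒢₃.rng a.2)

theorem compositeLeft_isContinuous (hR : R₁.IsContinuous) (hL : L₂.IsContinuous)
    (hr : IsOpenMap 𝒢₂.rng) (c : ActionsCommute L₁ R₁) (hL₁ : L₁.IsContinuous) :
    (compositeLeft c L₂).IsContinuous where
  continuous_mom := by
    have hq := CompositeSpace.isOpenQuotientMap_mk hR hL hr
    rw [hq.isQuotientMap.continuous_iff]
    exact hL₁.continuous_mom.comp (by fun_prop : Continuous fun z : FibreProduct R₁ L₂ => z.1.1)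
  continuous_act := by
    have hq := CompositeSpace.isOpenQuotientMap_mk hR hL hr
    rw [(isOpenQuotientMap_leftArrows hR hL hr c).isQuotientMap.continuous_iff]
    exact hq.continuous.comp (Continuous.subtype_mk (Continuous.prodMk
      (hL₁.continuous_act_of (by fun_prop) (by fun_prop) fun a => a.2) (by fun_prop)) _)

theorem compositeRight_isContinuous (hR : R₁.IsContinuous) (hL : L₂.IsContinuous)
    (hr : IsOpenMap 𝒢₂.rng) (c : ActionsCommute L₂ R₂) (hR₂ : R₂.IsContinuous) :
    (compositeRight R₁ c).IsContinuous where
  continuous_mom := by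
    have hq := CompositeSpace.isOpenQuotientMap_mk hR hL hr
    rw [hq.isQuotientMap.continuous_iff]
    exact hR₂.continuous_mom.comp (by fun_prop : Continuous fun z : FibreProduct R₁ L₂ => z.1.2)
  continuous_act := by
    have hq := CompositeSpace.isOpenQuotientMap_mk hR hL hr
    rw [(isOpenQuotientMap_rightArrows hR hL hr c).isQuotientMap.continuous_iff]
    exact hq.continuous.comp (Continuous.subtype_mk (Continuous.prodMk (by fun_prop)
      (hR₂.continuous_act_of (by fun_prop) (by fun_prop) fun a => a.2)) _)

theorem compositeActions_commute (c : ActionsCommute L₁ R₁) (c' : ActionsCommute L₂ R₂) :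
    ActionsCommute (compositeLeft c L₂) (compositeRight R₁ c') where
  mom_left ω := by
    induction ω using Quotient.inductionOn with | _ z
    exact fun _ _ => rfl
  mom_right g ω := by
    induction ω using Quotient.inductionOn with | _ z
    exact fun _ => rfl
  act_act g ω := by
    induction ω using Quotient.inductionOn with | _ z
    exact fun _ _ _ => rfl

/-- The right action of `G₃` on the composite space is proper. -/
theorem compositeRight_isProper (hR : R₁.IsContinuous) (hL : L₂.IsContinuous)
    (hr : IsOpenMap 𝒢₂.rng) (hP : R₁.IsProper) (c : ActionsCommute L₂ R₂) (hR₂ : R₂.IsContinuous)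
    (hP₂ : R₂.IsProper) : (compositeRight R₁ c).IsProper := by
  have := CompositeSpace.t2Space hR hL hr hP
  have := CompositeSpace.locallyCompactSpace hR hL hr
  have := locallyCompactSpace_fibreProduct hR hL
  have hq := CompositeSpace.isOpenQuotientMap_mk hR hL hr
  have hcR := compositeRight_isContinuous hR hL hr c hR₂
  have hcont : Continuous fun p : (compositeRight R₁ c).Arrows =>
      (p.1.1, (compositeRight R₁ c).act p.1.1 p.1.2 p.2) :=
    Continuous.prodMk (by fun_prop) hcR.continuous_act
  rw [RightAction.IsProper, isProperMap_iff_isCompact_preimage]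
  refine ⟨hcont, fun K hK => ?_⟩
  -- Both projections of `K` are covered by images of compact subsets of `Z`, so the argument can
  -- use properness on `X` and on `Y`.
  obtain ⟨K₁, hK₁, h₁⟩ := hq.exists_isCompact_image_eq (hK.image continuous_fst)
  obtain ⟨K₂, hK₂, h₂⟩ := hq.exists_isCompact_image_eq (hK.image continuous_snd)
  have cx : Continuous fun z : FibreProduct R₁ L₂ => z.1.1 := by fun_prop
  have cy : Continuous fun z : FibreProduct R₁ L₂ => z.1.2 := by fun_prop
  -- the arrows of `X` that move the first components of `K₁` to those of `K₂`
  have hP' := hP.isCompact_preimage ((hK₁.image cx).prod (hK₂.image cx))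
  -- the translates of the second components of `K₂` by these arrows
  let M := {a : R₁.Arrows × Y // 𝒢₂.src a.1.1.2 = L₂.mom a.2}
  have hM : IsClosedEmbedding (Subtype.val : M → R₁.Arrows × Y) :=
    IsClosed.isClosedEmbedding_subtypeVal (isClosed_eq
      (𝒢₂.continuous_src.comp (by fun_prop)) (hL.continuous_mom.comp continuous_snd))
  have hK₃ := (hM.isCompact_preimage (hP'.prod (hK₂.image cy))).image
    (f := fun a : M => L₂.act a.1.1.1.2 a.1.2 a.2)
    (hL.continuous_act_of (by fun_prop) (by fun_prop) _)
  -- Properness on `Y` now confines the elements of `G₃` that move the second components of `K₁`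
  -- into these translates.
  have hV := hP₂.isCompact_preimage ((hK₁.image cy).prod hK₃)
  let N := {a : FibreProduct R₁ L₂ × R₂.Arrows // a.1.1.2 = a.2.1.1}
  have hN : IsClosedEmbedding (Subtype.val : N → FibreProduct R₁ L₂ × R₂.Arrows) :=
    IsClosed.isClosedEmbedding_subtypeVal (isClosed_eq (by fun_prop) (by fun_prop))
  have hS := (hN.isCompact_preimage (hK₁.prod hV)).image
    (f := fun a : N => (⟨(CompositeSpace.mk a.1.1, a.1.2.1.2),
      (congrArg R₂.mom a.2).trans a.1.2.2⟩ : (compositeRight R₁ c).Arrows))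
    (Continuous.subtype_mk ((hq.continuous.comp (by fun_prop)).prodMk (by fun_prop)) _)
  refine hS.of_isClosed_subset (hK.isClosed.preimage hcont) ?_
  rintro ⟨⟨ω, g⟩, p⟩ ha
  obtain ⟨z, hz, rfl⟩ := h₁ ⟨_, ha, rfl⟩
  obtain ⟨z', hz', e⟩ := h₂ ⟨_, ha, rfl⟩
  have hp : R₂.mom z.1.2 = 𝒢₃.rng g := p
  obtain ⟨γ, q, rfl⟩ := Quotient.exact e.symm
  refine ⟨⟨(z, ⟨(z.1.2, g), hp⟩), rfl⟩, ⟨hz, ⟨_, hz, rfl⟩, ?_⟩, rfl⟩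
  -- The representative in `K₂` is `(x γ, γ⁻¹ (y g))`. Acting with `γ` on its second component
  -- recovers `y g`, which therefore lies in the compact set of translates.
  have hs : 𝒢₂.src (𝒢₂.inv γ) = L₂.mom (R₂.act z.1.2 g hp) :=
    (𝒢₂.src_inv γ).trans (q.symm.trans (z.2.trans (c.mom_left _ _ _).symm))
  refine ⟨⟨(⟨(z.1.1, γ), q⟩, L₂.act (𝒢₂.inv γ) (R₂.act z.1.2 g hp) hs),
    ((L₂.mom_act _ _ _).trans (𝒢₂.rng_inv γ)).symm⟩, ⟨⟨⟨_, hz, rfl⟩, ⟨_, hz', rfl⟩⟩,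
    ⟨_, hz', rfl⟩⟩, ?_⟩
  exact L₂.act_inv _ _ _ _

end CompositeBispace

/-! ### Continuity, full support and invariance of `μ`. -/

section CompositeFamily

open Set Filter Topology CompactlySupported

set_option linter.unusedSectionVars false

variable {G₁ U₁ G₂ U₂ G₃ U₃ X Y : Type*}
  [TopologicalSpace G₁] [TopologicalSpace U₁] [T2Space U₁]
  [TopologicalSpace G₂] [TopologicalSpace U₂] [T2Space U₂]
  [TopologicalSpace G₃] [TopologicalSpace U₃] [T2Space U₃]
  [MeasurableSpace G₁] [BorelSpace G₁] [MeasurableSpace G₂] [BorelSpace G₂]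
  [MeasurableSpace G₃] [BorelSpace G₃]
  [TopologicalSpace X] [T2Space X] [SecondCountableTopology X] [MeasurableSpace X] [BorelSpace X]
  [TopologicalSpace Y] [T2Space Y] [SecondCountableTopology Y] [MeasurableSpace Y] [BorelSpace Y]
  {𝒢₁ : TopGroupoid G₁ U₁} {𝒢₂ : TopGroupoid G₂ U₂} {𝒢₃ : TopGroupoid G₃ U₃}
  {χ₁ : HaarSystem 𝒢₁} {χ₂ : HaarSystem 𝒢₂} {χ₃ : HaarSystem 𝒢₃}
  {L₁ : LeftAction 𝒢₁ X} {R₁ : RightAction 𝒢₂ X} {α : ∀ v, Measure {x : X // R₁.mom x = v}}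
  {L₂ : LeftAction 𝒢₂ Y} {R₂ : RightAction 𝒢₃ Y} {β : ∀ u, Measure {y : Y // R₂.mom y = u}}

/-- The right action `(x, y) η = (x, y η)` of `G₃` on `Z`. -/
def fibreProductRight (R₁ : RightAction 𝒢₂ X) (c : ActionsCommute L₂ R₂) :
    RightAction 𝒢₃ (FibreProduct R₁ L₂) where
  mom z := R₂.mom z.1.2
  act z η p := ⟨(z.1.1, R₂.act z.1.2 η p), z.2.trans (c.mom_left _ _ _).symm⟩
  mom_act _ _ _ := R₂.mom_act _ _ _
  act_unit _ := Subtype.ext (Prod.ext rfl (R₂.act_unit _))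
  act_mul _ _ _ _ _ := Subtype.ext (Prod.ext rfl (R₂.act_mul _ _ _ _ _))

theorem fibreProductRight_isContinuous (c : ActionsCommute L₂ R₂) (hR₂ : R₂.IsContinuous) :
    (fibreProductRight R₁ c).IsContinuous where
  continuous_mom := hR₂.continuous_mom.comp (by fun_prop)
  continuous_act := Continuous.subtype_mk (Continuous.prodMk (by fun_prop)
    (hR₂.continuous_act_of (by fun_prop) (by fun_prop) fun a => a.2)) _

/-- The measures `b m_u` are invariant under the action of `G₃` on `Z`. -/
theorem weightedIntegral_translate {Δ₂ : L₂.Arrows → ℝ} {c : ActionsCommute L₂ R₂}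
    {b : FibreProduct R₁ L₂ → ℝ} (hb : IsTrivializingCochain R₁ c Δ₂ b)
    (hR₂ : R₂.IsContinuous) (hβ : R₂.IsInvariant β) (η : G₃) {f f' : FibreProduct R₁ L₂ → ℝ}
    (h : ∀ (z : FibreProduct R₁ L₂) (p : R₂.mom z.1.2 = 𝒢₃.rng η),
      f' z = f ((fibreProductRight R₁ c).act z η p)) :
    weightedIntegral α β b f' (𝒢₃.rng η) = weightedIntegral α β b f (𝒢₃.src η) := by
  refine Eq.trans ?_ (hβ.integral_translate hR₂ η rfl rfl _).symm
  refine integral_congr_ae (Eventually.of_forall fun y => ?_)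
  refine Eq.trans ?_ (pullIntegral_map (ν := α)
    (p := fun y : {y : Y // R₂.mom y = 𝒢₃.src η} => L₂.mom y)
    (p' := fun y : {y : Y // R₂.mom y = 𝒢₃.rng η} => L₂.mom y)
    (R₂.translate η) (fun t => c.mom_left _ _ _)
    (fun a => f (fibreMk a) * b (fibreMk a)) y).symm
  refine integral_congr_ae (Eventually.of_forall fun x => ?_)
  exact congrArg₂ (· * ·) (h ⟨(x, y), x.2⟩ y.2) (hb.invariant ⟨(x, y), x.2⟩ η y.2).symm

/-- The actions of `G₂` and `G₃` on `Z` commute, and `G₂`-orbits stay in one fibre over the units of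
`G₃`; so `f'` need only be a translate of `f` over `r(η)`. -/
theorem orbitIntegral_translate {c : ActionsCommute L₂ R₂} (η : G₃)
    {f f' : FibreProduct R₁ L₂ → ℝ}
    (h : ∀ (z : FibreProduct R₁ L₂) (p : R₂.mom z.1.2 = 𝒢₃.rng η),
      f' z = f ((fibreProductRight R₁ c).act z η p)) (ω : CompositeSpace R₁ L₂)
    (p : (compositeRight R₁ c).mom ω = 𝒢₃.rng η) :
    orbitIntegral χ₂ R₁ L₂ f' ω = orbitIntegral χ₂ R₁ L₂ f ((compositeRight R₁ c).act ω η p) := by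
  obtain ⟨z, rfl⟩ : ∃ z, CompositeSpace.mk z = ω := Quotient.mk_surjective ω
  refine integral_congr_ae (Eventually.of_forall fun γ => ?_)
  refine (h _ ((c.mom_right _ _ _).trans p)).trans (congrArg f ?_)
  exact Subtype.ext (Prod.ext rfl (c.act_act _ _ _ _ _))

variable (hG₂ : IsLocallyCompact G₂) (hX : IsTopCorrespondence χ₁ χ₂ L₁ R₁ α)
  (hY : IsTopCorrespondence χ₂ χ₃ L₂ R₂ β) (hZ : T2Space (diagAction R₁ L₂).Arrows)
  {Δ₂ : L₂.Arrows → ℝ}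
  {b : FibreProduct R₁ L₂ → ℝ} (hb : IsTrivializingCochain R₁ hY.commute Δ₂ b)
  {μ : ∀ u, Measure {ω : CompositeSpace R₁ L₂ // (compositeRight R₁ hY.commute).mom ω = u}}
  (hμ : IsCompositeFamily χ₂ hY.commute α β b μ)

include hX hY hb

theorem eq_zero_of_weightedIntegral_eq_zero {f : FibreProduct R₁ L₂ → ℝ} (hf : f ∈ Cc _)
    (h0 : ∀ z, 0 ≤ f z) {u : U₃} (h : weightedIntegral α β b f u = 0) (z : FibreProduct R₁ L₂)
    (hz : R₂.mom z.1.2 = u) : f z = 0 := by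
  have := hY.family.regular u
  have := hY.family.fullSupport u
  have hc := hY.right_continuous.continuous_mom
  have hi := isClosedEmbedding_fibreMk hX.right_continuous hY.left_continuous hc u
  have hnn : ∀ a : Pull (fun y : {y : Y // R₂.mom y = u} => L₂.mom y) R₁.mom,
      0 ≤ f (fibreMk a) * b (fibreMk a) := fun a => mul_nonneg (h0 _) (hb.pos _).le
  have h1 := integral_eq_zero_of_Cc (pullIntegral_weighted_mem_Cc hX hY hb hf u)
    (pullIntegral_nonneg hnn) h ⟨z.1.2, hz⟩
  have h2 := eq_zero_of_pullIntegral_eq_zero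
    (hY.left_continuous.continuous_mom.comp continuous_subtype_val)
    hX.right_continuous.continuous_mom hX.family (fun _ => inferInstance)
    (Cc_mul_continuous (Cc_comp_isClosedEmbedding hf hi) (hb.continuous.comp hi.continuous))
    hnn h1 z.1.1 z.2
  exact (mul_eq_zero.1 h2).resolve_right (hb.pos _).ne'

/-- Integrating first along the pull-back of `α` to `Y` yields a function in `C_c(Y)`, to which
continuity of the family `β` applies. -/
theorem continuous_weightedIntegral {f : FibreProduct R₁ L₂ → ℝ} (hf : f ∈ Cc _) :
    Continuous (weightedIntegral α β b f) := by
  let i : Pull L₂.mom R₁.mom → FibreProduct R₁ L₂ := fun a => ⟨(a.1.2, a.1.1), a.2⟩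
  have hi : IsClosedEmbedding i :=
    (Homeomorph.mk ⟨i, fun z => ⟨(z.1.2, z.1.1), z.2⟩, fun _ => rfl, fun _ => rfl⟩
      (Continuous.subtype_mk (by fun_prop) _)
      (Continuous.subtype_mk (by fun_prop) _)).isClosedEmbedding
  exact hY.family.continuous_integral _ (pullIntegral_mem_Cc hY.locallyCompact hX.locallyCompact
    hY.left_continuous.continuous_mom hX.right_continuous.continuous_mom hX.family
    (fun _ => inferInstance)
    (Cc_mul_continuous (Cc_comp_isClosedEmbedding hf hi) (hb.continuous.comp hi.continuous)))

include hG₂ hZ hμ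

theorem IsCompositeFamily.isContinuousFamily :
    IsContinuousFamily (compositeRight R₁ hY.commute).mom μ := by
  have := hX.locallyCompact.locallyCompactSpace
  have := hY.locallyCompact.locallyCompactSpace
  have hR := hX.right_continuous
  have hL := hY.left_continuous
  have hr := χ₂.isOpenMap_rng hG₂
  have := CompositeSpace.t2Space hR hL hr hX.proper
  have := CompositeSpace.locallyCompactSpace hR hL hr
  have := CompositeSpace.secondCountableTopology hR hL hr
  have hlc := fun u => (isClosedEmbedding_fibre
    (continuous_compositeRight_mom hG₂ hX hY) u).locallyCompactSpace
  refine ⟨hμ.regular, fun u => ?_, fun u => ⟨fun O hO hne h0 => ?_⟩, fun g hg => ?_⟩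
  · have := hμ.regular u
    have := hlc u
    have : IsLocallyFiniteMeasure (μ u) := isLocallyFiniteMeasure_of_isFiniteMeasureOnCompacts
    have := (IsEmbedding.subtypeVal (p := fun ω : CompositeSpace R₁ L₂ =>
      (compositeRight R₁ hY.commute).mom ω = u)).secondCountableTopology
    exact sigmaFinite_of_locallyFinite
  · obtain ⟨ω, hω⟩ := hne
    obtain ⟨k, hk, hk0, hk1, hkO⟩ := exists_Cc_bump IsLocallyCompact.of_locallyCompactSpace hO hω
    -- A bump function in a null open set is the orbit integral of some `f ≥ 0` with `∫ f b dm_u =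
    -- 0`. Full support of `α` and `β` forces `f = 0` over `u`, so the bump function vanishes, a
    -- contradiction.
    obtain ⟨f, hf, hfk, hf0⟩ := exists_orbitIntegral_fibre_eq hG₂ hX hY hZ hk
    have hf' := (mem_Cc_iff _).1 hf
    have h1 : weightedIntegral α β b f u = 0 := by
      refine (hμ.disintegration u f hf'.1 hf'.2).trans (integral_eq_zero_of_ae ?_)
      have : ∀ᵐ ω ∂μ u, ω ∉ O := measure_eq_zero_iff_ae_notMem.1 h0
      filter_upwards [this] with ω hω
      rw [hfk, hkO ω hω]
      rfl
    have h2 := eq_zero_of_weightedIntegral_eq_zero hX hY hb hf (hf0 hk0) h1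
    obtain ⟨z, hz⟩ : ∃ z, CompositeSpace.mk z = ω.1 := Quotient.mk_surjective _
    have h3 : orbitIntegral χ₂ R₁ L₂ f (CompositeSpace.mk z) = 0 := by
      refine integral_eq_zero_of_ae (Eventually.of_forall fun γ => h2 _ ?_)
      refine (hY.commute.mom_right _ _ _).trans ?_
      exact (congrArg (compositeRight R₁ hY.commute).mom hz).trans ω.2
    rw [hz, hfk, hk1] at h3
    exact one_ne_zero h3
  · obtain ⟨f, hf, rfl, -⟩ := exists_orbitIntegral_eq χ₂ hG₂ hR hL hX.proper hZ hg
    have hf' := (mem_Cc_iff _).1 hf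
    exact (continuous_weightedIntegral hX hY hb hf).congr fun u =>
      hμ.disintegration u f hf'.1 hf'.2

theorem IsCompositeFamily.isInvariant : (compositeRight R₁ hY.commute).IsInvariant μ := by
  intro η
  have := hX.locallyCompact.locallyCompactSpace
  have := hY.locallyCompact.locallyCompactSpace
  have hR := hX.right_continuous
  have hL := hY.left_continuous
  have hr := χ₂.isOpenMap_rng hG₂
  have := CompositeSpace.t2Space hR hL hr hX.proper
  have := CompositeSpace.locallyCompactSpace hR hL hr
  have := locallyCompactSpace_fibreProduct hR hL
  have := (isClosedEmbedding_fibre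
    (continuous_compositeRight_mom hG₂ hX hY) (𝒢₃.src η)).locallyCompactSpace
  have hcR := compositeRight_isContinuous hR hL hr hY.commute hY.right_continuous
  have hcZ := fibreProductRight_isContinuous (R₁ := R₁) hY.commute hY.right_continuous
  have := hμ.regular (𝒢₃.rng η)
  have := hμ.regular (𝒢₃.src η)
  have : ((μ (𝒢₃.rng η)).map ((compositeRight R₁ hY.commute).translate η)).Regular :=
    Measure.Regular.map (RightAction.translateHomeo hcR η)
  refine Measure.ext_of_integral_eq_on_compactlySupported fun g => ?_
  obtain ⟨f, hf, hfg, -⟩ := exists_orbitIntegral_fibre_eq hG₂ hX hY hZ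
    ((mem_Cc_iff _).2 ⟨g.continuous, g.hasCompactSupport⟩)
  -- Translation by `η` is defined only on the closed fibre of `Z` over `r(η)`; the translate of `f`
  -- is extended from there to a test function on `Z`.
  obtain ⟨f', hf', h⟩ := Cc_exists_extension IsLocallyCompact.of_locallyCompactSpace
    (isClosedEmbedding_fibre hcZ.continuous_mom (𝒢₃.rng η))
    (Cc_comp_isClosedEmbedding hf ((isClosedEmbedding_fibre hcZ.continuous_mom (𝒢₃.src η)).comp
      (RightAction.translateHomeo hcZ η).isClosedEmbedding))
  have h' : ∀ (z : FibreProduct R₁ L₂) (p : R₂.mom z.1.2 = 𝒢₃.rng η),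
      f' z = f ((fibreProductRight R₁ hY.commute).act z η p) := fun z p => h ⟨z, p⟩
  have h1 := (mem_Cc_iff _).1 hf
  have h2 := (mem_Cc_iff _).1 hf'
  refine ((RightAction.translateHomeo hcR η).measurableEmbedding.integral_map _).trans ?_
  refine (integral_congr_ae (Eventually.of_forall fun ω => ?_)).trans
    ((hμ.disintegration _ f' h2.1 h2.2).symm.trans ((weightedIntegral_translate hb
      hY.right_continuous hY.invariant η h').trans ((hμ.disintegration _ f h1.1 h1.2).trans
        (integral_congr_ae (Eventually.of_forall hfg)))))
  exact ((hfg _).symm.trans (orbitIntegral_translate η h' ω.1 ω.2).symm)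

end CompositeFamily

/-! ### The cocycle `Δ₁₂` on `G₁ ⋉ Ω`. -/

section CompositeAdjoiningFunction

open Set Filter Topology

set_option linter.unusedSectionVars false

variable {G₁ U₁ G₂ U₂ G₃ U₃ X Y : Type*}
  [TopologicalSpace G₁] [TopologicalSpace U₁] [T2Space U₁]
  [TopologicalSpace G₂] [TopologicalSpace U₂] [T2Space U₂]
  [TopologicalSpace G₃] [TopologicalSpace U₃] [T2Space U₃]
  [MeasurableSpace G₁] [BorelSpace G₁] [MeasurableSpace G₂] [BorelSpace G₂]
  [MeasurableSpace G₃] [BorelSpace G₃]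
  [TopologicalSpace X] [T2Space X] [SecondCountableTopology X] [MeasurableSpace X] [BorelSpace X]
  [TopologicalSpace Y] [T2Space Y] [SecondCountableTopology Y] [MeasurableSpace Y] [BorelSpace Y]
  {𝒢₁ : TopGroupoid G₁ U₁} {𝒢₂ : TopGroupoid G₂ U₂} {𝒢₃ : TopGroupoid G₃ U₃}
  {χ₁ : HaarSystem 𝒢₁} {χ₂ : HaarSystem 𝒢₂} {χ₃ : HaarSystem 𝒢₃}
  {L₁ : LeftAction 𝒢₁ X} {R₁ : RightAction 𝒢₂ X} {α : ∀ v, Measure {x : X // R₁.mom x = v}}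
  {L₂ : LeftAction 𝒢₂ Y} {R₂ : RightAction 𝒢₃ Y} {β : ∀ u, Measure {y : Y // R₂.mom y = u}}

/-- The left action `η (x, y) = (η x, y)` of `G₁` on `Z`. -/
def fibreProductLeft (c : ActionsCommute L₁ R₁) (L₂ : LeftAction 𝒢₂ Y) :
    LeftAction 𝒢₁ (FibreProduct R₁ L₂) where
  mom z := L₁.mom z.1.1
  act η z p := ⟨(L₁.act η z.1.1 p, z.1.2), (c.mom_right _ _ _).trans z.2⟩
  mom_act _ _ _ := L₁.mom_act _ _ _
  unit_act _ := Subtype.ext (Prod.ext (L₁.unit_act _) rfl)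
  mul_act _ _ _ _ _ := Subtype.ext (Prod.ext (L₁.mul_act _ _ _ _ _) rfl)

theorem fibreProductLeft_isContinuous (c : ActionsCommute L₁ R₁) (hL₁ : L₁.IsContinuous) :
    (fibreProductLeft c L₂).IsContinuous where
  continuous_mom := hL₁.continuous_mom.comp (by fun_prop)
  continuous_act := Continuous.subtype_mk (Continuous.prodMk
    (hL₁.continuous_act_of (by fun_prop) (by fun_prop) fun a => a.2) (by fun_prop)) _

/-- The arrow `(η, [z])` of `G₁ ⋉ Ω`. -/
def arrowMk (c : ActionsCommute L₁ R₁) (L₂ : LeftAction 𝒢₂ Y) (a : (fibreProductLeft c L₂).Arrows) :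
    (compositeLeft c L₂).Arrows :=
  ⟨(a.1.1, CompositeSpace.mk a.1.2), a.2⟩

/-- `Δ` is given by the formula `Δ(η, [x, y]) = b(η x, y)⁻¹ Δ₁(η, x) b(x, y)`. -/
def IsCompositeCocycle (c : ActionsCommute L₁ R₁) (L₂ : LeftAction 𝒢₂ Y) (Δ₁ : L₁.Arrows → ℝ)
    (b : FibreProduct R₁ L₂ → ℝ) (Δ : (compositeLeft c L₂).Arrows → ℝ) : Prop :=
  ∀ (η : G₁) (z : FibreProduct R₁ L₂) (p : 𝒢₁.src η = L₁.mom z.1.1),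
    Δ ⟨(η, CompositeSpace.mk z), p⟩ =
      (b ⟨(L₁.act η z.1.1 p, z.1.2), (c.mom_right _ _ _).trans z.2⟩)⁻¹ * Δ₁ ⟨(η, z.1.1), p⟩ * b z

/-- The formula is constant along `G₂`-orbits: `Δ₁` is `G₂`-invariant, while `b(x, y)` and `b(η x,
y)` are both multiplied by `Δ₂(γ⁻¹, y)`, which does not involve the first coordinate, so their
quotient is unchanged. -/
theorem exists_isCompositeCocycle {c : ActionsCommute L₁ R₁} {c' : ActionsCommute L₂ R₂}
    {Δ₁ : L₁.Arrows → ℝ}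
    (hinv : ∀ (g : G₁) (x : X) (p : 𝒢₁.src g = L₁.mom x) (η : G₂) (q : R₁.mom x = 𝒢₂.rng η),
      Δ₁ ⟨(g, R₁.act x η q), p.trans (c.mom_left _ _ _).symm⟩ = Δ₁ ⟨(g, x), p⟩)
    {Δ₂ : L₂.Arrows → ℝ} {b : FibreProduct R₁ L₂ → ℝ} (hb : IsTrivializingCochain R₁ c' Δ₂ b) :
    ∃ Δ, IsCompositeCocycle c L₂ Δ₁ b Δ := by
  let φ : (fibreProductLeft c L₂).Arrows → ℝ := fun a =>
    (b ((fibreProductLeft c L₂).act a.1.1 a.1.2 a.2))⁻¹ * Δ₁ ⟨(a.1.1, a.1.2.1.1), a.2⟩ * b a.1.2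
  have hφ : φ.FactorsThrough (arrowMk c L₂) := by
    rintro ⟨⟨η, z⟩, p⟩ ⟨⟨η', z'⟩, p'⟩ h
    obtain rfl : η = η' := congrArg (fun a => a.1.1) h
    obtain ⟨γ, q, rfl⟩ := Quotient.exact (congrArg (fun a => a.1.2) h)
    have h1 := hb.coboundary z γ q
    have h2 := hb.coboundary ((fibreProductLeft c L₂).act η z p) γ ((c.mom_right _ _ _).trans q)
    have h3 : (diagAction R₁ L₂).act ((fibreProductLeft c L₂).act η z p) γ
        ((c.mom_right _ _ _).trans q) =
        (fibreProductLeft c L₂).act η ((diagAction R₁ L₂).act z γ q) p' :=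
      Subtype.ext (Prod.ext (c.act_act _ _ _ _ _) rfl)
    rw [h3] at h2
    have h4 := h1.trans h2.symm
    have n1 := (hb.pos z).ne'
    have n2 := (hb.pos ((fibreProductLeft c L₂).act η z p)).ne'
    have n3 := (hb.pos ((fibreProductLeft c L₂).act η ((diagAction R₁ L₂).act z γ q) p')).ne'
    have h5 : Δ₁ ⟨(η, R₁.act z.1.1 γ q), p'⟩ = Δ₁ ⟨(η, z.1.1), p⟩ := hinv η z.1.1 p γ q
    change (b ((fibreProductLeft c L₂).act η z p))⁻¹ * Δ₁ ⟨(η, z.1.1), p⟩ * b z =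
      (b ((fibreProductLeft c L₂).act η ((diagAction R₁ L₂).act z γ q) p'))⁻¹ *
        Δ₁ ⟨(η, R₁.act z.1.1 γ q), p'⟩ * b ((diagAction R₁ L₂).act z γ q)
    rw [h5]
    field_simp at h4 ⊢
    linear_combination (-Δ₁ ⟨(η, z.1.1), p⟩) * h4
  -- Every arrow of `G₁ ⋉ Ω` lifts to `G₁ ⋉ Z`, so the default value `0` is never taken.
  exact ⟨(arrowMk c L₂).extend φ 0, fun η z p => hφ.extend_apply 0 ⟨(η, z), p⟩⟩

section

variable {c : ActionsCommute L₁ R₁} {Δ₁ : L₁.Arrows → ℝ} {b : FibreProduct R₁ L₂ → ℝ}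
  {Δ : (compositeLeft c L₂).Arrows → ℝ} (h : IsCompositeCocycle c L₂ Δ₁ b Δ)

include h

theorem IsCompositeCocycle.continuous [LocallyCompactSpace X] [LocallyCompactSpace Y]
    (hR : R₁.IsContinuous) (hL : L₂.IsContinuous) (hr : IsOpenMap 𝒢₂.rng) (hL₁ : L₁.IsContinuous)
    (hΔ₁ : Continuous Δ₁) (hbc : Continuous b) (hb : ∀ z, 0 < b z) : Continuous Δ := by
  rw [(isOpenQuotientMap_leftArrows hR hL hr c).isQuotientMap.continuous_iff]
  have h1 : Continuous fun a : (fibreProductLeft c L₂).Arrows =>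
      (b ((fibreProductLeft c L₂).act a.1.1 a.1.2 a.2))⁻¹ * Δ₁ ⟨(a.1.1, a.1.2.1.1), a.2⟩ *
        b a.1.2 :=
    (((hbc.comp (fibreProductLeft_isContinuous c hL₁).continuous_act).inv₀ fun a =>
      (hb _).ne').mul (hΔ₁.comp (Continuous.subtype_mk (by fun_prop) _))).mul
      (hbc.comp (by fun_prop))
  exact h1.congr fun a => (h a.1.1 a.1.2 a.2).symm

theorem IsCompositeCocycle.pos (hΔ₁ : ∀ a, 0 < Δ₁ a) (hb : ∀ z, 0 < b z) (a) : 0 < Δ a := by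
  obtain ⟨⟨η, ω⟩, p⟩ := a
  obtain ⟨z, rfl⟩ : ∃ z, CompositeSpace.mk z = ω := Quotient.mk_surjective ω
  rw [h η z p]
  exact mul_pos (mul_pos (inv_pos.2 (hb _)) (hΔ₁ _)) (hb _)

theorem IsCompositeCocycle.isCocycle (hΔ₁ : L₁.IsCocycle Δ₁) (hb : ∀ z, 0 < b z) :
    (compositeLeft c L₂).IsCocycle Δ := by
  intro g k ω q p
  obtain ⟨z, rfl⟩ : ∃ z, CompositeSpace.mk z = ω := Quotient.mk_surjective ω
  have h1 := h (𝒢₁.mul g k q) z ((𝒢₁.src_mul g k q).trans p)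
  have h2 := h g ((fibreProductLeft c L₂).act k z p) (q.trans (L₁.mom_act _ _ _).symm)
  have h3 := h k z p
  have h4 := hΔ₁ g k z.1.1 q p
  have h5 := congrArg b ((fibreProductLeft c L₂).mul_act g k z q p)
  have n1 := (hb ((fibreProductLeft c L₂).act k z p)).ne'
  refine h1.trans (Eq.trans ?_ (congrArg₂ (· * ·) h2 h3).symm)
  refine (congrArg₂ (fun s t => s⁻¹ * t * b z) h5 h4).trans ?_
  change _ = ((b ((fibreProductLeft c L₂).act g ((fibreProductLeft c L₂).act k z p) _))⁻¹ *
    Δ₁ ⟨(g, L₁.act k z.1.1 p), _⟩ * b ((fibreProductLeft c L₂).act k z p)) *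
    ((b ((fibreProductLeft c L₂).act k z p))⁻¹ * Δ₁ ⟨(k, z.1.1), p⟩ * b z)
  field_simp

end

end CompositeAdjoiningFunction

/-! ### Interplay of the `G₁`-integrals with the orbit integrals. -/

section CompositeQuasiInvariance

open Set Filter Topology

set_option linter.unusedSectionVars false

variable {G₁ U₁ G₂ U₂ G₃ U₃ X Y : Type*}
  [TopologicalSpace G₁] [TopologicalSpace U₁] [T2Space U₁]
  [TopologicalSpace G₂] [TopologicalSpace U₂] [T2Space U₂]
  [TopologicalSpace G₃] [TopologicalSpace U₃] [T2Space U₃]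
  [MeasurableSpace G₁] [BorelSpace G₁] [MeasurableSpace G₂] [BorelSpace G₂]
  [MeasurableSpace G₃] [BorelSpace G₃]
  [TopologicalSpace X] [T2Space X] [SecondCountableTopology X] [MeasurableSpace X] [BorelSpace X]
  [TopologicalSpace Y] [T2Space Y] [SecondCountableTopology Y] [MeasurableSpace Y] [BorelSpace Y]
  {𝒢₁ : TopGroupoid G₁ U₁} {𝒢₂ : TopGroupoid G₂ U₂} {𝒢₃ : TopGroupoid G₃ U₃}
  {χ₁ : HaarSystem 𝒢₁} {χ₂ : HaarSystem 𝒢₂} {χ₃ : HaarSystem 𝒢₃}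
  {L₁ : LeftAction 𝒢₁ X} {R₁ : RightAction 𝒢₂ X} {α : ∀ v, Measure {x : X // R₁.mom x = v}}
  {L₂ : LeftAction 𝒢₂ Y} {R₂ : RightAction 𝒢₃ Y} {β : ∀ u, Measure {y : Y // R₂.mom y = u}}

/-- An arrow `γ` ending in `x ∈ X_{r(y)}` is also an arrow ending in `(x, y)`. -/
theorem isClosedEmbedding_fibreProductLeft_inArrows (hR : R₁.IsContinuous) (hL : L₂.IsContinuous)
    (hL₁ : L₁.IsContinuous) (hc : Continuous R₂.mom) (c : ActionsCommute L₁ R₁) {u : U₃}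
    (y : {y : Y // R₂.mom y = u}) :
    IsClosedEmbedding (fun a : (L₁.fibre R₁.mom c.mom_right (L₂.mom y)).InArrows =>
      (⟨(⟨(a.1.1, y), a.1.1.2⟩, a.1.2), a.2⟩ : (fibreProductLeft c L₂).InArrows)) :=
  isClosedEmbedding_pull_comp (p := (fibreProductLeft c L₂).mom)
    (fibreProductLeft_isContinuous c hL₁).continuous_mom 𝒢₁.continuous_rng
    ((isClosedEmbedding_fibreMk hR hL hc u).comp
      (isClosedEmbedding_slice (p := fun y : {y : Y // R₂.mom y = u} => L₂.mom y)
        (hL.continuous_mom.comp continuous_subtype_val) hR.continuous_mom y))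

/-- A test function on `G₁ ⋉ Ω` pulled back to `G₁ ⋉ Z` need not have compact support. This
embedding, closed because `Ω` is Hausdorff, shows that multiplying the pull-back by some `e ∈
C_c(Z)` returns it to `C_c`. -/
theorem isClosedEmbedding_arrow_graph [T2Space (CompositeSpace R₁ L₂)]
    (hq : Continuous (CompositeSpace.mk : FibreProduct R₁ L₂ → CompositeSpace R₁ L₂))
    (c : ActionsCommute L₁ R₁) :
    IsClosedEmbedding (fun a : (fibreProductLeft c L₂).Arrows => (a.1.2, arrowMk c L₂ a)) := by
  let j : FibreProduct R₁ L₂ × (compositeLeft c L₂).Arrows → G₁ × FibreProduct R₁ L₂ :=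
    fun b => (b.2.1.1, b.1)
  have hj : Continuous j := by fun_prop
  have hic : Continuous fun a : (fibreProductLeft c L₂).Arrows => (a.1.2, arrowMk c L₂ a) :=
    Continuous.prodMk (by fun_prop) (Continuous.subtype_mk (Continuous.prodMk (by fun_prop)
      (hq.comp (by fun_prop))) _)
  refine ⟨Topology.IsEmbedding.of_comp hic hj Topology.IsEmbedding.subtypeVal, ?_⟩
  convert isClosed_eq (hq.comp continuous_fst) (by fun_prop : Continuous
    fun b : FibreProduct R₁ L₂ × (compositeLeft c L₂).Arrows => b.2.1.2) using 1
  ext ⟨z, ⟨⟨g, ω⟩, p⟩⟩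
  constructor
  · rintro ⟨a, e⟩
    rw [← e]
    rfl
  · intro e
    obtain rfl : CompositeSpace.mk z = ω := e
    exact ⟨⟨(g, z), p⟩, rfl⟩

theorem orbitIntegral_mk_of_eq (f : FibreProduct R₁ L₂ → ℝ) (z : FibreProduct R₁ L₂) {v : U₂}
    (hv : R₁.mom z.1.1 = v) : orbitIntegral χ₂ R₁ L₂ f (CompositeSpace.mk z) =
      ∫ γ : {γ : G₂ // 𝒢₂.rng γ = v}, f ((diagAction R₁ L₂).act z γ (hv.trans γ.2.symm))
        ∂(χ₂.meas v) := by
  subst hv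
  rfl

/-- The measures `m_u` on `Z` are quasi-invariant under `G₁`. -/
theorem integral_invArrow_fibreProductLeft (hG₁ : IsLocallyCompact G₁)
    (hX : IsTopCorrespondence χ₁ χ₂ L₁ R₁ α) (hY : IsTopCorrespondence χ₂ χ₃ L₂ R₂ β)
    (hΔ₁ : L₁.IsAdjoiningFunction χ₁ R₁.mom α Δ₁) (u : U₃)
    {F : (fibreProductLeft hX.commute L₂).InArrows → ℝ} (hF : F ∈ Cc _) :
    ∫ y : {y : Y // R₂.mom y = u}, ∫ x : {x : X // R₁.mom x = L₂.mom y},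
      pullIntegral χ₁.meas (fibreProductLeft hX.commute L₂).mom
        (fun a => F ((fibreProductLeft hX.commute L₂).invArrow a)) ⟨(x, y), x.2⟩
        ∂(α (L₂.mom y)) ∂(β u) =
    ∫ y : {y : Y // R₂.mom y = u}, ∫ x : {x : X // R₁.mom x = L₂.mom y},
      pullIntegral χ₁.meas (fibreProductLeft hX.commute L₂).mom
        (fun a => F a * Δ₁ (L₁.toArrow ⟨(a.1.1.1.1, a.1.2), a.2⟩)) ⟨(x, y), x.2⟩
        ∂(α (L₂.mom y)) ∂(β u) := by
  refine integral_congr_ae (Eventually.of_forall fun y => ?_)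
  exact ((LeftAction.isAdjoiningFunction_iff hG₁ hX.locallyCompact hX.left_continuous
    hX.right_continuous.continuous_mom hX.commute.mom_right).1 hΔ₁).2.2 (L₂.mom y) _
    (Cc_comp_isClosedEmbedding hF (isClosedEmbedding_fibreProductLeft_inArrows hX.right_continuous
      hY.left_continuous hX.left_continuous hY.right_continuous.continuous_mom hX.commute y))

/-- Integration over `G₂`-orbits commutes with integration over `G₁`. -/
theorem orbitIntegral_pullIntegral (hG₁ : IsLocallyCompact G₁) (hG₂ : IsLocallyCompact G₂)
    (hX : IsTopCorrespondence χ₁ χ₂ L₁ R₁ α) (hY : IsTopCorrespondence χ₂ χ₃ L₂ R₂ β)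
    {e : FibreProduct R₁ L₂ → ℝ} (he : e ∈ Cc _)
    {F : (compositeLeft hX.commute L₂).Arrows → ℝ} (hF : F ∈ Cc _) (z : FibreProduct R₁ L₂) :
    orbitIntegral χ₂ R₁ L₂ (pullIntegral χ₁.meas (fibreProductLeft hX.commute L₂).mom fun a =>
      e ((fibreProductLeft hX.commute L₂).toArrow a).1.2 * F (arrowMk hX.commute L₂
        ((fibreProductLeft hX.commute L₂).toArrow a))) (CompositeSpace.mk z) =
    pullIntegral χ₁.meas (compositeLeft hX.commute L₂).mom (fun a =>
      orbitIntegral χ₂ R₁ L₂ e ((compositeLeft hX.commute L₂).toArrow a).1.2 *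
        F ((compositeLeft hX.commute L₂).toArrow a)) (CompositeSpace.mk z) := by
  have := hX.locallyCompact.locallyCompactSpace
  have := hY.locallyCompact.locallyCompactSpace
  have hR := hX.right_continuous
  have hL := hY.left_continuous
  have hr := χ₂.isOpenMap_rng hG₂
  have := CompositeSpace.t2Space hR hL hr hX.proper
  have := CompositeSpace.locallyCompactSpace hR hL hr
  have h₁ := 𝒢₁.t2Space_fibre hG₁ (L₁.mom z.1.1)
  have h₂ := 𝒢₂.t2Space_fibre hG₂ (R₁.mom z.1.1)
  have := χ₁.isContinuousFamily.regular (L₁.mom z.1.1)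
  have := χ₂.isContinuousFamily.regular (R₁.mom z.1.1)
  have hcL := compositeLeft_isContinuous hR hL hr hX.commute hX.left_continuous
  have hcZ := fibreProductLeft_isContinuous (L₂ := L₂) hX.commute hX.left_continuous
  have hd := diagAction_isContinuous hR hL
  have he' := (mem_Cc_iff _).1 he
  -- the arrow `γ` ending in `z`
  let s : {γ : G₁ // 𝒢₁.rng γ = L₁.mom z.1.1} → FibreProduct R₁ L₂ := fun γ =>
    (fibreProductLeft hX.commute L₂).act (𝒢₁.inv γ) z ((𝒢₁.src_inv _).trans γ.2)
  have hs : Continuous s := hcZ.continuous_act_of (𝒢₁.continuous_inv.comp (by fun_prop))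
    (by fun_prop) _
  have hsm : ∀ γ, R₁.mom (s γ).1.1 = R₁.mom z.1.1 := fun γ => hX.commute.mom_right _ _ _
  let φ : {γ : G₁ // 𝒢₁.rng γ = L₁.mom z.1.1} → ℝ := fun γ =>
    F ((compositeLeft hX.commute L₂).toArrow ⟨(CompositeSpace.mk z, γ), γ.2⟩)
  have hφ : φ ∈ Cc _ := Cc_comp_isClosedEmbedding hF (hcL.isClosedEmbedding_toArrow.comp
    (isClosedEmbedding_slice hcL.continuous_mom 𝒢₁.continuous_rng (CompositeSpace.mk z)))
  have hφ' := (mem_Cc_iff _).1 hφ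
  let Φ : {γ : G₂ // 𝒢₂.rng γ = R₁.mom z.1.1} → {γ : G₁ // 𝒢₁.rng γ = L₁.mom z.1.1} → ℝ :=
    fun γ₂ γ₁ => e ((diagAction R₁ L₂).act (s γ₁) γ₂ ((hsm γ₁).trans γ₂.2.symm)) * φ γ₁
  have hΦ : Continuous Φ.uncurry :=
    (he'.1.comp (hd.continuous_act_of (hs.comp continuous_snd) (by fun_prop) _)).mul
      (hφ'.1.comp continuous_snd)
  have hΦs : HasCompactSupport Φ.uncurry := by
    -- The start points `s γ₁` with `γ₁` in the support of `φ` form a compact set, and properness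
    -- confines the `γ₂` that move them into the support of `e`.
    have h1 := (isProperMap_diagAction hR hL hX.proper).isCompact_preimage
      ((hφ'.2.isCompact.image hs).prod he'.2.isCompact)
    have h2 := (isClosedEmbedding_fibre 𝒢₂.continuous_rng (R₁.mom z.1.1)).isCompact_preimage
      (h1.image (by fun_prop : Continuous fun a : (diagAction R₁ L₂).Arrows => a.1.2))
    refine HasCompactSupport.intro (h2.prod hφ'.2.isCompact) fun a ha => ?_
    by_cases h : a.2 ∈ tsupport φ
    · refine mul_eq_zero_of_left (image_eq_zero_of_notMem_tsupport fun h' => ha ⟨?_, h⟩) _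
      exact ⟨⟨(s a.2, a.1), (hsm _).trans a.1.2.symm⟩, ⟨⟨_, h, rfl⟩, h'⟩, rfl⟩
    · exact mul_eq_zero_of_right _ (image_eq_zero_of_notMem_tsupport h)
  have hswap := integral_integral_swap_of_hasCompactSupport hΦ hΦs
    (μ := χ₂.meas (R₁.mom z.1.1)) (ν := χ₁.meas (L₁.mom z.1.1))
  refine Eq.trans (integral_congr_ae (Eventually.of_forall fun γ₂ => ?_))
    (hswap.trans (integral_congr_ae (Eventually.of_forall fun γ₁ => ?_)))
  · refine (pullIntegral_map (ν := χ₁.meas) (p' := fun _ => L₁.mom z.1.1)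
      (fun γ₂ : {γ : G₂ // 𝒢₂.rng γ = R₁.mom z.1.1} => (diagAction R₁ L₂).act z γ₂ γ₂.2.symm)
      (fun γ₂ => hX.commute.mom_left _ _ _) _ γ₂).trans ?_
    refine integral_congr_ae (Eventually.of_forall fun γ₁ => ?_)
    have e1 : (fibreProductLeft hX.commute L₂).act (𝒢₁.inv γ₁)
        ((diagAction R₁ L₂).act z γ₂ γ₂.2.symm) ((𝒢₁.src_inv _).trans
          (γ₁.2.trans (hX.commute.mom_left _ _ _).symm)) =
        (diagAction R₁ L₂).act (s γ₁) γ₂ ((hsm γ₁).trans γ₂.2.symm) :=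
      Subtype.ext (Prod.ext (hX.commute.act_act _ _ _ _ _).symm rfl)
    refine congrArg₂ (· * ·) (congrArg e e1) (congrArg F (Subtype.ext (Prod.ext rfl ?_)))
    exact (congrArg CompositeSpace.mk e1).trans
      (Quotient.sound ((diagAction R₁ L₂).orbitSetoid.symm ⟨γ₂, _, rfl⟩))
  · refine (integral_mul_const _ _).trans (congrArg (· * φ γ₁) ?_)
    exact (orbitIntegral_mk_of_eq e (s γ₁) (hsm γ₁)).symm

end CompositeQuasiInvariance

/-! ### Quasi-invariance of `μ` under `G₁`. -/

section CompositeAdjoining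

open Set Filter Topology

set_option linter.unusedSectionVars false

variable {G₁ U₁ G₂ U₂ G₃ U₃ X Y : Type*}
  [TopologicalSpace G₁] [TopologicalSpace U₁] [T2Space U₁]
  [TopologicalSpace G₂] [TopologicalSpace U₂] [T2Space U₂]
  [TopologicalSpace G₃] [TopologicalSpace U₃] [T2Space U₃]
  [MeasurableSpace G₁] [BorelSpace G₁] [MeasurableSpace G₂] [BorelSpace G₂]
  [MeasurableSpace G₃] [BorelSpace G₃]
  [TopologicalSpace X] [T2Space X] [SecondCountableTopology X] [MeasurableSpace X] [BorelSpace X]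
  [TopologicalSpace Y] [T2Space Y] [SecondCountableTopology Y] [MeasurableSpace Y] [BorelSpace Y]
  {𝒢₁ : TopGroupoid G₁ U₁} {𝒢₂ : TopGroupoid G₂ U₂} {𝒢₃ : TopGroupoid G₃ U₃}
  {χ₁ : HaarSystem 𝒢₁} {χ₂ : HaarSystem 𝒢₂} {χ₃ : HaarSystem 𝒢₃}
  {L₁ : LeftAction 𝒢₁ X} {R₁ : RightAction 𝒢₂ X} {α : ∀ v, Measure {x : X // R₁.mom x = v}}
  {L₂ : LeftAction 𝒢₂ Y} {R₂ : RightAction 𝒢₃ Y} {β : ∀ u, Measure {y : Y // R₂.mom y = u}}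

/-- The function `Δ` with `Δ(η, [x, y]) = b(η x, y)⁻¹ Δ₁(η, x) b(x, y)` is adjoining for the family
of measures on the composite space. -/
theorem IsCompositeCocycle.isAdjoiningFunction (hG₁ : IsLocallyCompact G₁)
    (hG₂ : IsLocallyCompact G₂) (hX : IsTopCorrespondence χ₁ χ₂ L₁ R₁ α)
    (hY : IsTopCorrespondence χ₂ χ₃ L₂ R₂ β) (hZ : T2Space (diagAction R₁ L₂).Arrows)
    {Δ₁ : L₁.Arrows → ℝ} (hΔ₁ : L₁.IsAdjoiningFunction χ₁ R₁.mom α Δ₁)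
    {Δ₂ : L₂.Arrows → ℝ} {b : FibreProduct R₁ L₂ → ℝ}
    (hb : IsTrivializingCochain R₁ hY.commute Δ₂ b)
    {μ : ∀ u, Measure {ω : CompositeSpace R₁ L₂ // (compositeRight R₁ hY.commute).mom ω = u}}
    (hμ : IsCompositeFamily χ₂ hY.commute α β b μ)
    {Δ : (compositeLeft hX.commute L₂).Arrows → ℝ}
    (hΔ : IsCompositeCocycle hX.commute L₂ Δ₁ b Δ) :
    (compositeLeft hX.commute L₂).IsAdjoiningFunction χ₁ (compositeRight R₁ hY.commute).mom μ Δ := by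
  have := hX.locallyCompact.locallyCompactSpace
  have := hY.locallyCompact.locallyCompactSpace
  have hR := hX.right_continuous
  have hL := hY.left_continuous
  have hr := χ₂.isOpenMap_rng hG₂
  have := CompositeSpace.t2Space hR hL hr hX.proper
  have := CompositeSpace.locallyCompactSpace hR hL hr
  have := locallyCompactSpace_fibreProduct hR hL
  have hq := CompositeSpace.isOpenQuotientMap_mk hR hL hr
  let LΩ := compositeLeft hX.commute L₂
  let LZ := fibreProductLeft hX.commute L₂
  have hLΩ : LΩ.IsContinuous := compositeLeft_isContinuous hR hL hr hX.commute hX.left_continuous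
  have hLZ : LZ.IsContinuous := fibreProductLeft_isContinuous hX.commute hX.left_continuous
  have hΔc := hΔ.continuous hR hL hr hX.left_continuous hΔ₁.continuous hb.continuous hb.pos
  refine ⟨hΔc, hΔ.pos hΔ₁.pos hb.pos, fun u F hF => ?_⟩
  have hFΔ : (fun a => F a * Δ a) ∈ Cc LΩ.Arrows := Cc_mul_continuous hF hΔc
  obtain ⟨K, hK, hFK⟩ := Cc_exists_compact hF
  -- The cut-off has orbit integral `1` at the source points of all arrows in the support of `F`, so
  -- that `Λ(e) F = F` on `G₁ ⋉ Ω`.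
  obtain ⟨e, he, he1⟩ := exists_orbitIntegral_eq_one χ₂ hG₂ hR hL hX.proper hZ
    (hK.image (by fun_prop : Continuous fun a : LΩ.Arrows => a.1.2))
  have he1' : ∀ a : LΩ.Arrows, orbitIntegral χ₂ R₁ L₂ e a.1.2 * F a = F a := fun a => by
    by_cases ha : a ∈ K
    · rw [he1 _ ⟨a, ha, rfl⟩, one_mul]
    · rw [hFK a ha, mul_zero]
  -- the inner integrals on both sides
  let A : CompositeSpace R₁ L₂ → ℝ := pullIntegral χ₁.meas LΩ.mom fun a =>
    F ⟨(𝒢₁.inv a.1.2, a.1.1), (𝒢₁.src_inv _).trans a.2⟩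
  have hA : A ∈ Cc _ := by
    refine χ₁.pullIntegral_mem_Cc hG₁ IsLocallyCompact.of_locallyCompactSpace hLΩ.continuous_mom ?_
    convert Cc_comp_isClosedEmbedding hF
      (hLΩ.isClosedEmbedding_toArrow.comp hLΩ.isClosedEmbedding_invArrow) using 1
    exact funext fun a => congrArg F (LΩ.toArrow_invArrow a).symm
  have hA1 : ∀ ω, orbitIntegral χ₂ R₁ L₂ e ω * A ω = A ω := fun ω => by
    refine (integral_const_mul _ _).symm.trans ?_
    exact integral_congr_ae (Eventually.of_forall fun γ =>
      he1' ⟨(𝒢₁.inv γ, ω), (𝒢₁.src_inv _).trans γ.2⟩)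
  have heA := (mem_Cc_iff _).1 (Cc_mul_continuous he (((mem_Cc_iff _).1 hA).1.comp hq.continuous))
  let C : FibreProduct R₁ L₂ → ℝ := pullIntegral χ₁.meas LZ.mom fun a =>
    e (LZ.toArrow a).1.2 * (F (arrowMk hX.commute L₂ (LZ.toArrow a)) *
      Δ (arrowMk hX.commute L₂ (LZ.toArrow a)))
  have hprod := fun (F : LΩ.Arrows → ℝ) (hF : F ∈ Cc _) => Cc_comp_isClosedEmbedding
    (Cc_comp_isClosedEmbedding (Cc_prod he hF)
      (isClosedEmbedding_arrow_graph hq.continuous hX.commute)) hLZ.isClosedEmbedding_toArrow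
  have hC := (mem_Cc_iff _).1 (χ₁.pullIntegral_mem_Cc hG₁ IsLocallyCompact.of_locallyCompactSpace
    hLZ.continuous_mom (hprod _ hFΔ) : C ∈ Cc _)
  -- The factor `b` at the source of the arrow serves both sides. After inversion it becomes the
  -- density `b(z)`; in the other integral `b(γ⁻¹ z) Δ₁ = Δ b(z)`. Both sides are thus integrals
  -- against `b m_u`.
  let H : LZ.InArrows → ℝ := fun a => e (LZ.toArrow a).1.2 *
    F (arrowMk hX.commute L₂ (LZ.toArrow a)) * b (LZ.toArrow a).1.2
  have hH : H ∈ Cc _ := Cc_mul_continuous (hprod F hF)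
    (hb.continuous.comp ((by fun_prop : Continuous fun a : LZ.Arrows => a.1.2).comp
      hLZ.continuous_toArrow))
  have key := integral_invArrow_fibreProductLeft hG₁ hX hY hΔ₁ u hH
  have h1 : ∀ z : FibreProduct R₁ L₂, pullIntegral χ₁.meas LZ.mom (fun a => H (LZ.invArrow a)) z =
      e z * A (CompositeSpace.mk z) * b z := fun z => by
    refine Eq.trans (integral_congr_ae (Eventually.of_forall fun γ => ?_))
      ((integral_mul_const _ _).trans (congrArg (· * b z) (integral_const_mul _ _)))
    exact congrArg (fun a : LZ.Arrows => e a.1.2 * F (arrowMk hX.commute L₂ a) * b a.1.2)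
      (LZ.toArrow_invArrow ⟨(z, γ), γ.2⟩)
  have h2 : ∀ z : FibreProduct R₁ L₂, pullIntegral χ₁.meas LZ.mom
      (fun a => H a * Δ₁ (L₁.toArrow ⟨(a.1.1.1.1, a.1.2), a.2⟩)) z = C z * b z := fun z => by
    refine Eq.trans (integral_congr_ae (Eventually.of_forall fun γ => ?_)) (integral_mul_const _ _)
    let a : LZ.InArrows := ⟨(z, γ), γ.2⟩
    have h3 : Δ (arrowMk hX.commute L₂ (LZ.toArrow a)) =
        (b z)⁻¹ * Δ₁ (L₁.toArrow ⟨(z.1.1, γ), γ.2⟩) * b (LZ.toArrow a).1.2 := by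
      refine (hΔ _ _ _).trans (congrArg (fun z' => (b z')⁻¹ * _ * _) ?_)
      exact LZ.act_inv γ z ((𝒢₁.src_inv _).trans γ.2) _
    change e (LZ.toArrow a).1.2 * F (arrowMk hX.commute L₂ (LZ.toArrow a)) * b (LZ.toArrow a).1.2 *
      Δ₁ (L₁.toArrow ⟨(z.1.1, γ), γ.2⟩) = e (LZ.toArrow a).1.2 *
      (F (arrowMk hX.commute L₂ (LZ.toArrow a)) * Δ (arrowMk hX.commute L₂ (LZ.toArrow a))) * b z
    rw [h3]
    have := (hb.pos z).ne'
    field_simp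
  have h4 : ∀ ω, orbitIntegral χ₂ R₁ L₂ C ω = pullIntegral χ₁.meas LΩ.mom
      (fun a => F (LΩ.toArrow a) * Δ (LΩ.toArrow a)) ω := fun ω => by
    obtain ⟨z, rfl⟩ : ∃ z, CompositeSpace.mk z = ω := Quotient.mk_surjective ω
    refine (orbitIntegral_pullIntegral hG₁ hG₂ hX hY he hFΔ z).trans ?_
    refine integral_congr_ae (Eventually.of_forall fun γ => ?_)
    exact (mul_assoc _ _ _).symm.trans (congrArg (· * _) (he1' _))
  -- Disintegration lifts the left side to `Z`, quasi-invariance of `α` is applied there, and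
  -- disintegration descends again.
  calc ∫ ω : {ω : CompositeSpace R₁ L₂ // (compositeRight R₁ hY.commute).mom ω = u}, A ω ∂(μ u)
      = ∫ ω : {ω : CompositeSpace R₁ L₂ // (compositeRight R₁ hY.commute).mom ω = u},
          orbitIntegral χ₂ R₁ L₂ (fun z => e z * A (CompositeSpace.mk z)) ω ∂(μ u) :=
        integral_congr_ae (Eventually.of_forall fun ω =>
          ((orbitIntegral_mul_mk χ₂ e A ω.1).trans (hA1 ω.1)).symm)
    _ = weightedIntegral α β b (fun z => e z * A (CompositeSpace.mk z)) u :=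
        (hμ.disintegration u _ heA.1 heA.2).symm
    _ = weightedIntegral α β b C u := by
        refine Eq.trans (integral_congr_ae (Eventually.of_forall fun y => integral_congr_ae
          (Eventually.of_forall fun x => (h1 ⟨(x, y), x.2⟩).symm))) (key.trans
          (integral_congr_ae (Eventually.of_forall fun y => integral_congr_ae
            (Eventually.of_forall fun x => h2 ⟨(x, y), x.2⟩))))
    _ = ∫ ω : {ω : CompositeSpace R₁ L₂ // (compositeRight R₁ hY.commute).mom ω = u},
          orbitIntegral χ₂ R₁ L₂ C ω ∂(μ u) := hμ.disintegration u C hC.1 hC.2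
    _ = ∫ ω : {ω : CompositeSpace R₁ L₂ // (compositeRight R₁ hY.commute).mom ω = u},
          pullIntegral χ₁.meas LΩ.mom (fun a => F (LΩ.toArrow a) * Δ (LΩ.toArrow a)) ω ∂(μ u) :=
        integral_congr_ae (Eventually.of_forall fun ω => h4 ω.1)

end CompositeAdjoining

/-! ### The proposition. -/

theorem mainTheorem8
    {G₁ U₁ G₂ U₂ G₃ U₃ X Y : Type*}
    [TopologicalSpace G₁] [TopologicalSpace U₁] [T2Space U₁]
    [TopologicalSpace G₂] [TopologicalSpace U₂] [T2Space U₂]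
    [TopologicalSpace G₃] [TopologicalSpace U₃] [T2Space U₃]
    [MeasurableSpace G₁] [BorelSpace G₁] [MeasurableSpace G₂] [BorelSpace G₂]
    [MeasurableSpace G₃] [BorelSpace G₃]
    [TopologicalSpace X] [T2Space X] [SecondCountableTopology X] [MeasurableSpace X] [BorelSpace X]
    [TopologicalSpace Y] [T2Space Y] [SecondCountableTopology Y] [MeasurableSpace Y] [BorelSpace Y]
    {𝒢₁ : TopGroupoid G₁ U₁} {𝒢₂ : TopGroupoid G₂ U₂} {𝒢₃ : TopGroupoid G₃ U₃}
    (hG₁ : IsLocallyCompact G₁) (hG₂ : IsLocallyCompact G₂) (hG₃ : IsLocallyCompact G₃)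
    (χ₁ : HaarSystem 𝒢₁) (χ₂ : HaarSystem 𝒢₂) (χ₃ : HaarSystem 𝒢₃)
    (L₁ : LeftAction 𝒢₁ X) (R₁ : RightAction 𝒢₂ X) (α : ∀ v, Measure {x : X // R₁.mom x = v})
    (hX : IsTopCorrespondence χ₁ χ₂ L₁ R₁ α)
    (L₂ : LeftAction 𝒢₂ Y) (R₂ : RightAction 𝒢₃ Y) (β : ∀ u, Measure {y : Y // R₂.mom y = u})
    (hY : IsTopCorrespondence χ₂ χ₃ L₂ R₂ β)
    (hZ : T2Space (diagAction R₁ L₂).Arrows)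
    (Δ₁ : L₁.Arrows → ℝ) (hΔ₁ : L₁.IsAdjoiningFunction χ₁ R₁.mom α Δ₁)
    (Δ₂ : L₂.Arrows → ℝ) (hΔ₂ : L₂.IsAdjoiningFunction χ₂ R₂.mom β Δ₂) :
    T2Space (CompositeSpace R₁ L₂) ∧ SecondCountableTopology (CompositeSpace R₁ L₂) ∧
    (∃ b : FibreProduct R₁ L₂ → ℝ, IsTrivializingCochain R₁ hY.commute Δ₂ b) ∧
    ∀ b : FibreProduct R₁ L₂ → ℝ, IsTrivializingCochain R₁ hY.commute Δ₂ b →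
      (∃! μ : ∀ u, Measure {ω : CompositeSpace R₁ L₂ // (compositeRight R₁ hY.commute).mom ω = u},
        IsCompositeFamily χ₂ hY.commute α β b μ) ∧
      ∀ μ : ∀ u, Measure {ω : CompositeSpace R₁ L₂ // (compositeRight R₁ hY.commute).mom ω = u},
        IsCompositeFamily χ₂ hY.commute α β b μ →
        IsTopCorrespondence χ₁ χ₃ (compositeLeft hX.commute L₂)
          (compositeRight R₁ hY.commute) μ ∧
        ∃ Δ₁₂ : (compositeLeft hX.commute L₂).Arrows → ℝ,
          (∀ (η : G₁) (z : FibreProduct R₁ L₂) (p : 𝒢₁.src η = L₁.mom z.1.1),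
            Δ₁₂ ⟨(η, CompositeSpace.mk z), p⟩ =
              (b ⟨(L₁.act η z.1.1 p, z.1.2), (hX.commute.mom_right _ _ _).trans z.2⟩)⁻¹ *
                Δ₁ ⟨(η, z.1.1), p⟩ * b z) ∧
          Continuous Δ₁₂ ∧
          (∀ a, 0 < Δ₁₂ a) ∧
          (compositeLeft hX.commute L₂).IsCocycle Δ₁₂ ∧
          ∀ Δ : (compositeLeft hX.commute L₂).Arrows → ℝ,
            (compositeLeft hX.commute L₂).IsAdjoiningFunction χ₁
              (compositeRight R₁ hY.commute).mom μ Δ ↔ Δ = Δ₁₂ := by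
  have := hX.locallyCompact.locallyCompactSpace
  have := hY.locallyCompact.locallyCompactSpace
  have hR := hX.right_continuous
  have hL := hY.left_continuous
  have hr := χ₂.isOpenMap_rng hG₂
  have hT := CompositeSpace.t2Space hR hL hr hX.proper
  have := CompositeSpace.locallyCompactSpace hR hL hr
  refine ⟨hT, CompositeSpace.secondCountableTopology hR hL hr,
    exists_isTrivializingCochain hG₂ hR hX.proper inferInstance hY hZ hΔ₂, fun b hb => ⟨?_, ?_⟩⟩
  · obtain ⟨μ, hμ⟩ := exists_isCompositeFamily hG₂ hX hY hZ hΔ₂ hb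
    exact ⟨μ, hμ, fun μ' hμ' => IsCompositeFamily.unique hG₂ hX hY hZ hμ' hμ⟩
  · intro μ hμ
    -- Well-definedness on `Ω` rests on the `G₂`-invariance of `Δ₁`, itself a consequence of
    -- uniqueness of adjoining functions and the invariance of `α`.
    obtain ⟨Δ, hΔ⟩ := exists_isCompositeCocycle (hΔ₁.act_right hG₁ hX.locallyCompact
      hX.left_continuous hR hX.commute hX.family hX.invariant) hb
    have hadj := hΔ.isAdjoiningFunction hG₁ hG₂ hX hY hZ hΔ₁ hb hμ
    have hLΩ := compositeLeft_isContinuous hR hL hr hX.commute hX.left_continuous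
    have hRΩ := compositeRight_isContinuous hR hL hr hY.commute hY.right_continuous
    have hc := compositeActions_commute hX.commute hY.commute
    have hfam := hμ.isContinuousFamily hG₂ hX hY hZ hb
    refine ⟨⟨IsLocallyCompact.of_locallyCompactSpace, hLΩ, hRΩ, hc,
      compositeRight_isProper hR hL hr hX.proper hY.commute hY.right_continuous hY.proper, hfam,
      hμ.isInvariant hG₂ hX hY hZ hb, Δ, hadj⟩, Δ, hΔ, hadj.continuous, hadj.pos, ?_, fun Δ' =>
      ⟨fun h => h.unique hG₁ IsLocallyCompact.of_locallyCompactSpace hLΩ hRΩ.continuous_mom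
        hc.mom_right hfam hadj, fun h => h ▸ hadj⟩⟩
    exact hΔ.isCocycle (hΔ₁.isCocycle hG₁ hX.locallyCompact hX.left_continuous hR.continuous_mom
      hX.commute.mom_right hX.family) hb.pos
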